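/- **Fractran.** A Fractran program is a finite list $P=\frac{p_1}{q_1},\dots,\frac{p_k}{q_k}$ of fractions of positive integers. Its one-step function is the partial function $f_P$ with $f_P(n)=n\cdot\frac{p_i}{q_i}$ for the first $i$ such that this is an integer, and $f_P(n)$ undefined if there is no such $i$. $P$ halts on $n$ if $f_P^{\,i}(n)$ is undefined for some $i$. **Induced specification.** Let $d=\mathrm{lcm}(q_1,\dots,q_k)$ ($d=1$ if $k=0$). For $1\le n\le d$ let $T_n=\mathsf{mod}_{a}(\mathsf{tail}^{\,b-1}(\mathsf T_P))$ with $a=p_i\cdot(d/q_i)$ and $b=n\cdot\frac{p_i}{q_i}$, where $\frac{p_i}{q_i}$ is the first fraction with $n\cdot\frac{p_i}{q_i}$ an integer, and $T_n=\bullet:\mathsf{mod}_d(\mathsf{tail}^{\,n-1}(\mathsf T_P))$ if there is none. The stream specification $R_P$ is the finite term rewriting system with the symbols $\bullet$ (data element), $:$ (stream constructor), $\mathsf{head}$, $\mathsf{tail}$, $\mathsf{zip}_d$, the stream constant $\mathsf T_P$, and those $\mathsf{mod}_m$ that occur in $T_1,\dots,T_d$, and with the rules $$\mathsf T_P\to\mathsf{zip}_d(T_1,\dots,T_d),\quad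 \mathsf{head}(x:\sigma)\to x,\quad \mathsf{tail}(x:\sigma)\to\sigma,\quad \mathsf{mod}_m(\sigma)\to\mathsf{head}(\sigma):\mathsf{mod}_m(\mathsf{tail}^m(\sigma)),$$ $$\mathsf{zip}_d(\sigma_1,\dots,\sigma_d)\to\mathsf{head}(\sigma_1):\mathsf{zip}_d(\sigma_2,\dots,\sigma_d,\mathsf{tail}(\sigma_1)).$$ A specification is in the lazy stream format if it consists of one rule for the stream constant, whose right-hand side is a ground term over $\bullet$, $:$, $\mathsf{head}$, $\mathsf{tail}$, $\mathsf{mod}_m$, $\mathsf{zip}_m$ ($m\ge1$) and the stream constant, together with the defining rules above of $\mathsf{head}$, $\mathsf{tail}$, $\mathsf{mod}_m$, $\mathsf{zip}_m$. **Productivity.** Let $R$ be a finite term rewriting system. A (history-aware) strategy for $R$ is a subrelation, with the same normal forms, of the rewrite relation of $R$ on pairs of a term and a list of previously applied rules and contracted positions. It is computable if the map from such pairs to their finite sets of successors is computable. An infinite rewrite sequence is outermost-fair if it contains no outermost redex that remains an outermost redex forever without being contracted; a strategy is outermost-fair if all its maximal rewrite sequences (starting from terms with empty history) are; finite ones always are.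 A constructor is a symbol of the signature that is not the root of a left-hand side. A term $t$ is productive in $R$ with respect to a strategy if every maximal rewrite sequence of the strategy from $t$ ends (in its last term if it is finite, in its limit if it is infinite) in a finite or infinite term built solely from constructors. The productivity problem for outermost-fair strategies has as instances the encodings of a finite TRS $R$, a computable outermost-fair strategy for $R$ and a term $t$; the question is whether $t$ is productive with respect to the strategy. **Theorem.** 1. For every Fractran program $P$, the specification $R_P$ is in the lazy stream format, there is a computable outermost-fair strategy for $R_P$, and for every outermost-fair strategy for $R_P$, the stream constant $\mathsf T_P$ is productive with respect to it if and only if $P$ halts on all integers $n>0$. 2. The restriction of the productivity problem for outermost-fair strategies to the systems $R_P$ and terms $\mathsf T_P$, for Fractran programs $P$, is $\Pi^0_2$-complete: on its instances the answer is given by a $\Pi^0_2$ set of codes, and every $\Pi^0_2$ set of natural numbers is many-one reducible to it by a computable function all of whose values are instances. 3. The set of (codes of) the systems $R_P$, for Fractran programs $P$, for which $\mathsf T_P$ is productive with respect to every outermost-fair strategy is $\Pi^0_2$-complete. -/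

import Mathlib

/-! ### Fractran -/

/-- A Fractran program: a finite list of fractions `p / q` with positive integers `p` and `q`,
given as pairs `(p, q)`. -/
abbrev FractranProgram : Type := List (ℕ+ × ℕ+)

namespace FractranProgram

/-- The first fraction `p / q` of the program such that `n * (p / q)` is an integer, if any. -/
def firstFraction (P : FractranProgram) (n : ℕ) : Option (ℕ+ × ℕ+) :=
  P.find? fun x => decide ((x.2 : ℕ) ∣ n * (x.1 : ℕ))

/-- The one-step computation of a Fractran program, a partial function. -/
def step (P : FractranProgram) (n : ℕ) : Option ℕ :=
  (P.firstFraction n).map fun x => n * (x.1 : ℕ) / (x.2 : ℕ)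

/-- The program halts on `n`: some iterate of the one-step function is undefined at `n`. -/
def Halts (P : FractranProgram) (n : ℕ) : Prop :=
  ∃ i : ℕ, (fun o : Option ℕ => o.bind P.step)^[i] (some n) = none

/-- The least common multiple of the denominators. -/
def denomLcm : FractranProgram → ℕ
  | [] => 1
  | x :: P => Nat.lcm (x.2 : ℕ) (denomLcm P)

theorem denomLcm_pos (P : FractranProgram) : 0 < P.denomLcm := by
  induction P with
  | nil => exact Nat.one_pos
  | cons x P ih => exact Nat.lcm_pos x.2.pos ih

end FractranProgram

/-! ### Term rewriting -/

/-- A first-order term over the function symbols of `L` with variables from `ℕ`. -/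
abbrev RTerm (L : FirstOrder.Language.{0, 0}) : Type := L.Term ℕ

/-- A function symbol together with its arity. -/
abbrev FnSym (L : FirstOrder.Language.{0, 0}) : Type := Σ n, L.Functions n

/-- A rewrite rule, given as the pair of its left-hand and its right-hand side. -/
abbrev RRule (L : FirstOrder.Language.{0, 0}) : Type := RTerm L × RTerm L

/-- All function symbols of the term belong to the list `sig`. -/
def TermOver {L : FirstOrder.Language.{0, 0}} (sig : List (FnSym L)) : RTerm L → Prop
  | .var _ => True
  | .func (l := n) f ts => (⟨n, f⟩ : FnSym L) ∈ sig ∧ ∀ i, TermOver sig (ts i)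

/-- A finite term rewriting system: a finite signature and a finite list of rewrite rules
over it, whose left-hand sides are not variables and contain all variables of the
right-hand sides. -/
@[ext]
structure TRS (L : FirstOrder.Language.{0, 0}) where
  sig : List (FnSym L)
  rules : List (RRule L)
  lhs_over : ∀ ρ ∈ rules, TermOver sig ρ.1
  rhs_over : ∀ ρ ∈ rules, TermOver sig ρ.2
  lhs_not_var : ∀ ρ ∈ rules, ∀ x, ρ.1 ≠ .var x
  rhs_vars : ∀ ρ ∈ rules, ρ.2.varFinset ⊆ ρ.1.varFinset

/-- A finite TRS is coded by the lists of its function symbols and of its rules. -/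
noncomputable instance {L : FirstOrder.Language.{0, 0}} [Encodable (FnSym L)] :
    Encodable (TRS L) :=
  Encodable.ofInj (fun R => (R.sig, R.rules)) fun R R' h =>
    TRS.ext (congrArg Prod.fst h) (congrArg Prod.snd h)

/-- `StepAt ρ p s t`: the term `s` rewrites to `t` by an application of the rule `ρ` at the
position `p` (a list of argument indices, counted from `0`). -/
inductive StepAt {L : FirstOrder.Language.{0, 0}} (ρ : RRule L) :
    List ℕ → RTerm L → RTerm L → Prop
  | root (τ : ℕ → RTerm L) : StepAt ρ [] (ρ.1.subst τ) (ρ.2.subst τ)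
  | arg {n : ℕ} (f : L.Functions n) (ts : Fin n → RTerm L) (i : Fin n) (p : List ℕ)
      (t' : RTerm L) : StepAt ρ p (ts i) t' →
      StepAt ρ ((i : ℕ) :: p) (.func f ts) (.func f (Function.update ts i t'))

/-- `s` contains a redex with respect to the rule `ρ` at the position `p`. -/
def IsRedexAt {L : FirstOrder.Language.{0, 0}} (ρ : RRule L) (p : List ℕ) (s : RTerm L) : Prop :=
  ∃ t, StepAt ρ p s t

/-- A finite or infinite term, as a labelling of positions by variables or function symbols. -/
abbrev LabelledTree (L : FirstOrder.Language.{0, 0}) : Type := List ℕ → Option (ℕ ⊕ FnSym L)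

/-- The label of a finite term at a position (`none` if there is no such position). -/
def label {L : FirstOrder.Language.{0, 0}} : RTerm L → LabelledTree L
  | .var x, [] => some (.inl x)
  | .var _, _ :: _ => none
  | .func (l := n) f _, [] => some (.inr ⟨n, f⟩)
  | .func (l := n) _ ts, i :: p => if h : i < n then label (ts ⟨i, h⟩) p else none

/-- The sequence of finite terms `t` converges to the finite or infinite term `s` in the usual
metric on terms: for every depth `k`, almost all `t n` agree with `s` up to depth `k`. -/
def TermLimit {L : FirstOrder.Language.{0, 0}} (t : ℕ → RTerm L) (s : LabelledTree L) : Prop :=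
  ∀ k : ℕ, ∃ N : ℕ, ∀ n ≥ N, ∀ p : List ℕ, p.length ≤ k → label (t n) p = s p

/-- A rewrite history: the list of applied rules and contracted positions, oldest first. -/
abbrev History (L : FirstOrder.Language.{0, 0}) : Type := List (RRule L × List ℕ)

/-- A term together with a rewrite history. -/
abbrev RState (L : FirstOrder.Language.{0, 0}) : Type := RTerm L × History L

namespace TRS

variable {L : FirstOrder.Language.{0, 0}}

/-- A term over the signature together with a history that refers to rules of `R`. -/
def IsState (R : TRS L) (a : RState L) : Prop :=
  TermOver R.sig a.1 ∧ ∀ x ∈ a.2, x.1 ∈ R.rules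

/-- The history-aware rewrite relation: a rewrite step of `R`, which is recorded in the history. -/
def HStep (R : TRS L) (a b : RState L) : Prop :=
  R.IsState a ∧ ∃ ρ ∈ R.rules, ∃ p, StepAt ρ p a.1 b.1 ∧ b.2 = a.2 ++ [(ρ, p)]

/-- A (history-aware, possibly non-deterministic) strategy for `R`: a subrelation of the
history-aware rewrite relation with the same normal forms. Strategies that depend only on the
current term are the special case where the history is ignored. -/
def IsStrategy (R : TRS L) (S : RState L → RState L → Prop) : Prop :=
  (∀ a b, S a b → R.HStep a b) ∧ ∀ a, (∃ b, R.HStep a b) → ∃ b, S a b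

/-- The redex of rule `ρ` at position `p` of `s` is outermost: no redex is strictly above it. -/
def IsOutermostRedex (R : TRS L) (ρ : RRule L) (p : List ℕ) (s : RTerm L) : Prop :=
  IsRedexAt ρ p s ∧ ∀ q, q <+: p → q ≠ p → ∀ ρ' ∈ R.rules, ¬ IsRedexAt ρ' q s

/-- An infinite rewrite sequence is outermost-fair if it has no outermost redex that remains
an outermost redex for ever without being contracted. -/
def OutermostFairSeq (R : TRS L) (a : ℕ → RState L) : Prop :=
  ∀ (n : ℕ), ∀ ρ ∈ R.rules, ∀ p : List ℕ,
    ¬ ∀ m ≥ n, R.IsOutermostRedex ρ p (a m).1 ∧ (a (m + 1)).2 ≠ (a m).2 ++ [(ρ, p)]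

/-- All maximal rewrite sequences of the strategy `S` (from terms over the signature, with empty
history) are outermost-fair. Finite maximal sequences, which end in a normal form, always are. -/
def OutermostFair (R : TRS L) (S : RState L → RState L → Prop) : Prop :=
  ∀ a : ℕ → RState L, TermOver R.sig (a 0).1 → (a 0).2 = [] → (∀ n, S (a n) (a (n + 1))) →
    R.OutermostFairSeq a

/-- A constructor: a symbol of the signature that is not the root of a left-hand side. -/
def IsConstructor (R : TRS L) (f : FnSym L) : Prop :=
  f ∈ R.sig ∧ ∀ ρ ∈ R.rules, label ρ.1 [] ≠ some (.inr f)

/-- A finite or infinite term is a constructor normal form if it is built solely from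
constructors. -/
def ConstructorNF (R : TRS L) (s : LabelledTree L) : Prop :=
  ∀ p x, s p = some x → ∃ f, x = .inr f ∧ R.IsConstructor f

/-- The term `t` is productive in `R` with respect to the strategy `S`: every maximal
`S`-rewrite sequence from `t` ends in a constructor normal form, that is, the last term
(if the sequence is finite) or the limit (if it is infinite) is a constructor normal form. -/
def Productive (R : TRS L) (S : RState L → RState L → Prop) (t : RTerm L) : Prop :=
  (∀ b, Relation.ReflTransGen S (t, []) b → (¬ ∃ c, S b c) → R.ConstructorNF (label b.1)) ∧
  (∀ a : ℕ → RState L, a 0 = (t, []) → (∀ n, S (a n) (a (n + 1))) →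
    ∃ s, TermLimit (fun n => (a n).1) s ∧ R.ConstructorNF s)

/-- The relation coded by `c`: on (the code of) a state `a`, the partial recursive function coded
by `c` returns (the code of) a list `l`, whose elements are the successors of `a`. -/
def codedRel [Encodable (FnSym L)] (R : TRS L) (c : Nat.Partrec.Code) (a b : RState L) : Prop :=
  R.IsState a ∧ ∃ l : List (RState L), Encodable.encode l ∈ c.eval (Encodable.encode a) ∧ b ∈ l

/-- `c` codes a computable outermost-fair strategy for `R`: it computes, for every term over the
signature with a history, the finite list of all successors with respect to the strategy. -/
def CodesOutermostFair [Encodable (FnSym L)] (R : TRS L) (c : Nat.Partrec.Code) : Prop :=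
  (∀ a, R.IsState a →
    ∃ l : List (RState L), Encodable.encode l ∈ c.eval (Encodable.encode a)) ∧
  R.IsStrategy (R.codedRel c) ∧ R.OutermostFair (R.codedRel c)

end TRS

/-! ### The lazy stream format and the specification induced by a Fractran program -/

/-- The symbols of the lazy stream format, indexed by their arities: the data element `pebble`,
the stream constant, `head`, `tail`, the unary `mod k`, the stream constructor `cons`, and the
`k`-ary `zip k`. -/
inductive StreamSymbol : ℕ → Type
  | pebble : StreamSymbol 0
  | const : StreamSymbol 0
  | head : StreamSymbol 1
  | tail : StreamSymbol 1
  | mod (k : ℕ) : StreamSymbol 1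
  | cons : StreamSymbol 2
  | zip (k : ℕ) : StreamSymbol k

/-- The language of the lazy stream format. -/
abbrev StreamLang : FirstOrder.Language.{0, 0} := ⟨StreamSymbol, fun _ => Empty⟩

namespace StreamSymbol

/-- Numbering of the symbols. -/
def toNat : (Σ n, StreamSymbol n) → ℕ
  | ⟨_, pebble⟩ => 0
  | ⟨_, const⟩ => 1
  | ⟨_, head⟩ => 2
  | ⟨_, tail⟩ => 3
  | ⟨_, cons⟩ => 4
  | ⟨_, mod k⟩ => 2 * k + 5
  | ⟨_, zip k⟩ => 2 * k + 6

/-- The inverse of the numbering. -/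
def ofNat : ℕ → Σ n, StreamSymbol n
  | 0 => ⟨_, pebble⟩
  | 1 => ⟨_, const⟩
  | 2 => ⟨_, head⟩
  | 3 => ⟨_, tail⟩
  | 4 => ⟨_, cons⟩
  | n + 5 => if n % 2 = 0 then ⟨_, mod (n / 2)⟩ else ⟨_, zip (n / 2)⟩

theorem ofNat_toNat (f : Σ n, StreamSymbol n) : ofNat (toNat f) = f := by
  obtain ⟨n, f⟩ := f
  cases f with
  | mod k => simp [toNat, ofNat]
  | zip k =>
    have h2 : (2 * n + 1) / 2 = n := by omega
    have h3 : ofNat (2 * n + 1 + 5) = ⟨_, zip ((2 * n + 1) / 2)⟩ := by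
      rw [ofNat, if_neg (by omega)]
    rw [h2] at h3
    exact h3
  | _ => rfl

end StreamSymbol

instance : Encodable (FnSym StreamLang) :=
  Encodable.ofLeftInverse StreamSymbol.toNat StreamSymbol.ofNat StreamSymbol.ofNat_toNat

namespace LSF

/-- Terms over the symbols of the lazy stream format. -/
abbrev STerm : Type := RTerm StreamLang

def pebble : STerm := .func (L := StreamLang) StreamSymbol.pebble Fin.elim0
def const : STerm := .func (L := StreamLang) StreamSymbol.const Fin.elim0
def head (t : STerm) : STerm := .func (L := StreamLang) StreamSymbol.head fun _ => t
def tail (t : STerm) : STerm := .func (L := StreamLang) StreamSymbol.tail fun _ => t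
def mod (k : ℕ) (t : STerm) : STerm := .func (L := StreamLang) (StreamSymbol.mod k) fun _ => t
def cons (s t : STerm) : STerm :=
  .func (L := StreamLang) StreamSymbol.cons fun i => if i = 0 then s else t
def zip (k : ℕ) (ts : Fin k → STerm) : STerm := .func (L := StreamLang) (StreamSymbol.zip k) ts

/-- `tail` applied `n` times. -/
def tailN (n : ℕ) (t : STerm) : STerm := tail^[n] t

/-- `head (x : σ) → x` -/
def headRule : RRule StreamLang := (head (cons (.var 0) (.var 1)), .var 0)

/-- `tail (x : σ) → σ` -/
def tailRule : RRule StreamLang := (tail (cons (.var 0) (.var 1)), .var 1)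

/-- `mod k σ → head σ : mod k (tail^k σ)` -/
def modRule (k : ℕ) : RRule StreamLang :=
  (mod k (.var 0), cons (head (.var 0)) (mod k (tailN k (.var 0))))

/-- `zip k (σ₁, σ₂, …, σₖ) → head σ₁ : zip k (σ₂, …, σₖ, tail σ₁)` -/
def zipRule (k : ℕ) : RRule StreamLang :=
  (zip k fun i => .var i,
    cons (head (.var 0))
      (zip k fun i => if (i : ℕ) + 1 < k then .var ((i : ℕ) + 1) else tail (.var 0)))

/-- `R` is in the lazy stream format: its rules are one rule for the stream constant, whose
right-hand side is a ground term, and the defining rules of `head`, `tail`, `mod k` and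
`zip k` (`k ≥ 1`), including those of all of these symbols that are in the signature. -/
def InFormat (R : TRS StreamLang) : Prop :=
  (∃! t : STerm, (const, t) ∈ R.rules) ∧
  (∀ t : STerm, (const, t) ∈ R.rules → t.varFinset = ∅) ∧
  (∀ ρ ∈ R.rules, ρ.1 = const ∨ ρ = headRule ∨ ρ = tailRule ∨
    ∃ k ≥ 1, ρ = modRule k ∨ ρ = zipRule k) ∧
  ((⟨_, StreamSymbol.head⟩ : FnSym StreamLang) ∈ R.sig → headRule ∈ R.rules) ∧
  ((⟨_, StreamSymbol.tail⟩ : FnSym StreamLang) ∈ R.sig → tailRule ∈ R.rules) ∧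
  (∀ k, (⟨_, StreamSymbol.mod k⟩ : FnSym StreamLang) ∈ R.sig → modRule k ∈ R.rules) ∧
  (∀ k, (⟨_, StreamSymbol.zip k⟩ : FnSym StreamLang) ∈ R.sig → zipRule k ∈ R.rules)

section TermOver

variable {sig : List (FnSym StreamLang)}

theorem over_tailN (h : (⟨_, StreamSymbol.tail⟩ : FnSym StreamLang) ∈ sig) (n : ℕ) {t : STerm}
    (ht : TermOver sig t) : TermOver sig (tailN n t) := by
  induction n with
  | zero => exact ht
  | succ n ih =>
    rw [tailN, Function.iterate_succ_apply']
    exact ⟨h, fun _ => ih⟩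

theorem over_cons (h : (⟨_, StreamSymbol.cons⟩ : FnSym StreamLang) ∈ sig) {s t : STerm}
    (hs : TermOver sig s) (ht : TermOver sig t) : TermOver sig (cons s t) := by
  refine ⟨h, fun i => ?_⟩
  dsimp only
  split_ifs
  exacts [hs, ht]

theorem tailN_vars (n : ℕ) (t : STerm) : (tailN n t).varFinset = t.varFinset := by
  induction n with
  | zero => rfl
  | succ n ih =>
    rw [tailN, Function.iterate_succ_apply', ← ih]
    ext x
    simp [tail, FirstOrder.Language.Term.varFinset, tailN]

end TermOver

end LSF

namespace FractranProgram

open LSF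

/-- The modulus used in the `n`-th argument: `p * (d / q)` for the first fraction `p / q` such
that `n * (p / q)` is an integer, and `d` if there is none. -/
def modulus (P : FractranProgram) (n : ℕ) : ℕ :=
  match P.firstFraction n with
  | some x => (x.1 : ℕ) * (P.denomLcm / (x.2 : ℕ))
  | none => P.denomLcm

/-- The term `Tₙ`: `mod (p * (d / q)) (tail^(n * (p / q) - 1) T)` for the first fraction `p / q`
such that `n * (p / q)` is an integer, and `pebble : mod d (tail^(n - 1) T)` if there is none. -/
def translArg (P : FractranProgram) (n : ℕ) : STerm :=
  match P.firstFraction n with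
  | some x => mod (P.modulus n) (tailN (n * (x.1 : ℕ) / (x.2 : ℕ) - 1) const)
  | none => cons pebble (mod (P.modulus n) (tailN (n - 1) const))

/-- All moduli that occur in `T₁, …, T_d`. -/
def moduli (P : FractranProgram) : List ℕ :=
  ((List.range P.denomLcm).map fun i => P.modulus (i + 1)).dedup

/-- The right-hand side `zip d (T₁, …, T_d)` of the rule for the stream constant. -/
def specRhs (P : FractranProgram) : STerm := zip P.denomLcm fun i => P.translArg ((i : ℕ) + 1)

/-- The signature of the stream specification induced by a Fractran program. -/
def specSig (P : FractranProgram) : List (FnSym StreamLang) :=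
  [⟨_, StreamSymbol.pebble⟩, ⟨_, StreamSymbol.cons⟩, ⟨_, StreamSymbol.head⟩,
    ⟨_, StreamSymbol.tail⟩, ⟨_, StreamSymbol.zip P.denomLcm⟩, ⟨_, StreamSymbol.const⟩] ++
  P.moduli.map fun k => ⟨_, StreamSymbol.mod k⟩

/-- The rules of the stream specification induced by a Fractran program. -/
def specRules (P : FractranProgram) : List (RRule StreamLang) :=
  [(const, P.specRhs), headRule, tailRule, zipRule P.denomLcm] ++ P.moduli.map modRule

theorem specRules_cases (P : FractranProgram) {ρ : RRule StreamLang} (h : ρ ∈ P.specRules) :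
    ρ = (const, P.specRhs) ∨ ρ = headRule ∨ ρ = tailRule ∨ ρ = zipRule P.denomLcm ∨
      ∃ k ∈ P.moduli, ρ = modRule k := by
  simp only [specRules, List.cons_append, List.nil_append, List.mem_cons, List.mem_map] at h
  rcases h with h | h | h | h | ⟨k, hk, h⟩
  · exact .inl h
  · exact .inr (.inl h)
  · exact .inr (.inr (.inl h))
  · exact .inr (.inr (.inr (.inl h)))
  · exact .inr (.inr (.inr (.inr ⟨k, hk, h.symm⟩)))

theorem over_translArg (P : FractranProgram) {n : ℕ} (hn : P.modulus n ∈ P.moduli) :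
    TermOver P.specSig (P.translArg n) := by
  have h1 : TermOver P.specSig const := ⟨by simp [specSig], fun i => i.elim0⟩
  have h2 : ∀ m, TermOver P.specSig (tailN m const) :=
    fun m => over_tailN (by simp [specSig]) m h1
  have h3 : ∀ m, TermOver P.specSig (mod (P.modulus n) (tailN m const)) := fun m =>
    ⟨List.mem_append_right _ (List.mem_map_of_mem (f := fun k => _) hn), fun _ => h2 m⟩
  unfold translArg
  split
  · exact h3 _
  · exact over_cons (by simp [specSig]) ⟨by simp [specSig], fun i => i.elim0⟩ (h3 _)

/-- The stream specification induced by a Fractran program. -/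
def spec (P : FractranProgram) : TRS StreamLang where
  sig := P.specSig
  rules := P.specRules
  lhs_over := by
    intro ρ h
    rcases P.specRules_cases h with rfl | rfl | rfl | rfl | ⟨k, hk, rfl⟩
    · exact ⟨by simp [specSig], fun i => i.elim0⟩
    · exact ⟨by simp [specSig], fun _ => over_cons (by simp [specSig]) trivial trivial⟩
    · exact ⟨by simp [specSig], fun _ => over_cons (by simp [specSig]) trivial trivial⟩
    · exact ⟨by simp [specSig], fun _ => trivial⟩
    · exact ⟨List.mem_append_right _ (List.mem_map_of_mem (f := fun k => _) hk), fun _ => trivial⟩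
  rhs_over := by
    intro ρ h
    rcases P.specRules_cases h with rfl | rfl | rfl | rfl | ⟨k, hk, rfl⟩
    · refine ⟨by simp [specSig], fun i => P.over_translArg ?_⟩
      rw [moduli, List.mem_dedup]
      exact List.mem_map_of_mem (f := fun i => P.modulus (i + 1)) (List.mem_range.2 i.2)
    · trivial
    · trivial
    · refine over_cons (by simp [specSig]) ⟨by simp [specSig], fun _ => trivial⟩
        ⟨by simp [specSig], fun i => ?_⟩
      dsimp only
      split_ifs
      · trivial
      · exact ⟨by simp [specSig], fun _ => trivial⟩
    · exact over_cons (by simp [specSig]) ⟨by simp [specSig], fun _ => trivial⟩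
        ⟨List.mem_append_right _ (List.mem_map_of_mem (f := fun k => _) hk),
          fun _ => over_tailN (by simp [specSig]) k trivial⟩
  lhs_not_var := by
    intro ρ h x
    rcases P.specRules_cases h with rfl | rfl | rfl | rfl | ⟨k, hk, rfl⟩ <;>
      exact fun h => by cases h
  rhs_vars := by
    intro ρ h
    rcases P.specRules_cases h with rfl | rfl | rfl | rfl | ⟨k, hk, rfl⟩
    · have hc : ∀ m, (tailN m const).varFinset = ∅ := fun m => by
        rw [tailN_vars]; simp [const, FirstOrder.Language.Term.varFinset]
      have ha : ∀ n, (P.translArg n).varFinset = ∅ := fun n => by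
        unfold translArg
        split
        · ext y
          simp [mod, FirstOrder.Language.Term.varFinset, hc]
        · ext y
          simp [mod, cons, pebble, FirstOrder.Language.Term.varFinset, hc]
      intro y hy
      simp [specRhs, zip, FirstOrder.Language.Term.varFinset, ha] at hy
    · intro y hy
      simp [headRule, head, cons, FirstOrder.Language.Term.varFinset] at hy ⊢
      exact .inl hy
    · intro y hy
      simp [tailRule, tail, cons, FirstOrder.Language.Term.varFinset] at hy ⊢
      exact .inr hy
    · intro y hy
      simp only [zipRule, zip, FirstOrder.Language.Term.varFinset, Finset.mem_biUnion,
        Finset.mem_univ, true_and, Finset.mem_singleton]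
      simp only [zipRule, zip, cons, head, FirstOrder.Language.Term.varFinset,
        Finset.mem_biUnion, Finset.mem_univ, true_and, Fin.exists_fin_two] at hy
      rcases hy with hy | hy
      · simp [FirstOrder.Language.Term.varFinset] at hy
        exact ⟨⟨0, P.denomLcm_pos⟩, hy⟩
      · simp [FirstOrder.Language.Term.varFinset] at hy
        obtain ⟨i, hi⟩ := hy
        split_ifs at hi with hlt
        · simp [FirstOrder.Language.Term.varFinset] at hi
          exact ⟨⟨i + 1, hlt⟩, hi⟩
        · simp [tail, FirstOrder.Language.Term.varFinset] at hi
          exact ⟨⟨0, P.denomLcm_pos⟩, hi⟩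
    · intro y hy
      simp [modRule, mod, head, cons, FirstOrder.Language.Term.varFinset, tailN_vars] at hy ⊢
      exact hy

end FractranProgram

/-! ### Arithmetical hierarchy and decision problems -/

/-- A set of natural numbers is `Π⁰₂`: it is `{n | ∀ x, ∃ y, r n x y}` for a decidable `r`. -/
def IsPi02 (A : Set ℕ) : Prop :=
  ∃ r : ℕ → ℕ → ℕ → Prop, ComputablePred (fun v : ℕ × ℕ × ℕ => r v.1 v.2.1 v.2.2) ∧
    ∀ n, n ∈ A ↔ ∀ x, ∃ y, r n x y

/-- A set of natural numbers is `Π⁰₂`-complete (with respect to many-one reductions). -/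
def IsPi02Complete (A : Set ℕ) : Prop :=
  IsPi02 A ∧ ∀ B : Set ℕ, IsPi02 B → ManyOneReducible (fun n => n ∈ B) (fun n => n ∈ A)

/-- The decision problem with the set of instances `I`, in which the instances in `Y` have the
answer "yes", is `Π⁰₂`-complete: on the codes of instances, the answer is given by a `Π⁰₂`
set, and every `Π⁰₂` set is many-one reducible to the problem, by a computable function all of
whose values are codes of instances. -/
def IsPi02CompleteProblem {α : Type} [Encodable α] (I Y : Set α) : Prop :=
  (∃ C : Set ℕ, IsPi02 C ∧ ∀ x ∈ I, (x ∈ Y ↔ Encodable.encode x ∈ C)) ∧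
  ∀ B : Set ℕ, IsPi02 B → ∃ f : ℕ → α, Computable (fun n => Encodable.encode (f n)) ∧
    ∀ n, f n ∈ I ∧ (n ∈ B ↔ f n ∈ Y)

/-- The instances of the productivity problem for computable outermost-fair strategies: a finite
TRS, a code of a computable outermost-fair strategy for it, and a term over its signature. -/
def productivityInstances : Set (TRS StreamLang × Nat.Partrec.Code × RTerm StreamLang) :=
  {x | TermOver x.1.sig x.2.2 ∧ x.1.CodesOutermostFair x.2.1}

/-- The instances in which the term is productive with respect to the strategy. -/
def productivityYes : Set (TRS StreamLang × Nat.Partrec.Code × RTerm StreamLang) :=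
  {x | x.1.Productive (x.1.codedRel x.2.1) x.2.2}

/-- The restriction to the stream constants of specifications induced by Fractran programs. -/
def fractranInstances : Set (TRS StreamLang × Nat.Partrec.Code × RTerm StreamLang) :=
  {x | x ∈ productivityInstances ∧ ∃ P : FractranProgram, x.1 = P.spec ∧ x.2.2 = LSF.const}

/-- The specifications induced by Fractran programs whose stream constant is productive with
respect to every outermost-fair strategy. -/
def productiveFractranSpecs : Set (TRS StreamLang) :=
  {R | (∃ P : FractranProgram, R = P.spec) ∧
    ∀ S, R.IsStrategy S → R.OutermostFair S → R.Productive S LSF.const}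

/-! ### Rewriting with the induced specification -/

/-! Index the stream constant from `0`. Unfolding its rule once expresses the element `i` through
another one. Write `i + 1 = n + d * q` with `1 ≤ n ≤ d`. Since `d` is a common multiple of the
denominators, the first applicable fraction depends only on `n`. If it sends `n` to `b`, it sends `n
+ d * q` to `b + a * q` with `a` the modulus of that argument, which is where `mod a (tail^(b-1) T)`
looks. If there is none, the element is a pebble or a copy of the element `i - d`, for which the
program also stops at once. So the element `i` can be evaluated exactly if the program halts on `i +
1`.

Productivity implies halting: interpret the stream constant by the predicate "halts on `i + 1`". All
rules preserve the induced interpretation of well-sorted terms (`Typed.haltsAt_step`), while a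
constructor prefix forces the predicate to hold (`haltsAt_of_label`). Well-sorted streams always
contain a redex, so an infinite sequence exists and its limit gives the claim.

Halting implies productivity: the relation `next` between an element and its source is well-founded,
so the evaluation costs have a finite bound `e` (`exists_isBound`). No step raises the costs. A term
without a constructor at the root has a redex reachable through `head` and `tail` alone; it is
outermost and stays so until it is contracted, and its contraction lowers the cost (`Spine.persist`,
`Spine.rank_lt`). Fairness therefore forces a constructor to the root. The steps in a child of
`cons` again form a fair sequence if the steps elsewhere count as idle, and induction on the depth
gives convergence.

A computable outermost-fair strategy uses the length of the history as a clock that gives every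
position priority infinitely often. Its computability is shown on terms in Polish notation,
evaluated with a stack.

The upper bound quantifies over programs, inputs and running times
(`isPi02_productiveFractranSpecs`). For hardness, a `Π⁰₂` set has the form `∀ x, ∃ k, p n x k ≠ 0`
with `p` primitive recursive and monotone in `k`. A counter machine searches for `k`; it is arranged
to halt from all configurations, not only the initial ones, when `n` is in the set. This uniform
halting is needed because a Fractran program has to halt on every positive integer. Loop programs
supply it, since they can be left from any address (`Cmd.exit`). -/

namespace LSF

/-- The fold of a term along an algebra of stream symbols. -/
def interp {β : Type} (z : β) (alg : ∀ n, StreamSymbol n → (Fin n → β) → β) : STerm → β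
  | .var _ => z
  | .func f ts => alg _ f fun i => interp z alg (ts i)

/-- The result sort of a symbol: `true` for streams, `false` for data elements. -/
def resSort : ∀ {n : ℕ}, StreamSymbol n → Bool
  | _, .pebble => false
  | _, .head => false
  | _, _ => true

/-- The sort of the `i`-th argument of a symbol. -/
def argSort : ∀ {n : ℕ}, StreamSymbol n → ℕ → Bool
  | _, .cons, 0 => false
  | _, _, _ => true

/-- The arguments on the right-hand side of the rule for `zip d`. -/
def rotate {d : ℕ} (hd : 0 < d) (ts : Fin d → STerm) (i : Fin d) : STerm :=
  if h : (i : ℕ) + 1 < d then ts ⟨i + 1, h⟩ else tail (ts ⟨0, hd⟩)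

/-- Argument families on `Fin 2` are determined by two values, but only up to function
extensionality; the same applies to the two lemmas below. -/
theorem cons_eta (ts : Fin 2 → STerm) :
    (FirstOrder.Language.Term.func (L := StreamLang) StreamSymbol.cons ts) =
      cons (ts 0) (ts 1) := by
  unfold cons
  congr 1
  funext i
  fin_cases i <;> rfl

theorem unary_eta (f : StreamSymbol 1) (ts : Fin 1 → STerm) :
    (FirstOrder.Language.Term.func (L := StreamLang) f ts) = .func (L := StreamLang) f
      fun _ => ts 0 := by
  congr 1
  funext i
  fin_cases i; rfl

theorem nullary_eta (f : StreamSymbol 0) (ts : Fin 0 → STerm) :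
    (FirstOrder.Language.Term.func (L := StreamLang) f ts) = .func (L := StreamLang) f
      Fin.elim0 := by
  congr 1
  funext i
  exact i.elim0

theorem subst_tailN (k : ℕ) (t : STerm) (τ : ℕ → STerm) :
    (tailN k t).subst τ = tailN k (t.subst τ) := by
  induction k with
  | zero => rfl
  | succ k ih =>
    simp only [tailN, Function.iterate_succ_apply'] at ih ⊢
    rw [← ih]
    rfl

theorem subst_cons (s t : STerm) (τ : ℕ → STerm) :
    (cons s t).subst τ = cons (s.subst τ) (t.subst τ) := by
  rw [cons, FirstOrder.Language.Term.subst, cons_eta]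
  rfl

theorem subst_const (τ : ℕ → STerm) : const.subst τ = const := by
  rw [const, FirstOrder.Language.Term.subst, nullary_eta]

theorem subst_headRule_lhs (τ : ℕ → STerm) :
    headRule.1.subst τ = head (cons (τ 0) (τ 1)) := by
  rw [headRule, head, FirstOrder.Language.Term.subst, subst_cons]; rfl

theorem subst_tailRule_lhs (τ : ℕ → STerm) :
    tailRule.1.subst τ = tail (cons (τ 0) (τ 1)) := by
  rw [tailRule, tail, FirstOrder.Language.Term.subst, subst_cons]; rfl

theorem subst_modRule_rhs (k : ℕ) (τ : ℕ → STerm) :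
    (modRule k).2.subst τ = cons (head (τ 0)) (mod k (tailN k (τ 0))) := by
  rw [modRule, subst_cons, mod, mod, FirstOrder.Language.Term.subst, subst_tailN]; rfl

end LSF

namespace FractranProgram

open LSF

/-- `Contracts P ρ s t`: the term `s` is an instance of the left-hand side of the rule `ρ` of
the induced specification, and `t` is the corresponding instance of the right-hand side. -/
inductive Contracts (P : FractranProgram) : RRule StreamLang → STerm → STerm → Prop
  | const : Contracts P (const, P.specRhs) const P.specRhs
  | head (s t : STerm) : Contracts P headRule (head (cons s t)) s
  | tail (s t : STerm) : Contracts P tailRule (tail (cons s t)) t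
  | mod (k : ℕ) (hk : k ∈ P.moduli) (t : STerm) :
      Contracts P (modRule k) (mod k t) (cons (head t) (mod k (tailN k t)))
  | zip (d : ℕ) (hd : d = P.denomLcm) (hd' : 0 < d) (ts : Fin d → STerm) :
      Contracts P (zipRule d) (zip d ts) (cons (head (ts ⟨0, hd'⟩)) (zip d (rotate hd' ts)))

theorem subst_specRhs (P : FractranProgram) (τ : ℕ → STerm) :
    P.specRhs.subst τ = P.specRhs := by
  have h1 : ∀ k m, (mod k (tailN m const)).subst τ = mod k (tailN m const) := by
    intro k m
    rw [mod, FirstOrder.Language.Term.subst, subst_tailN, subst_const]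
  rw [specRhs, zip, FirstOrder.Language.Term.subst]
  congr 1
  funext i
  unfold translArg
  split
  · exact h1 _ _
  · rw [subst_cons, h1]
    congr 1
    rw [pebble, FirstOrder.Language.Term.subst, nullary_eta]

theorem subst_zipRule_rhs {d : ℕ} (hd : 0 < d) (τ : ℕ → STerm) :
    (zipRule d).2.subst τ =
      cons (head (τ 0)) (zip d (rotate hd fun i => τ i)) := by
  rw [zipRule, subst_cons]
  congr 1
  rw [zip, zip, FirstOrder.Language.Term.subst]
  congr 1
  funext i
  unfold rotate
  split_ifs with h
  · rfl
  · rfl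

theorem mem_rules (P : FractranProgram) {ρ : RRule StreamLang} :
    ρ ∈ P.spec.rules ↔ ρ = (const, P.specRhs) ∨ ρ = headRule ∨ ρ = tailRule ∨
      ρ = zipRule P.denomLcm ∨ ∃ k ∈ P.moduli, ρ = modRule k := by
  refine ⟨P.specRules_cases, fun h => ?_⟩
  change ρ ∈ P.specRules
  simp only [specRules, List.cons_append, List.nil_append, List.mem_cons, List.mem_map]
  rcases h with h | h | h | h | ⟨k, hk, h⟩
  exacts [.inl h, .inr (.inl h), .inr (.inr (.inl h)), .inr (.inr (.inr (.inl h))),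
    .inr (.inr (.inr (.inr ⟨k, hk, h.symm⟩)))]

theorem Contracts.mem {P : FractranProgram} {ρ : RRule StreamLang} {s t : STerm}
    (h : Contracts P ρ s t) : ρ ∈ P.spec.rules := by
  rw [mem_rules]
  cases h with
  | const => exact .inl rfl
  | head => exact .inr (.inl rfl)
  | tail => exact .inr (.inr (.inl rfl))
  | mod k hk => exact .inr (.inr (.inr (.inr ⟨k, hk, rfl⟩)))
  | zip d hd => exact .inr (.inr (.inr (.inl (by rw [hd]))))

theorem contracts_subst {P : FractranProgram} {ρ : RRule StreamLang} (hρ : ρ ∈ P.spec.rules)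
    (τ : ℕ → STerm) : Contracts P ρ (ρ.1.subst τ) (ρ.2.subst τ) := by
  rcases P.mem_rules.1 hρ with rfl | rfl | rfl | rfl | ⟨k, hk, rfl⟩
  · rw [subst_specRhs, subst_const]
    exact .const
  · rw [subst_headRule_lhs]
    exact .head _ _
  · rw [subst_tailRule_lhs]
    exact .tail _ _
  · rw [subst_zipRule_rhs P.denomLcm_pos]
    exact .zip _ rfl _ fun i => τ i
  · rw [subst_modRule_rhs]
    exact .mod k hk _

theorem Contracts.stepAt {P : FractranProgram} {ρ : RRule StreamLang} {s t : STerm}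
    (h : Contracts P ρ s t) : StepAt ρ [] s t := by
  suffices h : ∃ τ : ℕ → STerm, ρ.1.subst τ = s ∧ ρ.2.subst τ = t by
    obtain ⟨τ, rfl, rfl⟩ := h
    exact .root τ
  cases h with
  | const => exact ⟨fun _ => LSF.const, subst_const _, P.subst_specRhs _⟩
  | head _ s =>
    exact ⟨fun i => if i = 0 then t else s, subst_headRule_lhs _, rfl⟩
  | tail s =>
    exact ⟨fun i => if i = 0 then s else t, subst_tailRule_lhs _, rfl⟩
  | mod k hk t => exact ⟨fun _ => t, rfl, subst_modRule_rhs _ _⟩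
  | zip d _ hd' ts =>
    -- Only the variables below `d` occur in the rule, so the value at the others is arbitrary.
    have h : ∀ i : Fin d, (fun i : ℕ => if h : i < d then ts ⟨i, h⟩ else LSF.const) i = ts i :=
      fun i => dif_pos i.2
    refine ⟨fun i => if h : i < d then ts ⟨i, h⟩ else LSF.const, ?_, ?_⟩
    · exact congrArg (LSF.zip _) (funext h)
    · rw [subst_zipRule_rhs hd', funext h, ← h ⟨0, hd'⟩]

/-- A rewrite step is a contraction at the root or a step in an argument. -/
theorem stepAt_iff {P : FractranProgram} {ρ : RRule StreamLang} (hρ : ρ ∈ P.spec.rules)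
    {p : List ℕ} {s t : STerm} :
    StepAt ρ p s t ↔ (p = [] ∧ Contracts P ρ s t) ∨
      ∃ (n : ℕ) (f : StreamSymbol n) (ts : Fin n → STerm) (i : Fin n) (q : List ℕ) (t' : STerm),
        p = (i : ℕ) :: q ∧ s = .func (L := StreamLang) f ts ∧ StepAt ρ q (ts i) t' ∧
        t = .func (L := StreamLang) f (Function.update ts i t') := by
  constructor
  · intro h
    cases h with
    | root τ => exact .inl ⟨rfl, contracts_subst hρ τ⟩
    | arg f ts i q t' h => exact .inr ⟨_, f, ts, i, q, t', rfl, rfl, h, rfl⟩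
  · rintro (⟨rfl, h⟩ | ⟨n, f, ts, i, q, t', rfl, rfl, h, rfl⟩)
    · exact h.stepAt
    · exact .arg f ts i q t' h

theorem contracts_head {P : FractranProgram} {ρ : RRule StreamLang} {s t : STerm}
    (h : Contracts P ρ (head s) t) : ∃ s', s = cons t s' := by
  generalize hs : LSF.head s = u at h
  cases h <;> simp [LSF.head, LSF.tail, LSF.const, LSF.mod, LSF.zip, funext_iff] at hs
  · exact ⟨_, hs⟩
  -- The arity of `zip d` is variable. For `d = 1` it coincides with that of `head`, and the symbols
  -- have to be separated after the arities are identified.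
  · obtain ⟨rfl, h, -⟩ := hs
    cases eq_of_heq h

theorem contracts_tail {P : FractranProgram} {ρ : RRule StreamLang} {s t : STerm}
    (h : Contracts P ρ (tail s) t) : ∃ s', s = cons s' t := by
  generalize hs : LSF.tail s = u at h
  cases h <;> simp [LSF.head, LSF.tail, LSF.const, LSF.mod, LSF.zip, funext_iff] at hs
  · exact ⟨_, hs⟩
  · obtain ⟨rfl, h, -⟩ := hs
    cases eq_of_heq h

theorem not_contracts_cons {P : FractranProgram} {ρ : RRule StreamLang} {s s' t : STerm} :
    ¬ Contracts P ρ (cons s s') t := by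
  intro h
  generalize hs : LSF.cons s s' = u at h
  cases h <;> simp [LSF.head, LSF.tail, LSF.cons, LSF.const, LSF.mod, LSF.zip] at hs
  obtain ⟨rfl, h, -⟩ := hs
  cases eq_of_heq h

/-- Distinct rules have distinct root symbols, so the root determines the rule and the arguments
determine the substitution. -/
theorem Contracts.unique {P : FractranProgram} {ρ ρ' : RRule StreamLang} {s t t' : STerm}
    (h : Contracts P ρ s t) (h' : Contracts P ρ' s t') : ρ = ρ' ∧ t = t' := by
  generalize hs : s = s' at h'
  cases h <;> cases h' <;>
    simp [LSF.head, LSF.tail, LSF.cons, LSF.const, LSF.mod, LSF.zip, funext_iff] at hs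
  case const.const | head.head | tail.tail => simp [hs]
  case mod.mod =>
    obtain ⟨rfl, rfl⟩ := hs
    exact ⟨rfl, rfl⟩
  all_goals
    obtain ⟨rfl, h₁, h₂⟩ := hs
    first
      | cases eq_of_heq h₂; exact ⟨rfl, rfl⟩
      | cases eq_of_heq h₁

/-! ### Sorts -/

/-- Ground terms over the signature of the induced specification that respect the sorts. -/
def Typed (P : FractranProgram) : Bool → STerm → Prop
  | _, .var _ => False
  | b, .func (l := n) f ts => (⟨n, f⟩ : FnSym StreamLang) ∈ P.specSig ∧ resSort f = b ∧
      ∀ i : Fin n, Typed P (argSort f i) (ts i)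

theorem Typed.termOver {P : FractranProgram} {b : Bool} {t : STerm} (h : P.Typed b t) :
    TermOver P.spec.sig t := by
  induction t generalizing b with
  | var x => trivial
  | func f ts ih => exact ⟨h.1, fun i => ih i (h.2.2 i)⟩

theorem typed_tailN {P : FractranProgram} {t : STerm} (h : P.Typed true t) (k : ℕ) :
    P.Typed true (tailN k t) := by
  induction k with
  | zero => exact h
  | succ k ih =>
    rw [tailN, Function.iterate_succ_apply']
    exact ⟨by simp [specSig], rfl, fun _ => ih⟩

theorem typed_cons {P : FractranProgram} {s t : STerm} :
    P.Typed true (cons s t) ↔ P.Typed false s ∧ P.Typed true t :=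
  ⟨fun h => ⟨h.2.2 0, h.2.2 1⟩, fun h => ⟨by simp [specSig], rfl, fun i => by
    fin_cases i
    exacts [h.1, h.2]⟩⟩

theorem typed_const (P : FractranProgram) : P.Typed true const :=
  ⟨by simp [specSig], rfl, fun i => i.elim0⟩

theorem typed_pebble (P : FractranProgram) : P.Typed false pebble :=
  ⟨by simp [specSig], rfl, fun i => i.elim0⟩

theorem mod_mem_specSig {P : FractranProgram} {k : ℕ} :
    (⟨1, .mod k⟩ : FnSym StreamLang) ∈ P.specSig ↔ k ∈ P.moduli := by
  constructor
  · intro h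
    simp only [specSig, List.cons_append, List.nil_append, List.mem_cons, List.mem_map] at h
    rcases h with h | h | h | h | h | h | ⟨m, hm, h⟩
    iterate 4 cases h
    · have := congrArg StreamSymbol.toNat h
      simp only [StreamSymbol.toNat] at this
      omega
    · cases h
    · have := congrArg StreamSymbol.toNat h
      simp only [StreamSymbol.toNat] at this
      obtain rfl : m = k := by omega
      exact hm
  · intro h
    exact List.mem_append_right _ (List.mem_map_of_mem (f := fun k => _) h)

theorem zip_mem_specSig {P : FractranProgram} {k : ℕ} :
    (⟨k, .zip k⟩ : FnSym StreamLang) ∈ P.specSig ↔ k = P.denomLcm := by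
  constructor
  · intro h
    simp only [specSig, List.cons_append, List.nil_append, List.mem_cons, List.mem_map] at h
    rcases h with h | h | h | h | h | h | ⟨m, hm, h⟩
    all_goals
      have := congrArg StreamSymbol.toNat h
      simp only [StreamSymbol.toNat] at this
      omega
  · rintro rfl
    simp [specSig]

theorem modulus_mem_moduli (P : FractranProgram) {i : ℕ} (hi : i < P.denomLcm) :
    P.modulus (i + 1) ∈ P.moduli := by
  rw [moduli, List.mem_dedup]
  exact List.mem_map_of_mem (f := fun i => P.modulus (i + 1)) (List.mem_range.2 hi)

theorem typed_specRhs (P : FractranProgram) : P.Typed true P.specRhs := by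
  refine ⟨zip_mem_specSig.2 rfl, rfl, fun i => ?_⟩
  have h : ∀ m, P.Typed true (mod (P.modulus (i + 1)) (tailN m const)) := fun m =>
    ⟨mod_mem_specSig.2 (P.modulus_mem_moduli i.2), rfl, fun _ => typed_tailN P.typed_const m⟩
  change P.Typed true (P.translArg (i + 1))
  unfold translArg
  split
  · exact h _
  · exact typed_cons.2 ⟨P.typed_pebble, h _⟩

theorem Contracts.typed {P : FractranProgram} {ρ : RRule StreamLang} {s t : STerm}
    (h : Contracts P ρ s t) {b : Bool} (hs : P.Typed b s) : P.Typed b t := by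
  cases h with
  | const =>
    obtain rfl := hs.2.1
    exact P.typed_specRhs
  | head =>
    obtain rfl := hs.2.1
    exact (typed_cons.1 (hs.2.2 0)).1
  | tail =>
    obtain rfl := hs.2.1
    exact (typed_cons.1 (hs.2.2 0)).2
  | mod k hk t =>
    obtain rfl := hs.2.1
    exact typed_cons.2 ⟨⟨by simp [specSig], rfl, fun _ => hs.2.2 0⟩,
      ⟨hs.1, rfl, fun _ => typed_tailN (hs.2.2 0) k⟩⟩
  | zip d hd hd' ts =>
    obtain rfl := hs.2.1
    have hts : ∀ i, P.Typed true (ts i) := hs.2.2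
    refine typed_cons.2 ⟨⟨by simp [specSig], rfl, fun _ => hts _⟩, ⟨hs.1, rfl, fun i => ?_⟩⟩
    change P.Typed true (rotate hd' ts i)
    unfold rotate
    split_ifs with h
    · exact hts _
    · exact ⟨by simp [specSig], rfl, fun _ => hts _⟩

/-- Rewrite steps respect the sorts. -/
theorem Typed.step {P : FractranProgram} {ρ : RRule StreamLang} (hρ : ρ ∈ P.spec.rules)
    {p : List ℕ} {s t : STerm} (h : StepAt ρ p s t) {b : Bool} (hs : P.Typed b s) :
    P.Typed b t := by
  induction h generalizing b with
  | root τ => exact (contracts_subst hρ τ).typed hs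
  | arg f ts i q t' h ih =>
    refine ⟨hs.1, hs.2.1, fun j => ?_⟩
    by_cases hj : j = i
    · subst hj
      rw [Function.update_self]
      exact ih (hs.2.2 j)
    · rw [Function.update_of_ne hj]
      exact hs.2.2 j

/-! ### The outermost redex of a term without a constructor at the root -/

/-- `Spine P ρ p s`: the redex of the rule `ρ` at the position `p` is reached from the root of
`s` through destructors only. -/
inductive Spine (P : FractranProgram) : RRule StreamLang → List ℕ → STerm → Prop
  | root {ρ : RRule StreamLang} {s t : STerm} : Contracts P ρ s t → Spine P ρ [] s
  | head {ρ : RRule StreamLang} {p : List ℕ} {s : STerm} :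
      Spine P ρ p s → Spine P ρ (0 :: p) (head s)
  | tail {ρ : RRule StreamLang} {p : List ℕ} {s : STerm} :
      Spine P ρ p s → Spine P ρ (0 :: p) (tail s)

/-- The root of the term is a constructor of streams or data elements. -/
def Guarded : STerm → Prop
  | .func (l := _) .cons _ => True
  | .func (l := _) .pebble _ => True
  | _ => False

theorem Spine.mem {P : FractranProgram} {ρ : RRule StreamLang} {p : List ℕ} {s : STerm}
    (h : Spine P ρ p s) : ρ ∈ P.spec.rules := by
  induction h with
  | root h => exact h.mem
  | head _ ih => exact ih
  | tail _ ih => exact ih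

theorem Spine.not_cons {P : FractranProgram} {ρ : RRule StreamLang} {p : List ℕ} {s t : STerm} :
    ¬ Spine P ρ p (cons s t) := by
  intro h
  cases h with
  | root h => exact not_contracts_cons h

/-- `const`, `mod` and `zip` are redexes whatever their arguments are. Below `head` and `tail` there
is a stream, which either starts with `cons` and gives a redex at once, or is unguarded again and
allows a descent. -/
theorem Typed.exists_spine {P : FractranProgram} {b : Bool} {t : STerm} (h : P.Typed b t)
    (ht : ¬ Guarded t) : ∃ ρ p, Spine P ρ p t := by
  induction t generalizing b with
  | var x => exact h.elim
  | @func n f ts ih =>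
    -- The sorts exclude `pebble` here, which would be stuck below a destructor.
    have key : ∀ (t : STerm), P.Typed true t → Guarded t → ∃ s s', t = cons s s' := by
      intro t ht hg
      match t, ht, hg with
      | .func .cons ts, _, _ => exact ⟨_, _, cons_eta ts⟩
      | .func .pebble ts, ht, _ => exact absurd ht.2.1 (by decide)
    match n, f, ts, ih, h, ht with
    | _, .pebble, ts, ih, h, ht => exact (ht trivial).elim
    | _, .cons, ts, ih, h, ht => exact (ht trivial).elim
    | _, .const, ts, ih, h, ht =>
      rw [nullary_eta]
      exact ⟨_, _, .root .const⟩
    | _, .mod k, ts, ih, h, ht =>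
      rw [unary_eta]
      exact ⟨_, _, .root (.mod k (mod_mem_specSig.1 h.1) _)⟩
    | _, .zip k, ts, ih, h, ht =>
      obtain rfl := zip_mem_specSig.1 h.1
      exact ⟨_, _, .root (.zip _ rfl P.denomLcm_pos ts)⟩
    | _, .head, ts, ih, h, ht =>
      rw [unary_eta]
      by_cases hg : Guarded (ts 0)
      · obtain ⟨s, s', hs⟩ := key _ (h.2.2 0) hg
        rw [hs]
        exact ⟨_, _, .root (.head _ _)⟩
      · obtain ⟨ρ, p, hp⟩ := ih 0 (h.2.2 0) hg
        exact ⟨ρ, _, .head hp⟩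
    | _, .tail, ts, ih, h, ht =>
      rw [unary_eta]
      by_cases hg : Guarded (ts 0)
      · obtain ⟨s, s', hs⟩ := key _ (h.2.2 0) hg
        rw [hs]
        exact ⟨_, _, .root (.tail _ _)⟩
      · obtain ⟨ρ, p, hp⟩ := ih 0 (h.2.2 0) hg
        exact ⟨ρ, _, .tail hp⟩

theorem Spine.exists_stepAt {P : FractranProgram} {ρ : RRule StreamLang} {p : List ℕ}
    {s : STerm} (h : Spine P ρ p s) : ∃ t, StepAt ρ p s t := by
  induction h with
  | root h => exact ⟨_, h.stepAt⟩
  | head _ ih =>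
    obtain ⟨t, ht⟩ := ih
    exact ⟨_, .arg (L := StreamLang) StreamSymbol.head _ 0 _ _ ht⟩
  | tail _ ih =>
    obtain ⟨t, ht⟩ := ih
    exact ⟨_, .arg (L := StreamLang) StreamSymbol.tail _ 0 _ _ ht⟩

/-- Well-sorted terms of sort stream are not normal forms. -/
theorem Typed.exists_stepAt {P : FractranProgram} {t : STerm} (h : P.Typed true t) :
    ∃ ρ ∈ P.spec.rules, ∃ p t', StepAt ρ p t t' := by
  induction t with
  | var x => exact h.elim
  | @func n f ts ih =>
    by_cases hg : Guarded (.func (L := StreamLang) f ts)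
    · match n, f, ts, ih, h, hg with
      | _, .pebble, ts, ih, h, hg => exact absurd h.2.1 (by decide)
      | _, .cons, ts, ih, h, hg =>
        obtain ⟨ρ, hρ, p, t', hp⟩ := ih 1 (h.2.2 1)
        exact ⟨ρ, hρ, _, _, .arg (L := StreamLang) StreamSymbol.cons ts 1 p t' hp⟩
    · obtain ⟨ρ, p, hp⟩ := h.exists_spine hg
      obtain ⟨t, ht⟩ := hp.exists_stepAt
      exact ⟨ρ, hp.mem, p, t, ht⟩

/-- All symbols strictly above the redex are `head` or `tail`, and their argument, carrying a spine
itself, cannot start with `cons`; so none of them is a redex. -/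
theorem Spine.isOutermostRedex {P : FractranProgram} {ρ : RRule StreamLang} {p : List ℕ}
    {s : STerm} (h : Spine P ρ p s) : P.spec.IsOutermostRedex ρ p s := by
  refine ⟨h.exists_stepAt, ?_⟩
  induction h with
  | root h =>
    intro q hq hne
    exact (hne (List.prefix_nil.1 hq)).elim
  | @head p s h ih =>
    rintro q hq hne ρ' hρ' ⟨t, ht⟩
    rcases (stepAt_iff hρ').1 ht with ⟨rfl, hc⟩ | ⟨n, f, ts, i, q, t', rfl, hs, hst, -⟩
    · obtain ⟨_, rfl⟩ := contracts_head hc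
      exact h.not_cons
    · cases hs
      obtain rfl : i = 0 := Subsingleton.elim _ _
      rw [List.cons_prefix_cons] at hq
      exact ih q hq.2 (fun h => hne (by rw [h]; rfl)) ρ' hρ' ⟨t', hst⟩
  | @tail p s h ih =>
    rintro q hq hne ρ' hρ' ⟨t, ht⟩
    rcases (stepAt_iff hρ').1 ht with ⟨rfl, hc⟩ | ⟨n, f, ts, i, q, t', rfl, hs, hst, -⟩
    · obtain ⟨_, rfl⟩ := contracts_tail hc
      exact h.not_cons
    · cases hs
      obtain rfl : i = 0 := Subsingleton.elim _ _
      rw [List.cons_prefix_cons] at hq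
      exact ih q hq.2 (fun h => hne (by rw [h]; rfl)) ρ' hρ' ⟨t', hst⟩

/-- The redex at the end of the spine stays there until it is contracted. -/
theorem Spine.persist {P : FractranProgram} {ρ ρ' : RRule StreamLang} {p p' : List ℕ}
    {s t : STerm} (h : Spine P ρ p s) (hρ' : ρ' ∈ P.spec.rules) (hst : StepAt ρ' p' s t)
    (hne : (ρ', p') ≠ (ρ, p)) : Spine P ρ p t := by
  induction h generalizing p' t with
  | root h =>
    rcases (stepAt_iff hρ').1 hst with ⟨rfl, hc⟩ | ⟨n, f, ts, i, q, t', rfl, hs, hst', rfl⟩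
    · exact (hne (by rw [(h.unique hc).1])).elim
    -- A step below the root can only affect the pattern of `head` and `tail` rules, whose `cons`
    -- survives because it is never contracted. The other left-hand sides put no condition on the
    -- arguments.
    · have hcons : ∀ (s s' : STerm) , StepAt ρ' q (cons s s') t' →
          ∃ s₁ s₂, t' = cons s₁ s₂ := by
        intro s s' h'
        rcases (stepAt_iff hρ').1 h' with ⟨rfl, hc⟩ | ⟨n, f, ts, i, q, t', rfl, hs, hst', rfl⟩
        · exact (not_contracts_cons hc).elim
        · cases hs
          exact ⟨_, _, cons_eta _⟩
      cases h with
      | const => cases hs; exact i.elim0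
      | head s₁ s₂ =>
        cases hs
        obtain ⟨_, _, rfl⟩ := hcons _ _ hst'
        rw [unary_eta]
        obtain rfl : i = 0 := Subsingleton.elim _ _
        rw [Function.update_self]
        exact .root (.head _ _)
      | tail s₁ s₂ =>
        cases hs
        obtain ⟨_, _, rfl⟩ := hcons _ _ hst'
        rw [unary_eta]
        obtain rfl : i = 0 := Subsingleton.elim _ _
        rw [Function.update_self]
        exact .root (.tail _ _)
      | mod k hk s =>
        cases hs
        rw [unary_eta]
        exact .root (.mod k hk _)
      | zip d hd hd' ts =>
        cases hs
        exact .root (.zip _ hd hd' _)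
  | @head p s h ih =>
    rcases (stepAt_iff hρ').1 hst with ⟨rfl, hc⟩ | ⟨n, f, ts, i, q, t', rfl, hs, hst', rfl⟩
    · obtain ⟨_, rfl⟩ := contracts_head hc
      exact h.not_cons.elim
    · cases hs
      obtain rfl : i = 0 := Subsingleton.elim _ _
      rw [unary_eta, Function.update_self]
      exact .head (ih hst' fun h => hne (by cases h; rfl))
  | @tail p s h ih =>
    rcases (stepAt_iff hρ').1 hst with ⟨rfl, hc⟩ | ⟨n, f, ts, i, q, t', rfl, hs, hst', rfl⟩
    · obtain ⟨_, rfl⟩ := contracts_tail hc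
      exact h.not_cons.elim
    · cases hs
      obtain rfl : i = 0 := Subsingleton.elim _ _
      rw [unary_eta, Function.update_self]
      exact .tail (ih hst' fun h => hne (by cases h; rfl))

end FractranProgram

/-! ### Interpretations of terms by costs and by predicates -/

namespace LSF

/-- The number of steps that evaluate the tails of a stream (first component) and its elements
(second component), where `e` is a bound for the elements of the stream constant. -/
def costAlg (e : ℕ → ℕ) :
    ∀ n, StreamSymbol n → (Fin n → (ℕ → ℕ) × (ℕ → ℕ)) → (ℕ → ℕ) × (ℕ → ℕ)
  | _, .pebble, _ => (0, 0)
  -- Exposing the tail with index `i` of a `mod` or `zip` takes `i + 1` unfoldings and `i`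
  -- contractions of `tail`, together `2 * i + 1`; the stream constant needs one further step to
  -- become a `zip`.
  | _, .const, _ => (fun i => 2 * i + 2, e)
  -- Expose the constructor, contract `head`, evaluate the element. Data terms have the same element
  -- cost at every index and no tail cost.
  | _, .head, c => (0, fun _ => (c 0).1 0 + 1 + (c 0).2 0)
  | _, .tail, c => (fun i => (c 0).1 (i + 1), fun i => (c 0).2 (i + 1))
  | _, .mod k, c => (fun i => 2 * i + 1, fun i => (c 0).1 (k * i) + 1 + (c 0).2 (k * i))
  | _, .cons, c => (fun i => i.casesOn 0 fun j => 1 + (c 1).1 j,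
      fun i => i.casesOn ((c 0).2 0) fun j => (c 1).2 j)
  | k, .zip _, c => (fun i => 2 * i + 1, fun i =>
      if h : 0 < k then (c ⟨i % k, Nat.mod_lt _ h⟩).1 (i / k) + 1 +
        (c ⟨i % k, Nat.mod_lt _ h⟩).2 (i / k) else 0)

/-- The cost of a term, in the sense of `costAlg`. -/
def cost (e : ℕ → ℕ) : STerm → (ℕ → ℕ) × (ℕ → ℕ) := interp (0, 0) (costAlg e)

/-- The interpretation of streams by predicates, where `h` interprets the stream constant. -/
def predAlg (h : ℕ → Prop) : ∀ n, StreamSymbol n → (Fin n → ℕ → Prop) → ℕ → Prop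
  | _, .pebble, _ => fun _ => True
  | _, .const, _ => h
  | _, .head, c => fun _ => c 0 0
  | _, .tail, c => fun i => c 0 (i + 1)
  | _, .mod k, c => fun i => c 0 (k * i)
  | _, .cons, c => fun i => i.casesOn (c 0 0) fun j => c 1 j
  | k, .zip _, c => fun i => if h : 0 < k then c ⟨i % k, Nat.mod_lt _ h⟩ (i / k) else True

/-- The predicate that interprets a term, in the sense of `predAlg`. -/
def predOf (h : ℕ → Prop) : STerm → ℕ → Prop := interp (fun _ => True) (predAlg h)

theorem interp_update {β : Type} (z : β) (alg : ∀ n, StreamSymbol n → (Fin n → β) → β) {n : ℕ}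
    (ts : Fin n → STerm) (i : Fin n) (t : STerm) :
    (fun j => interp z alg (Function.update ts i t j)) =
      Function.update (fun j => interp z alg (ts j)) i (interp z alg t) := by
  funext j
  by_cases h : j = i
  · subst h; simp
  · simp [h]

/-- Monotonicity carries the decrease from a contracted subterm to its context. -/
theorem costAlg_mono (e : ℕ → ℕ) {n : ℕ} (f : StreamSymbol n) :
    Monotone (costAlg e n f) := by
  intro c c' h
  have h1 : ∀ i j, (c i).1 j ≤ (c' i).1 j := fun i => (h i).1
  have h2 : ∀ i j, (c i).2 j ≤ (c' i).2 j := fun i => (h i).2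
  cases f with
  | pebble => exact le_rfl
  | const => exact le_rfl
  | head => exact ⟨le_rfl, fun _ => Nat.add_le_add (Nat.add_le_add_right (h1 _ _) _) (h2 _ _)⟩
  | tail => exact ⟨fun _ => h1 _ _, fun _ => h2 _ _⟩
  | mod k => exact ⟨le_rfl, fun _ => Nat.add_le_add (Nat.add_le_add_right (h1 _ _) _) (h2 _ _)⟩
  | cons =>
    constructor
    · rintro (_ | i)
      exacts [le_rfl, Nat.add_le_add_left (h1 _ _) _]
    · rintro (_ | i)
      exacts [h2 _ _, h2 _ _]
  | zip =>
    refine ⟨le_rfl, fun i => ?_⟩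
    simp only [costAlg]
    split_ifs
    · exact Nat.add_le_add (Nat.add_le_add_right (h1 _ _) _) (h2 _ _)
    · exact le_rfl

theorem cost_tailN (e : ℕ → ℕ) (k : ℕ) (t : STerm) :
    cost e (tailN k t) = (fun i => (cost e t).1 (i + k), fun i => (cost e t).2 (i + k)) := by
  induction k with
  | zero => rfl
  | succ k ih =>
    have h : cost e (tailN (k + 1) t) =
        (fun i => (cost e (tailN k t)).1 (i + 1), fun i => (cost e (tailN k t)).2 (i + 1)) := by
      rw [tailN, Function.iterate_succ_apply']; rfl
    rw [h, ih]
    ext i <;> simp only [Nat.add_assoc, Nat.add_comm 1 k]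

theorem predOf_tailN (h : ℕ → Prop) (k : ℕ) (t : STerm) :
    predOf h (tailN k t) = fun i => predOf h t (i + k) := by
  induction k with
  | zero => rfl
  | succ k ih =>
    have h' : predOf h (tailN (k + 1) t) = fun i => predOf h (tailN k t) (i + 1) := by
      rw [tailN, Function.iterate_succ_apply']; rfl
    rw [h', ih]
    funext i
    simp only [Nat.add_assoc, Nat.add_comm 1 k]

theorem succ_mod_of_lt {i d : ℕ} (h : i % d + 1 < d) : (i + 1) % d = i % d + 1 := by
  rw [Nat.add_mod, Nat.mod_eq_of_lt (a := 1) (by omega), Nat.mod_eq_of_lt h]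

theorem succ_div_of_lt {i d : ℕ} (h : i % d + 1 < d) : (i + 1) / d = i / d := by
  rw [Nat.succ_div_of_not_dvd]
  intro h'
  have := Nat.mod_eq_zero_of_dvd h'
  rw [succ_mod_of_lt h] at this
  omega

theorem dvd_succ_of_not_lt {i d : ℕ} (hd : 0 < d) (h : ¬ i % d + 1 < d) : d ∣ i + 1 := by
  have h1 := Nat.mod_lt i hd
  have h2 : i % d + 1 = d := by omega
  refine ⟨i / d + 1, ?_⟩
  have := Nat.mod_add_div i d
  rw [Nat.mul_add, Nat.mul_one]
  omega

/-- Dropping the first element of a `zip` shifts the index by one. Either the next argument is met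
at the same depth, or the round is complete and the first argument is met one level deeper, which
accounts for the `tail` at the end of the rotation. -/
theorem predOf_rotate (h : ℕ → Prop) {d : ℕ} (hd : 0 < d) (ts : Fin d → STerm) (i : ℕ) :
    predOf h (rotate hd ts ⟨i % d, Nat.mod_lt _ hd⟩) (i / d) =
      predOf h (ts ⟨(i + 1) % d, Nat.mod_lt _ hd⟩) ((i + 1) / d) := by
  unfold rotate
  split_ifs with hlt
  · simp only [succ_mod_of_lt hlt, succ_div_of_lt hlt]
  · have hdvd := dvd_succ_of_not_lt hd hlt
    simp only [Nat.mod_eq_zero_of_dvd hdvd, Nat.succ_div_of_dvd hdvd]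
    rfl

theorem cost_rotate (e : ℕ → ℕ) {d : ℕ} (hd : 0 < d) (ts : Fin d → STerm) (i : ℕ) :
    (cost e (rotate hd ts ⟨i % d, Nat.mod_lt _ hd⟩)).1 (i / d) + 1 +
      (cost e (rotate hd ts ⟨i % d, Nat.mod_lt _ hd⟩)).2 (i / d) =
    (cost e (ts ⟨(i + 1) % d, Nat.mod_lt _ hd⟩)).1 ((i + 1) / d) + 1 +
      (cost e (ts ⟨(i + 1) % d, Nat.mod_lt _ hd⟩)).2 ((i + 1) / d) := by
  unfold rotate
  split_ifs with hlt
  · simp only [succ_mod_of_lt hlt, succ_div_of_lt hlt]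
  · have hdvd := dvd_succ_of_not_lt hd hlt
    simp only [Nat.mod_eq_zero_of_dvd hdvd, Nat.succ_div_of_dvd hdvd]
    rfl

end LSF

/-! ### Arithmetic of the induced specification -/

namespace FractranProgram

open LSF

theorem dvd_denomLcm {P : FractranProgram} {x : ℕ+ × ℕ+} (h : x ∈ P) :
    (x.2 : ℕ) ∣ P.denomLcm := by
  induction P with
  | nil => cases h
  | cons y P ih =>
    rcases List.mem_cons.1 h with rfl | h
    · exact Nat.dvd_lcm_left _ _
    · exact (ih h).trans (Nat.dvd_lcm_right _ _)

/-- Each denominator divides `P.denomLcm`, so the divisibility tests depend only on the residue.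
This is why finitely many arguments of `zip` suffice. -/
theorem firstFraction_add (P : FractranProgram) (n q : ℕ) :
    P.firstFraction (n + P.denomLcm * q) = P.firstFraction n := by
  refine List.find?_congr fun x hx => ?_
  rw [decide_eq_decide, Nat.add_mul, Nat.dvd_add_left]
  exact ((dvd_denomLcm hx).mul_right _).mul_right _

theorem firstFraction_some {P : FractranProgram} {n : ℕ} {x : ℕ+ × ℕ+}
    (h : P.firstFraction n = some x) : x ∈ P ∧ (x.2 : ℕ) ∣ n * x.1 :=
  ⟨List.mem_of_find?_eq_some h, by simpa using List.find?_some h⟩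

/-- The index of the element of the stream constant that the element with the index `i` is
copied from, if any. -/
def next (P : FractranProgram) (i : ℕ) : Option ℕ :=
  match P.step (i + 1) with
  | some m => some (m - 1)
  | none => if i < P.denomLcm then none else some (i - P.denomLcm)

theorem step_pos {P : FractranProgram} {n m : ℕ} (hn : 0 < n) (h : P.step n = some m) :
    0 < m := by
  rw [step, Option.map_eq_some_iff] at h
  obtain ⟨x, hx, rfl⟩ := h
  obtain ⟨-, hd⟩ := firstFraction_some hx
  exact Nat.div_pos (Nat.le_of_dvd (Nat.mul_pos hn x.1.pos) hd) x.2.pos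

/-- The element with the index `i / d` of the argument of `zip d` that yields the element with
the index `i` of the stream constant. -/
theorem translArg_cases (P : FractranProgram) (i : ℕ) :
    (∃ k m j, P.translArg (i % P.denomLcm + 1) = mod k (tailN m const) ∧
      P.next i = some j ∧ P.step (i + 1) = some (j + 1) ∧ k * (i / P.denomLcm) + m = j) ∨
    (P.step (i + 1) = none ∧ ∃ k m, P.translArg (i % P.denomLcm + 1) =
      cons pebble (mod k (tailN m const)) ∧
      ((i / P.denomLcm = 0 ∧ P.next i = none) ∨
        ∃ q j, i / P.denomLcm = q + 1 ∧ P.next i = some j ∧ k * q + m = j ∧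
          i = j + P.denomLcm)) := by
  set d := P.denomLcm with hd
  have hd0 : 0 < d := P.denomLcm_pos
  have hi : i % d + 1 + d * (i / d) = i + 1 := by
    have := Nat.mod_add_div i d
    omega
  have hf : P.firstFraction (i + 1) = P.firstFraction (i % d + 1) := by
    rw [← P.firstFraction_add (i % d + 1) (i / d), ← hd, hi]
  cases h : P.firstFraction (i % d + 1) with
  | some x =>
    left
    obtain ⟨hx, hdvd⟩ := firstFraction_some h
    obtain ⟨c, hc⟩ := dvd_denomLcm hx
    rw [← hd] at hc
    obtain ⟨b, hb⟩ := hdvd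
    have hq : (x.2 : ℕ) ≠ 0 := x.2.pos.ne'
    have hb0 : 0 < b := by
      rcases Nat.eq_zero_or_pos b with rfl | hb0
      · exact absurd hb (Nat.mul_pos (Nat.succ_pos (i % d)) x.1.pos).ne'
      · exact hb0
    -- For a denominator `x.2` with `d = x.2 * c`, a step of the program is affine on the residue
    -- class: slope `x.1 * c` in the quotient `i / d`, offset `b`.
    have hn : (i + 1) * (x.1 : ℕ) = x.2 * (b + x.1 * c * (i / d)) := by
      rw [← hi, Nat.add_mul, hb, Nat.mul_add]
      congr 1
      rw [hc]
      ring
    have hs : P.step (i + 1) = some (b + x.1 * c * (i / d)) := by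
      rw [step, hf, h, Option.map_some, hn, Nat.mul_div_cancel_left _ x.2.pos]
    -- The element with index `j` belongs to the integer `j + 1`, hence the subtractions of one;
    -- they are harmless because `b` is positive.
    refine ⟨x.1 * c, b - 1, b + x.1 * c * (i / d) - 1, ?_, ?_, ?_, ?_⟩
    · simp only [translArg, modulus, h]
      rw [hb, Nat.mul_div_cancel_left _ x.2.pos, ← hd, hc, Nat.mul_div_cancel_left _ x.2.pos]
    · rw [next, hs]
    · rw [hs, Nat.sub_add_cancel (by omega)]
    · omega
  | none =>
    right
    have hs : P.step (i + 1) = none := by rw [step, hf, h, Option.map_none]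
    refine ⟨hs, d, i % d, by simp only [translArg, modulus, h]; rfl, ?_⟩
    rcases Nat.eq_zero_or_pos (i / d) with h0 | h0
    · left
      refine ⟨h0, ?_⟩
      rw [next, hs]
      exact if_pos ((Nat.div_eq_zero_iff_lt hd0).1 h0)
    · right
      have hlt : ¬ i < d := fun h => by rw [Nat.div_eq_of_lt h] at h0; omega
      refine ⟨i / d - 1, i - d, by omega, ?_, ?_, by omega⟩
      · rw [next, hs]
        exact if_neg hlt
      · have h1 : d * (i / d) = d * (i / d - 1) + d := by
          rw [← Nat.mul_succ]
          congr 1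
          omega
        have := Nat.mod_add_div i d
        omega

theorem halts_iff_of_step {P : FractranProgram} {n m : ℕ} (h : P.step n = some m) :
    P.Halts n ↔ P.Halts m := by
  have key : ∀ i, (fun o : Option ℕ => o.bind P.step)^[i + 1] (some n) =
      (fun o : Option ℕ => o.bind P.step)^[i] (some m) := fun i => by
    rw [Function.iterate_succ_apply, Option.bind_some, h]
  constructor
  · rintro ⟨_ | i, hi⟩
    · cases hi
    · exact ⟨i, by rw [← key, hi]⟩
  · rintro ⟨i, hi⟩
    exact ⟨i + 1, by rw [key, hi]⟩

theorem halts_of_step {P : FractranProgram} {n : ℕ} (h : P.step n = none) : P.Halts n :=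
  ⟨1, h⟩

/-- Going back by one period preserves being stuck. The elements of `pebble : mod d _` after the
first are copied from such earlier indices. -/
theorem step_add (P : FractranProgram) (j : ℕ) (h : P.step (j + P.denomLcm + 1) = none) :
    P.step (j + 1) = none := by
  have : P.firstFraction (j + P.denomLcm + 1) = P.firstFraction (j + 1) := by
    rw [← P.firstFraction_add (j + 1) 1, Nat.mul_one, Nat.add_right_comm]
  rw [step, ← this]
  rwa [step, Option.map_eq_none_iff, ← Option.map_eq_none_iff] at h

/-! ### Halting and the elements of streams -/

/-- The interpretation of a term: the `i`-th element of the stream constant is interpreted by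
the statement that the program halts on `i + 1`. -/
abbrev HaltsAt (P : FractranProgram) : STerm → ℕ → Prop := predOf fun i => P.Halts (i + 1)

/-- Halting is invariant under a step, which settles the arguments of the form `mod`. If no fraction
applies, both sides are true: the element is a pebble or comes from an integer on which the program
is stuck too. -/
theorem haltsAt_specRhs (P : FractranProgram) :
    P.HaltsAt P.specRhs = fun i => P.Halts (i + 1) := by
  funext i
  have h : P.HaltsAt P.specRhs i =
      P.HaltsAt (P.translArg (i % P.denomLcm + 1)) (i / P.denomLcm) :=
    dif_pos P.denomLcm_pos
  have hm : ∀ k m q, P.HaltsAt (mod k (tailN m const)) q = P.Halts (k * q + m + 1) := by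
    intro k m q
    change P.HaltsAt (tailN m const) (k * q) = _
    rw [HaltsAt, predOf_tailN]
    rfl
  rw [h]
  rcases P.translArg_cases i with ⟨k, m, j, h1, -, h2, h3⟩ | ⟨h1, k, m, h2, h3⟩
  · rw [h1, hm, h3]
    exact propext (halts_iff_of_step h2).symm
  · rw [h2, eq_true (halts_of_step h1), eq_iff_iff, iff_true]
    rcases h3 with ⟨h3, -⟩ | ⟨q, j, h3, -, h4, h5⟩
    · rw [h3]
      trivial
    · rw [h3]
      change P.HaltsAt (mod k (tailN m const)) q
      rw [hm, h4]
      rw [h5] at h1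
      exact halts_of_step (P.step_add j h1)

/-- A data term is `pebble` or starts with `head`, and both algebras are constant in the index on
these symbols. -/
theorem Typed.interp_const {P : FractranProgram} {t : STerm} (ht : P.Typed false t)
    {β : Type} (z : β) (alg : ∀ n, StreamSymbol n → (Fin n → β) → β) (C : β → Prop)
    (h1 : ∀ c, C (alg 0 .pebble c)) (h2 : ∀ c, C (alg 1 .head c)) : C (interp z alg t) := by
  match t, ht with
  | .var _, ht => exact ht.elim
  | .func .pebble ts, _ => exact h1 _
  | .func .head ts, _ => exact h2 _
  | .func .const ts, ht => exact absurd ht.2.1 (by decide)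
  | .func .tail ts, ht => exact absurd ht.2.1 (by decide)
  | .func (.mod k) ts, ht => exact absurd ht.2.1 (by simp [resSort])
  | .func .cons ts, ht => exact absurd ht.2.1 (by decide)
  | .func (.zip k) ts, ht => exact absurd ht.2.1 (by simp [resSort])

/-- Every rule is a valid equation between streams of propositions. The sorts matter for `head`
only: its value is the element at index `0`, so the interpretation of the reduct must not depend on
the index. -/
theorem Contracts.haltsAt {P : FractranProgram} {ρ : RRule StreamLang} {s t : STerm}
    (h : Contracts P ρ s t) {b : Bool} (hs : P.Typed b s) : P.HaltsAt t = P.HaltsAt s := by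
  funext i
  cases h with
  | const => rw [haltsAt_specRhs]; rfl
  | head s t =>
    have ht := (typed_cons.1 (hs.2.2 0)).1
    exact ht.interp_const (fun _ => True) (predAlg _) (fun c => c i = c 0)
      (fun _ => rfl) (fun _ => rfl)
  | tail => rfl
  | mod k hk t =>
    cases i with
    | zero => rfl
    | succ i =>
      change P.HaltsAt (tailN k t) (k * i) = P.HaltsAt t (k * (i + 1))
      rw [HaltsAt, predOf_tailN, Nat.mul_succ]
  | zip d _ hd ts =>
    have h1 : ∀ ts i, P.HaltsAt (LSF.zip d ts) i = P.HaltsAt (ts ⟨i % d, Nat.mod_lt _ hd⟩) (i / d) :=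
      fun ts i => dif_pos hd
    rw [h1]
    cases i with
    | zero =>
      simp only [Nat.zero_mod, Nat.zero_div]
      rfl
    | succ i =>
      change P.HaltsAt (LSF.zip d _) i = _
      rw [h1]
      exact predOf_rotate _ hd ts i

/-- The interpretation is invariant under rewriting. -/
theorem Typed.haltsAt_step {P : FractranProgram} {ρ : RRule StreamLang} (hρ : ρ ∈ P.spec.rules)
    {p : List ℕ} {s t : STerm} (h : StepAt ρ p s t) {b : Bool} (hs : P.Typed b s) :
    P.HaltsAt t = P.HaltsAt s := by
  induction h generalizing b with
  | root τ => exact (contracts_subst hρ τ).haltsAt hs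
  | @arg n f ts i q t' h ih =>
    change predAlg _ n f (fun j => interp _ _ (Function.update ts i t' j)) = _
    rw [interp_update]
    have := ih (hs.2.2 i)
    rw [HaltsAt, predOf] at this
    rw [this]
    exact congrArg (predAlg _ n f) (Function.update_eq_self i _)

/-! ### Costs -/

/-- `e` bounds the cost of the elements of the stream constant. -/
def IsBound (P : FractranProgram) (e : ℕ → ℕ) : Prop := ∀ i, (cost e P.specRhs).2 i ≤ e i

/-- This is the recursion for the costs: apart from an overhead linear in `i`, evaluating an element
amounts to reaching and evaluating its source. -/
theorem cost_specRhs (P : FractranProgram) (e : ℕ → ℕ) (i : ℕ) :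
    (cost e P.specRhs).2 i ≤ 2 * i + 5 + (P.next i).elim 0 fun j => 2 * j + e j := by
  have h : (cost e P.specRhs).2 i =
      (cost e (P.translArg (i % P.denomLcm + 1))).1 (i / P.denomLcm) + 1 +
      (cost e (P.translArg (i % P.denomLcm + 1))).2 (i / P.denomLcm) :=
    dif_pos P.denomLcm_pos
  have hm : ∀ k m q, (cost e (mod k (tailN m const))).2 q =
      2 * (k * q + m) + 2 + 1 + e (k * q + m) := by
    intro k m q
    change (cost e (tailN m const)).1 (k * q) + 1 + (cost e (tailN m const)).2 (k * q) = _
    rw [cost_tailN]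
    rfl
  have hq := Nat.div_le_self i P.denomLcm
  rw [h]
  rcases P.translArg_cases i with ⟨k, m, j, h1, h2, -, h3⟩ | ⟨h1, k, m, h2, h3⟩
  · rw [h1, hm, h2, h3]
    -- The summands are the tail cost of `mod`, the contraction of the outer `head`, and `2 * j + 3
    -- + e j` for the tails of the constant, the inner `head` and the source element. This case
    -- determines the constant `5`.
    change 2 * (i / P.denomLcm) + 1 + 1 + _ ≤ 2 * i + 5 + (2 * j + e j)
    omega
  · rw [h2]
    rcases h3 with ⟨h3, h4⟩ | ⟨q, j, h3, h4, h5, h6⟩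
    · rw [h3, h4]
      change 0 + 1 + 0 ≤ 2 * i + 5 + 0
      omega
    · rw [h3, h4]
      change 1 + (2 * q + 1) + 1 + (cost e (mod k (tailN m const))).2 q ≤
        2 * i + 5 + (2 * j + e j)
      rw [hm, h5]
      omega

/-- While the program runs, `next` follows it, so induction on the running time applies. Once no
fraction applies, `next` subtracts the period and remains in the stuck case, so the index decreases.
-/
theorem next_wf {P : FractranProgram} (h : ∀ n, 0 < n → P.Halts n) :
    WellFounded fun j i => P.next i = some j := by
  have hnone : ∀ i, P.step (i + 1) = none → Acc (fun j i => P.next i = some j) i := by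
    intro i
    induction i using Nat.strong_induction_on with
    | _ i ih =>
      intro hi
      refine ⟨_, fun j hj => ?_⟩
      rw [next, hi] at hj
      dsimp only at hj
      split_ifs at hj with hlt
      obtain rfl := Option.some.inj hj
      refine ih _ (Nat.sub_lt (by have := P.denomLcm_pos; omega) P.denomLcm_pos)
        (P.step_add _ ?_)
      rwa [Nat.sub_add_cancel (by omega)]
  have key : ∀ k i, (fun o : Option ℕ => o.bind P.step)^[k] (some (i + 1)) = none →
      Acc (fun j i => P.next i = some j) i := by
    intro k
    induction k with
    | zero => intro i hi; cases hi
    | succ k ih =>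
      intro i hi
      cases hs : P.step (i + 1) with
      | none => exact hnone i hs
      | some m =>
        rw [Function.iterate_succ_apply, Option.bind_some, hs] at hi
        refine ⟨_, fun j hj => ?_⟩
        rw [next, hs] at hj
        obtain rfl := Option.some.inj hj
        refine ih _ ?_
        rwa [Nat.sub_add_cancel (step_pos (Nat.succ_pos i) hs)]
  refine ⟨fun i => ?_⟩
  obtain ⟨k, hk⟩ := h (i + 1) (Nat.succ_pos i)
  exact key k i hk

/-- The recursive inequality `cost_specRhs` is read as a definition of `e` by recursion along the
well-founded relation `next`. -/
theorem exists_isBound {P : FractranProgram} (h : ∀ n, 0 < n → P.Halts n) :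
    ∃ e, P.IsBound e := by
  classical
  let F : ∀ i : ℕ, (∀ j : ℕ, P.next i = some j → ℕ) → ℕ := fun i g =>
    2 * i + 5 + if h : ∃ j, P.next i = some j then 2 * h.choose + g _ h.choose_spec else 0
  refine ⟨(next_wf h).fix F, fun i => (P.cost_specRhs _ i).trans ?_⟩
  rw [(next_wf h).fix_eq F i]
  refine Nat.add_le_add_left ?_ _
  split_ifs with hj
  · exact (congrArg (fun o : Option ℕ => o.elim 0 _) hj.choose_spec).le
  · cases hn : P.next i with
    | none => exact le_rfl
    | some j => exact (hj ⟨j, hn⟩).elim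

/-- The measure of a term: the cost of the elements for data, the cost of the tails for
streams. -/
def rank (e : ℕ → ℕ) (b : Bool) (t : STerm) : ℕ → ℕ :=
  match b with
  | true => (cost e t).1
  | false => (cost e t).2

/-- The cost counts each root contraction: `head` lowers the element cost, the other rules lower the
tail cost at every index. The bound `e` is needed only when the stream constant is unfolded. -/
theorem Contracts.cost {P : FractranProgram} {ρ : RRule StreamLang} {s t : STerm}
    (h : Contracts P ρ s t) {e : ℕ → ℕ} (he : P.IsBound e) {b : Bool} (hs : P.Typed b s) :
    cost e t ≤ cost e s ∧ ∀ i, rank e b t i < rank e b s i := by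
  cases h with
  | const =>
    obtain rfl := hs.2.1
    exact ⟨⟨fun i => Nat.le_succ _, he⟩, fun i => Nat.lt_succ_self _⟩
  | head _ u =>
    obtain rfl := hs.2.1
    have ht := (typed_cons.1 (hs.2.2 0)).1
    have h0 : (LSF.cost e t).1 = 0 :=
      ht.interp_const (0, 0) (costAlg e) (fun c => c.1 = 0) (fun _ => rfl) (fun _ => rfl)
    have hc : ∀ i, (LSF.cost e t).2 i = (LSF.cost e t).2 0 := fun i =>
      ht.interp_const (0, 0) (costAlg e) (fun c => c.2 i = c.2 0) (fun _ => rfl) (fun _ => rfl)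
    have hlt : ∀ i, (LSF.cost e t).2 i < (LSF.cost e (LSF.head (cons t u))).2 i := by
      intro i
      rw [hc]
      change _ < 0 + 1 + (LSF.cost e t).2 0
      omega
    exact ⟨⟨h0.le, fun i => (hlt i).le⟩, hlt⟩
  | tail s t =>
    obtain rfl := hs.2.1
    have hlt : ∀ i, (LSF.cost e t).1 i < (LSF.cost e (LSF.tail (cons s t))).1 i := by
      intro i
      change _ < 1 + (LSF.cost e t).1 i
      omega
    exact ⟨⟨fun i => (hlt i).le, fun _ => le_rfl⟩, hlt⟩
  | mod k hk t =>
    obtain rfl := hs.2.1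
    have hlt : ∀ i, (LSF.cost e (cons (LSF.head t) (LSF.mod k (tailN k t)))).1 i <
        (LSF.cost e (LSF.mod k t)).1 i := by
      rintro (_ | i)
      · exact Nat.one_pos
      · change 1 + (2 * i + 1) < 2 * (i + 1) + 1
        omega
    refine ⟨⟨fun i => (hlt i).le, ?_⟩, hlt⟩
    -- At index `0` the unfolding was the whole cost. At a later index one unit is saved, the
    -- remaining `1` being the contraction of a `tail`.
    rintro (_ | i)
    · exact le_rfl
    · change (LSF.cost e (tailN k t)).1 (k * i) + 1 + (LSF.cost e (tailN k t)).2 (k * i) ≤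
        (LSF.cost e t).1 (k * (i + 1)) + 1 + (LSF.cost e t).2 (k * (i + 1))
      rw [cost_tailN, Nat.mul_succ]
  | zip d _ hd ts =>
    obtain rfl := hs.2.1
    have hlt : ∀ i, (LSF.cost e (cons (LSF.head (ts ⟨0, hd⟩)) (LSF.zip d (rotate hd ts)))).1 i <
        (LSF.cost e (LSF.zip d ts)).1 i := by
      rintro (_ | i)
      · exact Nat.one_pos
      · change 1 + (2 * i + 1) < 2 * (i + 1) + 1
        omega
    refine ⟨⟨fun i => (hlt i).le, fun i => le_of_eq ?_⟩, hlt⟩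
    have h1 : ∀ ts i, (LSF.cost e (LSF.zip d ts)).2 i =
        (LSF.cost e (ts ⟨i % d, Nat.mod_lt _ hd⟩)).1 (i / d) + 1 +
          (LSF.cost e (ts ⟨i % d, Nat.mod_lt _ hd⟩)).2 (i / d) := fun ts i => dif_pos hd
    rw [h1]
    cases i with
    | zero =>
      simp only [Nat.zero_mod, Nat.zero_div]
      rfl
    | succ i =>
      change (LSF.cost e (LSF.zip d _)).2 i = _
      rw [h1]
      exact cost_rotate e hd ts i

/-- Rewrite steps do not increase costs. -/
theorem Typed.cost_step {P : FractranProgram} {e : ℕ → ℕ} (he : P.IsBound e)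
    {ρ : RRule StreamLang} (hρ : ρ ∈ P.spec.rules) {p : List ℕ} {s t : STerm}
    (h : StepAt ρ p s t) {b : Bool} (hs : P.Typed b s) : cost e t ≤ cost e s := by
  induction h generalizing b with
  | root τ => exact ((contracts_subst hρ τ).cost he hs).1
  | @arg n f ts i q t' h ih =>
    change costAlg e n f (fun j => interp _ _ (Function.update ts i t' j)) ≤ costAlg e n f _
    rw [interp_update]
    refine costAlg_mono e f fun j => ?_
    by_cases hj : j = i
    · subst hj
      rw [Function.update_self]
      exact ih (hs.2.2 j)
    · rw [Function.update_of_ne hj]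

/-- The contraction of the redex at the end of the spine decreases the measure. -/
theorem Spine.rank_lt {P : FractranProgram} {e : ℕ → ℕ} (he : P.IsBound e)
    {ρ : RRule StreamLang} {p : List ℕ} {s t : STerm} (h : Spine P ρ p s) (hst : StepAt ρ p s t)
    {b : Bool} (hs : P.Typed b s) : ∀ i, rank e b t i < rank e b s i := by
  induction h generalizing t b with
  | root h =>
    rcases (stepAt_iff h.mem).1 hst with ⟨-, hc⟩ | ⟨n, f, ts, i, q, t', h', -⟩
    · exact (hc.cost he hs).2
    · cases h'
  | @head p s h ih =>
    rcases (stepAt_iff h.mem).1 hst with ⟨h', -⟩ | ⟨n, f, ts, i, q, t', h', hs', hst', rfl⟩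
    · cases h'
    · cases hs'
      obtain rfl : i = 0 := Subsingleton.elim _ _
      obtain rfl := (List.cons.inj h').2
      obtain rfl := hs.2.1
      rw [unary_eta, Function.update_self]
      intro i
      -- Below `head` the relevant sum consists of the tail cost at `0`, which falls, and the
      -- element cost at `0`, which does not rise.
      have h1 := ih hst' (hs.2.2 0) 0
      have h2 : (LSF.cost e t').2 0 ≤ (LSF.cost e s).2 0 :=
        (Typed.cost_step he h.mem hst' (hs.2.2 0)).2 0
      change (LSF.cost e t').1 0 < (LSF.cost e s).1 0 at h1
      change (LSF.cost e t').1 0 + 1 + (LSF.cost e t').2 0 <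
        (LSF.cost e s).1 0 + 1 + (LSF.cost e s).2 0
      omega
  | @tail p s h ih =>
    rcases (stepAt_iff h.mem).1 hst with ⟨h', -⟩ | ⟨n, f, ts, i, q, t', h', hs', hst', rfl⟩
    · cases h'
    · cases hs'
      obtain rfl : i = 0 := Subsingleton.elim _ _
      obtain rfl := (List.cons.inj h').2
      obtain rfl := hs.2.1
      rw [unary_eta, Function.update_self]
      intro i
      exact ih hst' (hs.2.2 0) (i + 1)

end FractranProgram

namespace FractranProgram

open LSF

/-! ### Fair sequences with idle steps -/

/-- A fair sequence of terms in which some steps may be idle (`l n = none`). -/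
structure FairSeq (P : FractranProgram) (u : ℕ → STerm)
    (l : ℕ → Option (RRule StreamLang × List ℕ)) : Prop where
  idle : ∀ n, l n = none → u (n + 1) = u n
  step : ∀ n x, l n = some x → x.1 ∈ P.spec.rules ∧ StepAt x.1 x.2 (u n) (u (n + 1))
  fair : ∀ n, ∀ ρ ∈ P.spec.rules, ∀ p,
    ¬ ∀ m ≥ n, P.spec.IsOutermostRedex ρ p (u m) ∧ l m ≠ some (ρ, p)

namespace FairSeq

variable {P : FractranProgram} {u : ℕ → STerm} {l : ℕ → Option (RRule StreamLang × List ℕ)}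

theorem shift (h : P.FairSeq u l) (N : ℕ) :
    P.FairSeq (fun n => u (N + n)) fun n => l (N + n) where
  idle n hn := h.idle (N + n) hn
  step n x hx := h.step (N + n) x hx
  fair n ρ hρ p hf := h.fair (N + n) ρ hρ p fun m hm => by
    have := hf (m - N) (by omega)
    rwa [Nat.add_sub_cancel' (by omega)] at this

theorem typed (h : P.FairSeq u l) {b : Bool} (h0 : P.Typed b (u 0)) (n : ℕ) :
    P.Typed b (u n) := by
  induction n with
  | zero => exact h0
  | succ n ih =>
    cases hl : l n with
    | none => rwa [h.idle n hl]
    | some x => exact ih.step (h.step n x hl).1 (h.step n x hl).2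

theorem cost_le (h : P.FairSeq u l) {e : ℕ → ℕ} (he : P.IsBound e) {b : Bool}
    (h0 : P.Typed b (u 0)) (n : ℕ) : cost e (u n) ≤ cost e (u 0) := by
  induction n with
  | zero => exact le_rfl
  | succ n ih =>
    cases hl : l n with
    | none => rwa [h.idle n hl]
    | some x =>
      exact ((h.typed h0 n).cost_step he (h.step n x hl).1 (h.step n x hl).2).trans ih

end FairSeq

theorem rank_mono {e : ℕ → ℕ} (b : Bool) {s t : STerm} (h : cost e s ≤ cost e t) (i : ℕ) :
    rank e b s i ≤ rank e b t i := by
  cases b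
  exacts [h.2 i, h.1 i]

theorem guarded_iff {P : FractranProgram} {b : Bool} {t : STerm} (ht : P.Typed b t) :
    Guarded t ↔ (b = true ∧ ∃ s s', t = cons s s') ∨ (b = false ∧ t = pebble) := by
  constructor
  · intro h
    match t, ht, h with
    | .func .cons ts, ht, _ => exact .inl ⟨ht.2.1.symm, _, _, cons_eta ts⟩
    | .func .pebble ts, ht, _ => exact .inr ⟨ht.2.1.symm, nullary_eta _ ts⟩
  · rintro (⟨-, s, s', rfl⟩ | ⟨-, rfl⟩) <;> trivial

theorem not_stepAt_pebble {P : FractranProgram} {ρ : RRule StreamLang} (hρ : ρ ∈ P.spec.rules)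
    {p : List ℕ} {t : STerm} : ¬ StepAt ρ p pebble t := by
  intro h
  rcases (stepAt_iff hρ).1 h with ⟨-, hc⟩ | ⟨n, f, ts, i, q, t', -, hs, -⟩
  · generalize hs : pebble = u at hc
    cases hc <;> simp [pebble, LSF.head, LSF.tail, LSF.const, LSF.mod, LSF.zip] at hs
    obtain ⟨rfl, h, -⟩ := hs
    cases eq_of_heq h
  · cases hs
    exact i.elim0

theorem stepAt_cons {P : FractranProgram} {ρ : RRule StreamLang} (hρ : ρ ∈ P.spec.rules)
    {p : List ℕ} {s s' t : STerm} (h : StepAt ρ p (cons s s') t) :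
    (∃ q t', p = 0 :: q ∧ StepAt ρ q s t' ∧ t = cons t' s') ∨
      ∃ q t', p = 1 :: q ∧ StepAt ρ q s' t' ∧ t = cons s t' := by
  rcases (stepAt_iff hρ).1 h with ⟨-, hc⟩ | ⟨n, f, ts, i, q, t', rfl, hs, hst, rfl⟩
  · exact (not_contracts_cons hc).elim
  · cases hs
    have hi : i = 0 ∨ i = 1 := by omega
    rcases hi with rfl | rfl
    · refine .inl ⟨q, t', rfl, hst, ?_⟩
      rw [cons_eta, Function.update_self, Function.update_of_ne (by decide)]
      rfl
    · refine .inr ⟨q, t', rfl, hst, ?_⟩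
      rw [cons_eta, Function.update_self, Function.update_of_ne (by decide)]
      rfl

namespace FairSeq

variable {P : FractranProgram} {u : ℕ → STerm} {l : ℕ → Option (RRule StreamLang × List ℕ)}

theorem guarded_succ (h : P.FairSeq u l) {b : Bool} (h0 : P.Typed b (u 0)) {n : ℕ}
    (hg : Guarded (u n)) : Guarded (u (n + 1)) := by
  cases hl : l n with
  | none => rwa [h.idle n hl]
  | some x =>
    obtain ⟨hx, hst⟩ := h.step n x hl
    rcases (guarded_iff (h.typed h0 n)).1 hg with ⟨-, s, s', hs⟩ | ⟨-, hs⟩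
    · rw [hs] at hst
      rcases stepAt_cons hx hst with ⟨q, t', -, -, ht⟩ | ⟨q, t', -, -, ht⟩ <;>
        rw [ht] <;> trivial
    · rw [hs] at hst
      exact (not_stepAt_pebble hx hst).elim

/-- Every fair sequence reaches a constructor at the root. -/
theorem exists_guarded {e : ℕ → ℕ} (he : P.IsBound e) {b : Bool} :
    ∀ (k : ℕ) {u : ℕ → STerm} {l : ℕ → Option (RRule StreamLang × List ℕ)},
    P.FairSeq u l → P.Typed b (u 0) → rank e b (u 0) 0 < k →
      ∃ N, ∀ n ≥ N, Guarded (u n) := by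
  intro k
  induction k with
  | zero => intro u l _ _ h; exact absurd h (Nat.not_lt_zero _)
  | succ k ih =>
    intro u l h h0 hk
    by_cases hg : Guarded (u 0)
    · refine ⟨0, fun n _ => ?_⟩
      induction n with
      | zero => exact hg
      | succ n ih => exact h.guarded_succ h0 (ih (Nat.zero_le n))
    · obtain ⟨ρ, p, hs⟩ := h0.exists_spine hg
      -- Otherwise the redex at the end of the spine would remain an outermost redex for ever
      -- without being contracted.
      have key : ∃ j, Spine P ρ p (u j) ∧ l j = some (ρ, p) := by
        by_contra hcon
        push Not at hcon
        have hall : ∀ m, Spine P ρ p (u m) := by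
          intro m
          induction m with
          | zero => exact hs
          | succ m ihm =>
            cases hl : l m with
            | none => rwa [h.idle m hl]
            | some x =>
              refine ihm.persist (h.step m x hl).1 (h.step m x hl).2 fun hx => ?_
              exact hcon m ihm (by rw [hl, ← hx])
        exact h.fair 0 ρ hs.mem p fun m _ =>
          ⟨(hall m).isOutermostRedex, hcon m (hall m)⟩
      obtain ⟨j, hj, hlj⟩ := key
      -- Before time `j` the rank cannot rise, and at time `j` it falls, so the induction hypothesis
      -- applies to the sequence from `j + 1` on.
      have hlt := hj.rank_lt he (h.step j _ hlj).2 (h.typed h0 j) 0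
      have hle := rank_mono (e := e) b (h.cost_le he h0 j) 0
      obtain ⟨N, hN⟩ := ih (h.shift (j + 1)) (h.typed h0 _)
        (show rank e b (u (j + 1)) 0 < k by omega)
      refine ⟨j + 1 + N, fun n hn => ?_⟩
      have := hN (n - (j + 1)) (by omega)
      rwa [Nat.add_sub_cancel' (by omega)] at this

end FairSeq

/-! ### Convergence of fair sequences to the constructor stream -/

/-- The infinite stream of data elements, as a labelled tree. -/
def pebbleStream : LabelledTree StreamLang
  | [] => some (.inr ⟨2, .cons⟩)
  | [0] => some (.inr ⟨0, .pebble⟩)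
  | 1 :: p => pebbleStream p
  | _ => none

theorem label_pebble (p : List ℕ) :
    label pebble p = if p = [] then some (.inr ⟨0, .pebble⟩) else none := by
  cases p with
  | nil => rfl
  | cons i p => rw [if_neg (by simp)]; rfl

theorem label_cons_zero (s t : STerm) (p : List ℕ) : label (cons s t) (0 :: p) = label s p := rfl

theorem label_cons_one (s t : STerm) (p : List ℕ) : label (cons s t) (1 :: p) = label t p := rfl

theorem label_cons_of_le (s t : STerm) (p : List ℕ) (i : ℕ) :
    label (cons s t) ((i + 2) :: p) = none := rfl

/-- A child of a term (and the term itself if there is no such child). -/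
def child (i : ℕ) : STerm → STerm
  | .var x => .var x
  | .func (l := n) f ts => if h : i < n then ts ⟨i, h⟩ else .func f ts

namespace FairSeq

variable {P : FractranProgram} {u : ℕ → STerm} {l : ℕ → Option (RRule StreamLang × List ℕ)}

/-- The sequence induced in a child of the stream constructor. -/
theorem child (h : P.FairSeq u l) (hc : ∀ n, ∃ s s', u n = cons s s') (i : Fin 2) :
    P.FairSeq (fun n => child i (u n)) fun n => (l n).bind fun x =>
      match x.2 with
      | [] => none
      | j :: q => if j = i then some (x.1, q) else none := by
  -- Each step takes place in one child and leaves the other one unchanged; for that other child it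
  -- is idle.
  have key : ∀ n x, l n = some x → ∃ (j : Fin 2) (q : List ℕ), x.2 = (j : ℕ) :: q ∧
      StepAt x.1 q (FractranProgram.child j (u n)) (FractranProgram.child j (u (n + 1))) ∧
      ∀ j' : Fin 2, j' ≠ j → FractranProgram.child j' (u (n + 1)) = FractranProgram.child j' (u n) := by
    intro n x hx
    obtain ⟨hρ, hst⟩ := h.step n x hx
    obtain ⟨s, s', hs⟩ := hc n
    rw [hs] at hst ⊢
    rcases stepAt_cons hρ hst with ⟨q, t', hp, hst, ht⟩ | ⟨q, t', hp, hst, ht⟩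
    · refine ⟨0, q, hp, by rw [ht]; exact hst, fun j hj => ?_⟩
      obtain rfl : j = 1 := by omega
      rw [ht]; rfl
    · refine ⟨1, q, hp, by rw [ht]; exact hst, fun j hj => ?_⟩
      obtain rfl : j = 0 := by omega
      rw [ht]; rfl
  refine ⟨fun n hn => ?_, fun n x hx => ?_, fun n ρ hρ p hf => ?_⟩
  · cases hl : l n with
    | none => exact congrArg _ (h.idle n hl)
    | some x =>
      obtain ⟨j, q, hp, -, hj⟩ := key n x hl
      refine hj i fun hij => ?_
      subst hij
      rw [hl, Option.bind_some, hp] at hn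
      simp at hn
  · rw [Option.bind_eq_some_iff] at hx
    obtain ⟨y, hl, hy⟩ := hx
    obtain ⟨j, q, hp, hst, -⟩ := key n y hl
    rw [hp] at hy
    simp only [Option.ite_none_right_eq_some, Option.some.injEq] at hy
    obtain ⟨hji, rfl⟩ := hy
    obtain rfl := Fin.ext hji
    exact ⟨(h.step n y hl).1, hst⟩
  -- Fairness is inherited because a `cons` at the root is no redex: an outermost redex of the child
  -- is an outermost redex of the whole term.
  · refine h.fair n ρ hρ (i :: p) fun m hm => ?_
    obtain ⟨⟨⟨t, ht⟩, ho⟩, hl⟩ := hf m hm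
    obtain ⟨s, s', hs⟩ := hc m
    refine ⟨⟨?_, ?_⟩, fun hlm => hl ?_⟩
    · rw [hs] at ht ⊢
      have hi : i = 0 ∨ i = 1 := by omega
      rcases hi with rfl | rfl
      · exact ⟨_, .arg (L := StreamLang) StreamSymbol.cons _ 0 p t ht⟩
      · exact ⟨_, .arg (L := StreamLang) StreamSymbol.cons _ 1 p t ht⟩
    · rintro q hq hne ρ' hρ' ⟨t', ht'⟩
      rw [hs] at ht' ho
      have hi : ∀ (j : Fin 2) q', q = (j : ℕ) :: q' →
          StepAt ρ' q' (FractranProgram.child j (cons s s'))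
            (FractranProgram.child j t') → False := by
        rintro j q' rfl hst
        rw [List.cons_prefix_cons] at hq
        obtain rfl := Fin.ext hq.1
        exact ho q' hq.2 (fun h => hne (by rw [h])) ρ' hρ' ⟨_, hst⟩
      rcases stepAt_cons hρ' ht' with ⟨q', t'', hp, hst, rfl⟩ | ⟨q', t'', hp, hst, rfl⟩
      · exact hi 0 q' hp hst
      · exact hi 1 q' hp hst
    · rw [hlm]
      simp

/-- Fair sequences from streams converge to the stream of data elements. -/
theorem eventually_label {e : ℕ → ℕ} (he : P.IsBound e) (k : ℕ) :
    ∀ {u : ℕ → STerm} {l : ℕ → Option (RRule StreamLang × List ℕ)},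
    P.FairSeq u l → P.Typed true (u 0) →
      ∃ N, ∀ n ≥ N, ∀ p : List ℕ, p.length ≤ k → label (u n) p = pebbleStream p := by
  induction k with
  | zero =>
    intro u l h h0
    obtain ⟨N, hN⟩ := exists_guarded he _ h h0 (Nat.lt_succ_self _)
    refine ⟨N, fun n hn p hp => ?_⟩
    obtain rfl := List.length_eq_zero_iff.1 (Nat.le_zero.1 hp)
    rcases (guarded_iff (h.typed h0 n)).1 (hN n hn) with ⟨-, s, s', hs⟩ | ⟨hb, -⟩
    · rw [hs]; rfl
    · cases hb
  | succ k ih =>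
    intro u l h h0
    obtain ⟨N, hN⟩ := exists_guarded he _ h h0 (Nat.lt_succ_self _)
    have hc : ∀ n, ∃ s s', u (N + n) = cons s s' := fun n => by
      rcases (guarded_iff (h.typed h0 (N + n))).1 (hN _ (Nat.le_add_right _ _)) with
        ⟨-, s, s', hs⟩ | ⟨hb, -⟩
      · exact ⟨s, s', hs⟩
      · cases hb
    have ht : P.Typed true (u (N + 0)) := h.typed h0 _
    have hch : P.Typed false (FractranProgram.child 0 (u (N + 0))) ∧
        P.Typed true (FractranProgram.child 1 (u (N + 0))) := by
      obtain ⟨s, s', hs⟩ := hc 0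
      rw [hs] at ht ⊢
      exact typed_cons.1 ht
    have h1 := (h.shift N).child hc 0
    -- The first child is a data term and only has to become guarded, that is, `pebble`. The second
    -- child is a stream, for which the induction on the depth applies.
    obtain ⟨N1, hN1⟩ := exists_guarded he _ h1 hch.1 (Nat.lt_succ_self _)
    obtain ⟨N2, hN2⟩ := ih ((h.shift N).child hc 1) hch.2
    refine ⟨N + max N1 N2, fun n hn p hp => ?_⟩
    obtain ⟨m, rfl⟩ := Nat.exists_eq_add_of_le (show N ≤ n by omega)
    have hg := hN1 m (by omega)
    have hl := hN2 m (by omega)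
    rw [guarded_iff (h1.typed hch.1 m)] at hg
    obtain ⟨s, s', hs⟩ := hc m
    simp only [Fin.val_zero, Fin.val_one, hs] at hg hl ⊢
    rcases hg with ⟨hb, -⟩ | ⟨-, hg⟩
    · cases hb
    · obtain rfl : s = pebble := hg
      match p, hp with
      | [], _ => rfl
      | 0 :: p, _ =>
        rw [label_cons_zero, label_pebble]
        cases p <;> rfl
      | 1 :: p, hp =>
        rw [label_cons_one]
        exact hl p (by simpa using hp)
      | (i + 2) :: p, _ =>
        rw [label_cons_of_le]; rfl

end FairSeq

theorem pebbleStream_constructorNF (P : FractranProgram) : P.spec.ConstructorNF pebbleStream := by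
  have h1 : ∀ (f : FnSym StreamLang), f ∈ P.specSig → f = ⟨2, .cons⟩ ∨ f = ⟨0, .pebble⟩ →
      P.spec.IsConstructor f := by
    intro f hf h
    refine ⟨hf, fun ρ hρ hl => ?_⟩
    have : label ρ.1 [] = some (.inr ⟨2, .cons⟩) ∨ label ρ.1 [] = some (.inr ⟨0, .pebble⟩) := by
      rcases h with rfl | rfl
      exacts [.inl hl, .inr hl]
    rcases P.mem_rules.1 hρ with rfl | rfl | rfl | rfl | ⟨k, hk, rfl⟩
    -- The root of the `zip` rule has variable arity, so it is distinguished from `cons` and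
    -- `pebble` by the numbers of the symbols.
    case inr.inr.inr.inl =>
      rcases this with h | h <;>
      · have h' := congrArg (fun o => o.elim 0 (Sum.elim id StreamSymbol.toNat)) h
        simp only [zipRule, zip, label, Option.elim, Sum.elim_inr, StreamSymbol.toNat] at h'
        omega
    all_goals rcases this with h | h <;> cases h
  intro p
  induction p using pebbleStream.induct with
  | case1 =>
    intro x hx
    cases hx
    exact ⟨_, rfl, h1 _ (by simp [specSig]) (.inl rfl)⟩
  | case2 =>
    intro x hx
    cases hx
    exact ⟨_, rfl, h1 _ (by simp [specSig]) (.inr rfl)⟩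
  | case3 p ih => exact ih
  | case4 p h1 h2 h3 =>
    intro x hx
    rw [pebbleStream] at hx
    · cases hx
    · exact h1
    · exact h2
    · exact h3

/-- If the labels of a stream up to some depth are constructors, then its elements up to this
depth are available. -/
theorem haltsAt_of_label {P : FractranProgram} (i : ℕ) :
    ∀ {t : STerm}, P.Typed true t →
    (∀ p : List ℕ, p.length ≤ i + 1 → ∀ x, label t p = some x →
      ∃ f, x = .inr f ∧ P.spec.IsConstructor f) → P.HaltsAt t i := by
  have hg : ∀ {b : Bool} {t : STerm}, P.Typed b t → (∀ x, label t [] = some x →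
      ∃ f, x = .inr f ∧ P.spec.IsConstructor f) → Guarded t := by
    intro b t ht h
    by_contra hng
    obtain ⟨ρ, p, hs⟩ := ht.exists_spine hng
    -- The root symbol of an unguarded term is the root of some left-hand side, hence not a
    -- constructor.
    have hbad : ∀ ρ : RRule StreamLang, ρ ∈ P.spec.rules → label ρ.1 [] = label t [] → False := by
      intro ρ hρ hl
      cases hx : label t [] with
      | none => cases t <;> cases hx
      | some x =>
        obtain ⟨f, rfl, hf⟩ := h x hx
        exact hf.2 ρ hρ (hl.trans hx)
    cases hs with
    | root hc => exact hbad ρ hc.mem (by cases hc <;> rfl)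
    | head _ => exact hbad headRule (P.mem_rules.2 (.inr (.inl rfl))) rfl
    | tail _ => exact hbad tailRule (P.mem_rules.2 (.inr (.inr (.inl rfl)))) rfl
  induction i with
  | zero =>
    intro t ht h
    rcases (guarded_iff ht).1 (hg ht (h [] (by simp))) with ⟨-, s, s', rfl⟩ | ⟨hb, -⟩
    · have hs := (typed_cons.1 ht).1
      rcases (guarded_iff hs).1 (hg hs (h [0] (by simp))) with ⟨hb, -⟩ | ⟨-, rfl⟩
      · cases hb
      · trivial
    · cases hb
  | succ i ih =>
    intro t ht h
    rcases (guarded_iff ht).1 (hg ht (h [] (by simp))) with ⟨-, s, s', rfl⟩ | ⟨hb, -⟩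
    · exact ih (typed_cons.1 ht).2 fun p hp => h (1 :: p) (by simpa using hp)
    · cases hb

/-! ### Productivity -/

theorem hstep_invariant {P : FractranProgram} {a b : RState StreamLang} (h : P.spec.HStep a b)
    (ha : P.Typed true a.1) : P.Typed true b.1 ∧ P.spec.IsState b := by
  obtain ⟨hs, ρ, hρ, p, hst, hb⟩ := h
  have ht := ha.step hρ hst
  refine ⟨ht, ht.termOver, fun x hx => ?_⟩
  rw [hb, List.mem_append, List.mem_singleton] at hx
  rcases hx with hx | rfl
  · exact hs.2 x hx
  · exact hρ

theorem exists_hstep {P : FractranProgram} {a : RState StreamLang} (ha : P.Typed true a.1)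
    (hs : P.spec.IsState a) : ∃ b, P.spec.HStep a b := by
  obtain ⟨ρ, hρ, p, t, ht⟩ := ha.exists_stepAt
  exact ⟨(t, a.2 ++ [(ρ, p)]), hs, ρ, hρ, p, ht, rfl⟩

theorem isState_const (P : FractranProgram) : P.spec.IsState (const, []) :=
  ⟨P.typed_const.termOver, fun _ h => by cases h⟩

/-- A finite maximal sequence cannot occur, since well-sorted streams always contain a redex. An
infinite one is a fair sequence without idle steps, so it converges to `pebbleStream`. -/
theorem productive_of_halts {P : FractranProgram} {S : RState StreamLang → RState StreamLang → Prop}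
    (hS : P.spec.IsStrategy S) (hf : P.spec.OutermostFair S) (h : ∀ n, 0 < n → P.Halts n) :
    P.spec.Productive S const := by
  obtain ⟨e, he⟩ := exists_isBound h
  constructor
  · intro b hb hnf
    have hb' : P.Typed true b.1 ∧ P.spec.IsState b := by
      clear hnf
      induction hb with
      | refl => exact ⟨P.typed_const, P.isState_const⟩
      | tail _ hbc ih => exact hstep_invariant (hS.1 _ _ hbc) ih.1
    exact (hnf (hS.2 b (exists_hstep hb'.1 hb'.2))).elim
  · intro a h0 ha
    have hstep := fun n => hS.1 _ _ (ha n)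
    choose hst ρ hρ p hp hh using hstep
    have hseq : P.FairSeq (fun n => (a n).1) fun n => some (ρ n, p n) := by
      refine ⟨fun n hn => (Option.some_ne_none _ hn).elim, fun n x hx => ?_,
        fun n ρ' hρ' p' hf' => ?_⟩
      · cases hx
        exact ⟨hρ n, hp n⟩
      · refine hf a (by rw [h0]; exact P.typed_const.termOver) (by rw [h0]) ha n ρ' hρ' p'
          fun m hm => ⟨(hf' m hm).1, fun heq => (hf' m hm).2 ?_⟩
        rw [hh, List.append_cancel_left_eq, List.singleton_inj] at heq
        exact congrArg some heq
    have h0' : P.Typed true (a 0).1 := by rw [h0]; exact P.typed_const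
    exact ⟨pebbleStream, fun k => FairSeq.eventually_label he k hseq h0',
      P.pebbleStream_constructorNF⟩

/-- One infinite sequence of the strategy is enough. A late term agrees with the limit up to the
depth needed, so the predicate of that term holds at the index; by invariance it is the predicate of
the stream constant. -/
theorem halts_of_productive {P : FractranProgram}
    {S : RState StreamLang → RState StreamLang → Prop}
    (hS : P.spec.IsStrategy S) (h : P.spec.Productive S const) {n : ℕ} (hn : 0 < n) :
    P.Halts n := by
  have hex : ∀ a : {a : RState StreamLang // P.Typed true a.1 ∧ P.spec.IsState a},
      ∃ b : {a : RState StreamLang // P.Typed true a.1 ∧ P.spec.IsState a}, S a.1 b.1 := by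
    rintro ⟨a, ha, hs⟩
    obtain ⟨b, hb⟩ := hS.2 a (exists_hstep ha hs)
    exact ⟨⟨b, hstep_invariant (hS.1 _ _ hb) ha⟩, hb⟩
  -- The strategy may be non-deterministic; iterating a choice function yields the infinite
  -- sequence.
  choose f hf using hex
  let a : ℕ → {a : RState StreamLang // P.Typed true a.1 ∧ P.spec.IsState a} :=
    fun n => f^[n] ⟨(const, []), P.typed_const, P.isState_const⟩
  have ha : ∀ n, S (a n).1 (a (n + 1)).1 := fun n => by
    change S (f^[n] _).1 (f^[n + 1] _).1
    rw [Function.iterate_succ_apply']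
    exact hf _
  obtain ⟨s, hlim, hnf⟩ := h.2 (fun n => (a n).1) rfl ha
  have hinv : ∀ m, P.HaltsAt (a m).1.1 = P.HaltsAt const := by
    intro m
    induction m with
    | zero => rfl
    | succ m ih =>
      obtain ⟨-, ρ, hρ, p, hst, -⟩ := hS.1 _ _ (ha m)
      rw [← ih]
      exact (a m).2.1.haltsAt_step hρ hst
  obtain ⟨i, rfl⟩ := Nat.exists_eq_succ_of_ne_zero hn.ne'
  obtain ⟨N, hN⟩ := hlim (i + 1)
  have key : P.HaltsAt (a N).1.1 i :=
    haltsAt_of_label i (a N).2.1 fun p hp x hx => hnf p x (by rw [← hN N le_rfl p hp]; exact hx)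
  rw [hinv] at key
  exact key

theorem inFormat_spec (P : FractranProgram) : InFormat P.spec := by
  have hpos : ∀ k ∈ P.moduli, 1 ≤ k := by
    intro k hk
    rw [moduli, List.mem_dedup, List.mem_map] at hk
    obtain ⟨i, -, rfl⟩ := hk
    unfold modulus
    split
    · rename_i x hx
      exact Nat.mul_pos x.1.pos (Nat.div_pos
        (Nat.le_of_dvd P.denomLcm_pos (dvd_denomLcm (firstFraction_some hx).1)) x.2.pos)
    · exact P.denomLcm_pos
  have hc : ∀ t, (const, t) ∈ P.spec.rules → t = P.specRhs := by
    intro t ht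
    rcases P.mem_rules.1 ht with h | h | h | h | ⟨k, hk, h⟩
    · exact (Prod.ext_iff.1 h).2
    case inr.inr.inr.inl =>
      have h' := congrArg (fun o => o.elim 0 (Sum.elim id StreamSymbol.toNat))
        (congrArg (fun ρ : RRule StreamLang => label ρ.1 []) h)
      simp only [const, zipRule, zip, label, Option.elim, Sum.elim_inr, StreamSymbol.toNat] at h'
      omega
    all_goals cases h
  refine ⟨⟨P.specRhs, P.mem_rules.2 (.inl rfl), hc⟩, fun t ht => ?_, fun ρ hρ => ?_,
    fun _ => P.mem_rules.2 (.inr (.inl rfl)), fun _ => P.mem_rules.2 (.inr (.inr (.inl rfl))),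
    fun k hk => P.mem_rules.2 (.inr (.inr (.inr (.inr ⟨k, mod_mem_specSig.1 hk, rfl⟩)))),
    fun k hk => P.mem_rules.2 (.inr (.inr (.inr (.inl (by rw [zip_mem_specSig.1 hk])))))⟩
  · have := P.spec.rhs_vars _ ht
    rw [← Finset.subset_empty]
    refine this.trans (Finset.subset_empty.2 ?_)
    ext x
    simp [const, FirstOrder.Language.Term.varFinset]
  · rcases P.mem_rules.1 hρ with rfl | rfl | rfl | rfl | ⟨k, hk, rfl⟩
    · exact .inl rfl
    · exact .inr (.inl rfl)
    · exact .inr (.inr (.inl rfl))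
    · exact .inr (.inr (.inr ⟨_, P.denomLcm_pos, .inr rfl⟩))
    · exact .inr (.inr (.inr ⟨_, hpos k hk, .inl rfl⟩))

end FractranProgram

/-! ### Terms as lists of tokens -/

namespace LSF

open Encodable

/-- The tokens of a term in Polish notation, as numbers. -/
def toks (t : STerm) : List ℕ := t.listEncode.map encode

/-- The code of a list depends only on the codes of its entries, so computations with terms and
histories may be carried out on lists of numbers. -/
theorem encode_map_encode {α : Type*} [Encodable α] (l : List α) :
    encode (l.map encode) = encode l := by
  induction l with
  | nil => rfl
  | cons a l ih => rw [List.map_cons, encode_list_cons, encode_list_cons, ih, encode_nat]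

theorem encode_term (t : STerm) : encode t = encode (toks t) :=
  (encode_map_encode _).symm

/-- The number of the symbol `f` as a token. -/
def tok {n : ℕ} (f : StreamSymbol n) : ℕ := 2 * StreamSymbol.toNat ⟨n, f⟩ + 1

theorem toks_var (x : ℕ) : toks (.var x) = [2 * x] := rfl

theorem toks_func {n : ℕ} (f : StreamSymbol n) (ts : Fin n → STerm) :
    toks (.func (L := StreamLang) f ts) = tok f :: (List.ofFn fun i => toks (ts i)).flatten := by
  rw [toks, FirstOrder.Language.Term.listEncode, List.map_cons, List.map_flatMap,
    List.ofFn_eq_map, List.flatMap_def]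
  rfl

/-- The arity of the symbol of a token (zero for variables). -/
def arity (m : ℕ) : ℕ :=
  -- Even tokens are variables. The tokens of `pebble`, `const`, `head`, `tail` and `cons` are `1`,
  -- `3`, `5`, `7` and `9`; those of `mod k` and `zip k` are `4 * k + 11` and `4 * k + 13`.
  if m % 2 = 0 then 0 else if m < 4 then 0 else if m < 8 then 1 else if m = 9 then 2
    else if m % 4 = 3 then 1 else (m - 13) / 4

theorem arity_var (x : ℕ) : arity (2 * x) = 0 := by simp [arity]

theorem arity_tok {n : ℕ} (f : StreamSymbol n) : arity (tok f) = n := by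
  cases f with
  | mod k =>
    rw [arity, tok, StreamSymbol.toNat, if_neg (by omega), if_neg (by omega), if_neg (by omega),
      if_neg (by omega), if_pos (by omega)]
  | zip k =>
    rw [arity, tok, StreamSymbol.toNat, if_neg (by omega), if_neg (by omega), if_neg (by omega),
      if_neg (by omega), if_neg (by omega)]
    omega
  | _ => rfl

/-- Bottom-up evaluation of a list of tokens in Polish notation with a stack. -/
def stackFold {β : Type} (g : ℕ → List β → β) (l : List ℕ) : List β :=
  l.foldr (fun m st => g m (st.take (arity m)) :: st.drop (arity m)) []

/-- Bottom-up evaluation of a term. -/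
def treeFold {β : Type} (g : ℕ → List β → β) : STerm → β
  | .var x => g (2 * x) []
  | .func f ts => g (tok f) (List.ofFn fun i => treeFold g (ts i))

/-- Polish notation is read from the right, so when a symbol is reached, the values of its arguments
lie on top of the stack in their order. The suffix `l` makes the induction work. -/
theorem stackFold_toks {β : Type} (g : ℕ → List β → β) (t : STerm) (l : List ℕ) :
    stackFold g (toks t ++ l) = treeFold g t :: stackFold g l := by
  induction t generalizing l with
  | var x =>
    rw [toks_var, stackFold, List.singleton_append, List.foldr_cons, arity_var]
    rfl
  | @func n f ts ih =>
    have key : ∀ (m : ℕ) (us : Fin m → STerm),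
        (∀ i l, stackFold g (toks (us i) ++ l) = treeFold g (us i) :: stackFold g l) →
        stackFold g ((List.ofFn fun i => toks (us i)).flatten ++ l) =
          (List.ofFn fun i => treeFold g (us i)) ++ stackFold g l := by
      intro m
      induction m with
      | zero => intro us _; rfl
      | succ m ihm =>
        intro us h
        rw [List.ofFn_succ, List.ofFn_succ, List.flatten_cons, List.append_assoc, h,
          ihm _ fun i l => h _ l, List.cons_append]
    have h := key n ts ih
    rw [toks_func, List.cons_append]
    change g (tok f) ((stackFold g _).take (arity (tok f))) ::
      (stackFold g _).drop (arity (tok f)) = _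
    rw [h, arity_tok, List.take_left' (by simp), List.drop_left' (by simp)]
    rfl

/-- The code of a rule, given by the tokens of both sides. -/
def ruleCode (l r : List ℕ) : ℕ := Nat.pair (encode l) (encode r)

theorem encode_rule (ρ : RRule StreamLang) : encode ρ = ruleCode (toks ρ.1) (toks ρ.2) := by
  rw [ruleCode, ← encode_term, ← encode_term]
  rfl

theorem toks_cons (s t : STerm) : toks (cons s t) = 9 :: (toks s ++ toks t) := by
  rw [cons, toks_func]
  simp [List.ofFn_succ]
  rfl

theorem toks_unary (f : StreamSymbol 1) (t : STerm) :
    toks (.func (L := StreamLang) f fun _ => t) = tok f :: toks t := by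
  rw [toks_func]
  simp [List.ofFn_succ]

theorem toks_tailN (k : ℕ) (t : STerm) :
    toks (tailN k t) = (List.range k).map (fun _ => 7) ++ toks t := by
  induction k with
  | zero => rfl
  | succ k ih =>
    have h : toks (tailN (k + 1) t) = 7 :: toks (tailN k t) := by
      rw [tailN, Function.iterate_succ_apply']
      exact toks_unary _ _
    rw [h, ih, List.range_succ_eq_map, List.map_cons, List.map_map, List.cons_append]
    rfl

theorem toks_mod (k : ℕ) (t : STerm) : toks (mod k t) = (4 * k + 11) :: toks t := by
  refine (toks_unary _ _).trans ?_
  congr 1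
  simp only [tok, StreamSymbol.toNat]
  omega

theorem toks_zip (k : ℕ) (ts : Fin k → STerm) :
    toks (zip k ts) = (4 * k + 13) :: (List.ofFn fun i => toks (ts i)).flatten := by
  refine (toks_func _ _).trans ?_
  congr 1
  simp only [tok, StreamSymbol.toNat]
  omega

theorem toks_rotate {d : ℕ} (hd : 0 < d) (ts : Fin d → STerm) :
    (List.ofFn fun i => toks (rotate hd ts i)).flatten =
      (List.ofFn fun i => toks (ts i)).tail.flatten ++ 7 :: toks (ts ⟨0, hd⟩) := by
  obtain ⟨k, rfl⟩ := Nat.exists_eq_succ_of_ne_zero hd.ne'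
  rw [List.ofFn_succ', List.ofFn_succ, List.tail_cons, List.concat_eq_append,
    List.flatten_append, List.flatten_singleton]
  congr 2
  · congr 1
    funext i
    rw [rotate, dif_pos (by simp)]
    rfl
  · rw [rotate, dif_neg (by simp)]
    exact toks_unary _ _

theorem toks_headRule : toks headRule.1 = [5, 9, 0, 2] ∧ toks headRule.2 = [0] := by
  refine ⟨?_, rfl⟩
  rw [headRule, head, toks_unary, toks_cons]
  rfl

theorem toks_tailRule : toks tailRule.1 = [7, 9, 0, 2] ∧ toks tailRule.2 = [2] := by
  refine ⟨?_, rfl⟩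
  rw [tailRule, tail, toks_unary, toks_cons]
  rfl

theorem toks_modRule (k : ℕ) : toks (modRule k).1 = [4 * k + 11, 0] ∧
    toks (modRule k).2 = [9, 5, 0, 4 * k + 11] ++ (List.range k).map (fun _ => 7) ++ [0] := by
  constructor
  · rw [modRule, toks_mod, toks_var]
  · rw [modRule, toks_cons, toks_mod, toks_tailN, head, toks_unary, toks_var]
    simp [tok, StreamSymbol.toNat]

theorem toks_vars (k : ℕ) :
    (List.ofFn fun i : Fin k => toks (.var i)) = (List.range k).map fun i => [2 * i] := by
  refine List.ext_getElem (by simp) fun i h1 h2 => ?_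
  simp [toks_var]

theorem zipRule_eq {k : ℕ} (hk : 0 < k) : zipRule k = (zip k fun i => .var i,
    cons (head (.var 0)) (zip k (rotate hk fun i => .var i))) := rfl

theorem toks_zipRule {k : ℕ} (hk : 0 < k) :
    toks (zipRule k).1 = (4 * k + 13) :: (List.range k).map (2 * ·) ∧
    toks (zipRule k).2 = [9, 5, 0, 4 * k + 13] ++ (List.range k).tail.map (2 * ·) ++ [7, 0] := by
  have h : ∀ l : List ℕ, (l.map fun i => [2 * i]).flatten = l.map (2 * ·) := fun l => by
    induction l with
    | nil => rfl
    | cons a l ih => rw [List.map_cons, List.flatten_cons, ih]; rfl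
  rw [zipRule_eq hk]
  constructor
  · rw [toks_zip, toks_vars, h]
  · rw [toks_cons, toks_zip, toks_rotate hk, toks_vars, ← List.map_tail, h, head, toks_unary,
      toks_var]
    simp [tok, StreamSymbol.toNat]

/-! ### Computing the list of redexes -/

/-- What is computed for a subterm: its tokens, the tokens of its arguments, and its redexes,
each given by its position, the code of its rule and the tokens of the result. -/
abbrev Info : Type := (List ℕ × List (List ℕ)) × List (List ℕ × ℕ × List ℕ)

/-- The code of the rule for the symbol `mod k` with the token `m`. -/
def modCode (m : ℕ) : ℕ :=
  ruleCode [m, 0] ([9, 5, 0, m] ++ (List.range ((m - 11) / 4)).map (fun _ => 7) ++ [0])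

/-- The code of the rule for the symbol `zip k` with the token `m`. -/
def zipCode (m : ℕ) : ℕ :=
  ruleCode (m :: (List.range ((m - 13) / 4)).map (2 * ·))
    ([9, 5, 0, m] ++ (List.range ((m - 13) / 4)).tail.map (2 * ·) ++ [7, 0])

theorem encode_modRule (k : ℕ) : encode (modRule k) = modCode (4 * k + 11) := by
  rw [encode_rule, (toks_modRule k).1, (toks_modRule k).2, modCode,
    show (4 * k + 11 - 11) / 4 = k by omega]

theorem encode_zipRule {k : ℕ} (hk : 0 < k) : encode (zipRule k) = zipCode (4 * k + 13) := by
  rw [encode_rule, (toks_zipRule hk).1, (toks_zipRule hk).2, zipCode,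
    show (4 * k + 13 - 13) / 4 = k by omega]

/-- The redexes at the root, where `rhs` lists the tokens of the right-hand side of the rule for
the stream constant. -/
def rootRedexes (rhs : List ℕ) (m : ℕ) (ks : List Info) : List (List ℕ × ℕ × List ℕ) :=
  -- The cases are `const`, `head`, `tail`, `mod` and `zip`, in this order. A leading `9` says that
  -- the argument is a `cons`, and the stored token lists of its two arguments give the result.
  if m = 3 then [([], ruleCode [3] rhs, rhs)]
  else if m = 5 then
    if ks.headI.1.1.headI = 9 then [([], ruleCode [5, 9, 0, 2] [0], ks.headI.1.2.getD 0 [])]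
    else []
  else if m = 7 then
    if ks.headI.1.1.headI = 9 then [([], ruleCode [7, 9, 0, 2] [2], ks.headI.1.2.getD 1 [])]
    else []
  else if m % 4 = 3 then
    [([], modCode m,
      [9, 5] ++ ks.headI.1.1 ++ [m] ++ (List.range ((m - 11) / 4)).map (fun _ => 7) ++
        ks.headI.1.1)]
  else if m % 4 = 1 ∧ 13 ≤ m then
    [([], zipCode m,
      [9, 5] ++ ks.headI.1.1 ++ [m] ++ (ks.tail.map (·.1.1)).flatten ++ [7] ++ ks.headI.1.1)]
  else []

/-- The redexes below the root. -/
def innerRedexes (m : ℕ) (ks : List Info) : List (List ℕ × ℕ × List ℕ) :=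
  (List.range ks.length).flatMap fun i => (ks.getI i).2.map fun x =>
    (i :: x.1, x.2.1, m :: ((ks.map (·.1.1)).set i x.2.2).flatten)

/-- The evaluation step for terms. -/
def infoStep (rhs : List ℕ) (m : ℕ) (ks : List Info) : Info :=
  ((m :: (ks.map (·.1.1)).flatten, ks.map (·.1.1)), rootRedexes rhs m ks ++ innerRedexes m ks)

/-- The evaluation of a term. -/
def info (rhs : List ℕ) : STerm → Info := treeFold (infoStep rhs)

theorem info_toks (rhs : List ℕ) (t : STerm) : (info rhs t).1.1 = toks t := by
  induction t with
  | var x => rfl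
  | @func n f ts ih =>
    rw [toks_func]
    change tok f :: ((List.ofFn fun i => info rhs (ts i)).map (·.1.1)).flatten = _
    rw [List.map_ofFn]
    congr 3
    funext i
    exact ih i

theorem info_args (rhs : List ℕ) {n : ℕ} (f : StreamSymbol n) (ts : Fin n → STerm) :
    (info rhs (.func (L := StreamLang) f ts)).1.2 = List.ofFn fun i => toks (ts i) := by
  change (List.ofFn fun i => info rhs (ts i)).map (·.1.1) = _
  rw [List.map_ofFn]
  congr 1
  funext i
  exact info_toks rhs _

end LSF

namespace FractranProgram

open LSF Encodable

theorem toks_headI {t : STerm} : (toks t).headI = 9 ↔ ∃ s s', t = cons s s' := by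
  constructor
  · intro h
    match t, h with
    | .var x, h =>
      rw [toks_var, List.headI_cons] at h
      omega
    | .func .cons ts, _ => exact ⟨_, _, cons_eta ts⟩
    | .func .pebble ts, h | .func .const ts, h | .func .head ts, h | .func .tail ts, h
    | .func (.mod k) ts, h | .func (.zip k) ts, h =>
      rw [toks_func, List.headI_cons, tok, StreamSymbol.toNat] at h
      omega
  · rintro ⟨s, s', rfl⟩
    rw [toks_cons, List.headI_cons]

/-- By `Contracts.unique`, knowing one contraction of a term means knowing all of them. -/
theorem Contracts.exists_iff {P : FractranProgram} {ρ : RRule StreamLang} {s t : STerm}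
    (h : Contracts P ρ s t) {α : Type} (F : RRule StreamLang → STerm → α) (x : α) :
    (∃ ρ t, Contracts P ρ s t ∧ x = F ρ t) ↔ x = F ρ t := by
  constructor
  · rintro ⟨ρ', t', h', rfl⟩
    rw [(h.unique h').1, (h.unique h').2]
  · rintro rfl
    exact ⟨ρ, t, h, rfl⟩

/-- The computation looks at the tokens only. That a `mod` or `zip` at the root has a rule in the
system is guaranteed by its membership in the signature. -/
theorem mem_rootRedexes {P : FractranProgram} {n : ℕ} (f : StreamSymbol n) (ts : Fin n → STerm)
    (hf : (⟨n, f⟩ : FnSym StreamLang) ∈ P.specSig) (x : List ℕ × ℕ × List ℕ) :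
    x ∈ rootRedexes (toks P.specRhs) (tok f) (List.ofFn fun i => info (toks P.specRhs) (ts i)) ↔
      ∃ ρ t', Contracts P ρ (.func (L := StreamLang) f ts) t' ∧
        x = ([], encode ρ, toks t') := by
  have hd : ∀ (m : ℕ) (us : Fin (m + 1) → STerm),
      (List.ofFn fun i => info (toks P.specRhs) (us i)).headI = info (toks P.specRhs) (us 0) :=
    fun m us => by rw [List.ofFn_succ, List.headI_cons]
  have hargs : ∀ s s', (info (toks P.specRhs) (cons s s')).1.2 = [toks s, toks s'] := fun s s' =>
    (info_args _ _ _).trans rfl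
  cases f with
  | pebble =>
    refine iff_of_false (by simp [rootRedexes, tok, StreamSymbol.toNat]) ?_
    rintro ⟨ρ, t', h, -⟩
    rw [nullary_eta] at h
    exact not_stepAt_pebble h.mem h.stepAt
  | const =>
    rw [nullary_eta]
    change x ∈ [_] ↔ ∃ ρ t', Contracts P ρ LSF.const t' ∧ _
    rw [(Contracts.const (P := P)).exists_iff, encode_rule, List.mem_singleton]
    rfl
  | head =>
    rw [rootRedexes, if_neg (by decide), if_pos (by decide), hd, info_toks, unary_eta]
    split_ifs with h
    · obtain ⟨s, s', hs⟩ := toks_headI.1 h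
      rw [hs, hargs]
      change _ ↔ ∃ ρ t', Contracts P ρ (LSF.head (cons s s')) t' ∧ _
      rw [(Contracts.head (P := P) s s').exists_iff, encode_rule, toks_headRule.1,
        toks_headRule.2, List.mem_singleton]
      rfl
    · refine iff_of_false (by simp) ?_
      rintro ⟨ρ, t', hc, -⟩
      obtain ⟨s', hs⟩ := contracts_head hc
      exact h (toks_headI.2 ⟨_, _, hs⟩)
  | tail =>
    rw [rootRedexes, if_neg (by decide), if_neg (by decide), if_pos (by decide), hd, info_toks, unary_eta]
    split_ifs with h
    · obtain ⟨s, s', hs⟩ := toks_headI.1 h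
      rw [hs, hargs]
      change _ ↔ ∃ ρ t', Contracts P ρ (LSF.tail (cons s s')) t' ∧ _
      rw [(Contracts.tail (P := P) s s').exists_iff, encode_rule, toks_tailRule.1,
        toks_tailRule.2, List.mem_singleton]
      rfl
    · refine iff_of_false (by simp) ?_
      rintro ⟨ρ, t', hc, -⟩
      obtain ⟨s', hs⟩ := contracts_tail hc
      exact h (toks_headI.2 ⟨_, _, hs⟩)
  | mod k =>
    have hk : tok (StreamSymbol.mod k) = 4 * k + 11 := by
      simp only [tok, StreamSymbol.toNat]; omega
    have hk' : (4 * k + 11 - 11) / 4 = k := by omega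
    rw [unary_eta, hk, rootRedexes, if_neg (by omega), if_neg (by omega), if_neg (by omega),
      if_pos (by omega), hk', hd, info_toks, List.mem_singleton]
    change _ ↔ ∃ ρ t', Contracts P ρ (LSF.mod k (ts 0)) t' ∧ _
    rw [(Contracts.mod (P := P) k (mod_mem_specSig.1 hf) (ts 0)).exists_iff, encode_modRule,
      toks_cons, LSF.head, toks_unary, toks_mod,
      toks_tailN]
    simp [tok, StreamSymbol.toNat]
  | cons =>
    refine iff_of_false (by simp [rootRedexes, tok, StreamSymbol.toNat]) ?_
    rintro ⟨ρ, t', h, -⟩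
    rw [cons_eta] at h
    exact not_contracts_cons h
  | zip =>
    have hk : tok (StreamSymbol.zip n) = 4 * n + 13 := by
      simp only [tok, StreamSymbol.toNat]; omega
    have hk' : (4 * n + 13 - 13) / 4 = n := by omega
    have hn := zip_mem_specSig.1 hf
    have hn0 : 0 < n := by rw [hn]; exact P.denomLcm_pos
    have hhead : (List.ofFn fun i => info (toks P.specRhs) (ts i)).headI =
        info (toks P.specRhs) (ts ⟨0, hn0⟩) := by
      obtain ⟨m, rfl⟩ := Nat.exists_eq_succ_of_ne_zero hn0.ne'
      exact hd m ts
    have htail : (List.ofFn fun i => info (toks P.specRhs) (ts i)).tail.map (·.1.1) =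
        (List.ofFn fun i => toks (ts i)).tail := by
      rw [List.map_tail, List.map_ofFn]
      congr 2
      funext i
      exact info_toks _ _
    rw [hk, rootRedexes, if_neg (by omega), if_neg (by omega), if_neg (by omega),
      if_neg (by omega), if_pos (by omega), hhead, info_toks, htail, List.mem_singleton]
    change _ ↔ ∃ ρ t', Contracts P ρ (LSF.zip n ts) t' ∧ _
    rw [(Contracts.zip (P := P) n hn hn0 ts).exists_iff, encode_zipRule hn0,
      toks_cons, LSF.head, toks_unary, toks_zip,
      toks_rotate]
    simp [tok, StreamSymbol.toNat]

/-- The computed list consists of all redexes of the term. -/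
theorem mem_info {P : FractranProgram} {t : STerm} (ht : TermOver P.spec.sig t)
    (x : List ℕ × ℕ × List ℕ) :
    x ∈ (info (toks P.specRhs) t).2 ↔ ∃ ρ ∈ P.spec.rules, ∃ p t', StepAt ρ p t t' ∧
      x = (p, encode ρ, toks t') := by
  induction t generalizing x with
  | var y =>
    refine iff_of_false ?_ ?_
    · change x ∉ rootRedexes _ (2 * y) [] ++ []
      rw [rootRedexes, if_neg (by omega), if_neg (by omega), if_neg (by omega), if_neg (by omega),
        if_neg (by omega)]
      simp
    · rintro ⟨ρ, hρ, p, t', h, -⟩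
      rcases (stepAt_iff hρ).1 h with ⟨-, hc⟩ | ⟨n, f, ts, i, q, t', -, hs, -⟩
      · generalize hs : FirstOrder.Language.Term.var y = u at hc
        cases hc <;> cases hs
      · cases hs
  | @func n f ts ih =>
    change x ∈ rootRedexes _ (tok f) (List.ofFn fun i => info _ (ts i)) ++
      innerRedexes (tok f) (List.ofFn fun i => info _ (ts i)) ↔ _
    rw [List.mem_append, mem_rootRedexes f ts ht.1]
    have hinner : x ∈ innerRedexes (tok f) (List.ofFn fun i => info (toks P.specRhs) (ts i)) ↔
        ∃ i : Fin n, ∃ y ∈ (info (toks P.specRhs) (ts i)).2, ((i : ℕ) :: y.1, y.2.1,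
          tok f :: ((List.ofFn fun i => toks (ts i)).set i y.2.2).flatten) = x := by
      have hmap : (List.ofFn fun i => info (toks P.specRhs) (ts i)).map (·.1.1) =
          List.ofFn fun i => toks (ts i) := by
        rw [List.map_ofFn]
        congr 1
        funext i
        exact info_toks _ _
      have hget : ∀ i : Fin n, (List.ofFn fun i => info (toks P.specRhs) (ts i)).getI i =
          info (toks P.specRhs) (ts i) := fun i => by
        rw [List.getI_eq_getElem _ (by simp)]
        simp
      rw [innerRedexes, hmap, List.mem_flatMap, List.length_ofFn]
      constructor
      · rintro ⟨i, hi, h⟩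
        rw [List.mem_range] at hi
        rw [List.mem_map, hget ⟨i, hi⟩] at h
        exact ⟨⟨i, hi⟩, h⟩
      · rintro ⟨i, h⟩
        exact ⟨i, List.mem_range.2 i.2, by rw [List.mem_map, hget i]; exact h⟩
    have hset : ∀ (i : Fin n) (t' : STerm),
        tok f :: ((List.ofFn fun i => toks (ts i)).set i (toks t')).flatten =
          toks (.func (L := StreamLang) f (Function.update ts i t')) := by
      intro i t'
      rw [toks_func]
      congr 2
      refine List.ext_getElem (by simp) fun j h1 h2 => ?_
      rw [List.getElem_set, List.getElem_ofFn, List.getElem_ofFn]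
      split_ifs with h
      · subst h
        rw [Function.update_self]
      · rw [Function.update_of_ne]
        exact fun h' => h (by rw [← h'])
    rw [hinner]
    constructor
    · rintro (⟨ρ, t', hc, rfl⟩ | ⟨i, y, hy, rfl⟩)
      · exact ⟨ρ, hc.mem, [], t', hc.stepAt, rfl⟩
      · obtain ⟨ρ, hρ, p, t', hst, rfl⟩ := (ih i (ht.2 i) y).1 hy
        exact ⟨ρ, hρ, _, _, .arg f ts i p t' hst, by rw [← hset]⟩
    · rintro ⟨ρ, hρ, p, t', hst, rfl⟩
      rcases (stepAt_iff hρ).1 hst with ⟨rfl, hc⟩ | ⟨n', f', ts', i, q, u, rfl, hs, hst', rfl⟩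
      · exact .inl ⟨ρ, t', hc, rfl⟩
      · cases hs
        exact .inr ⟨i, _, (ih i (ht.2 i) _).2 ⟨ρ, hρ, q, u, hst', rfl⟩, by rw [← hset]⟩

/-- There is at most one redex at each position. -/
theorem stepAt_unique {P : FractranProgram} {ρ ρ' : RRule StreamLang} (hρ : ρ ∈ P.spec.rules)
    (hρ' : ρ' ∈ P.spec.rules) {p : List ℕ} {s t t' : STerm} (h : StepAt ρ p s t)
    (h' : StepAt ρ' p s t') : ρ = ρ' ∧ t = t' := by
  induction p generalizing s t t' with
  | nil =>
    rcases (stepAt_iff hρ).1 h with ⟨-, hc⟩ | ⟨n, f, ts, i, q, u, hp, -⟩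
    · rcases (stepAt_iff hρ').1 h' with ⟨-, hc'⟩ | ⟨n, f, ts, i, q, u, hp, -⟩
      · exact hc.unique hc'
      · cases hp
    · cases hp
  | cons i p ih =>
    rcases (stepAt_iff hρ).1 h with ⟨hp, -⟩ | ⟨n, f, ts, j, q, u, hp, rfl, h, rfl⟩
    · cases hp
    · rcases (stepAt_iff hρ').1 h' with ⟨hp', -⟩ | ⟨n', f', ts', j', q', u', hp', hs, h', rfl⟩
      · cases hp'
      · cases hs
        obtain ⟨rfl, rfl⟩ := List.cons.inj hp
        obtain ⟨hj, rfl⟩ := List.cons.inj hp'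
        obtain rfl := Fin.ext hj
        obtain ⟨rfl, rfl⟩ := ih h h'
        exact ⟨rfl, rfl⟩

end FractranProgram

/-! ### A computable outermost-fair strategy -/

namespace LSF

open Encodable

/-- The position that has priority in the `n`-th step: every position has priority infinitely
often. -/
def target (n : ℕ) : List ℕ := Denumerable.ofNat (List ℕ) n.unpair.1

/-- The redex that is contracted in the `n`-th step. -/
def chosen (n : ℕ) (l : List (List ℕ × ℕ × List ℕ)) : Option (List ℕ × ℕ × List ℕ) :=
  -- Appending the whole list provides a fallback if there is no redex at the priority position.
  (l.filter (fun x => x.1 = target n) ++ l).head?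

/-- The strategy on the codes of terms and histories. -/
def strategy (rhs ts hist : List ℕ) : ℕ :=
  encode ((chosen hist.length (stackFold (infoStep rhs) ts).headI.2).map fun x =>
    Nat.pair (encode x.2.2) (encode (hist ++ [Nat.pair x.2.1 (encode x.1)]))).toList

/-- The strategy on codes of states. -/
def strategyCode (rhs : List ℕ) (m : ℕ) : ℕ :=
  strategy rhs (Denumerable.ofNat (List ℕ) m.unpair.1) (Denumerable.ofNat (List ℕ) m.unpair.2)

theorem strategyCode_encode (rhs : List ℕ) (a : RState StreamLang) :
    strategyCode rhs (encode a) = encode ((chosen a.2.length (info rhs a.1).2).map fun x =>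
      Nat.pair (encode x.2.2)
        (encode ((a.2.map encode) ++ [Nat.pair x.2.1 (encode x.1)]))).toList := by
  have h1 : (encode a).unpair = (encode (toks a.1), encode (a.2.map encode)) := by
    rw [encode_map_encode, ← encode_term]
    exact Nat.unpair_pair _ _
  have h2 := stackFold_toks (infoStep rhs) a.1 []
  rw [List.append_nil] at h2
  rw [strategyCode, h1, Denumerable.ofNat_encode, Denumerable.ofNat_encode, strategy, h2,
    List.headI_cons, List.length_map]
  rfl

theorem encode_state (t : STerm) (h : History StreamLang) (ρ : RRule StreamLang) (p : List ℕ) :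
    Nat.pair (encode (toks t)) (encode (h.map encode ++ [Nat.pair (encode ρ) (encode p)])) =
      encode ((t, h ++ [(ρ, p)]) : RState StreamLang) := by
  rw [← encode_term]
  change _ = Nat.pair (encode t) (encode (h ++ [(ρ, p)]))
  rw [← encode_map_encode (h ++ [(ρ, p)]), List.map_append]
  rfl

end LSF

namespace FractranProgram

open LSF Encodable

/-- The computed list contains exactly the redexes. Hence no choice means a normal form, and the
filtered part in front enforces the priority. -/
theorem strategyCode_spec {P : FractranProgram} {a : RState StreamLang} (ha : P.spec.IsState a) :
    (strategyCode (toks P.specRhs) (encode a) = encode ([] : List (RState StreamLang)) ∧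
      ¬ ∃ b, P.spec.HStep a b) ∨
    ∃ ρ ∈ P.spec.rules, ∃ p t, StepAt ρ p a.1 t ∧
      strategyCode (toks P.specRhs) (encode a) = encode [((t, a.2 ++ [(ρ, p)]) : RState StreamLang)] ∧
      ((∃ ρ ∈ P.spec.rules, IsRedexAt ρ (target a.2.length) a.1) → p = target a.2.length) := by
  rw [strategyCode_encode]
  have hmem := fun x => mem_info ha.1 x
  generalize (info (toks P.specRhs) a.1).2 = l at hmem
  cases hc : chosen a.2.length l with
  | none =>
    refine .inl ⟨rfl, ?_⟩
    rintro ⟨b, -, ρ, hρ, p, hst, -⟩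
    have h := (hmem _).2 ⟨ρ, hρ, p, _, hst, rfl⟩
    rw [chosen, List.head?_eq_none_iff, List.append_eq_nil_iff] at hc
    rw [hc.2] at h
    cases h
  | some x =>
    right
    have hx : x ∈ l := by
      have := List.mem_of_mem_head? hc
      rw [List.mem_append, List.mem_filter] at this
      exact this.elim (·.1) id
    obtain ⟨ρ, hρ, p, t, hst, rfl⟩ := (hmem x).1 hx
    refine ⟨ρ, hρ, p, t, hst, ?_, ?_⟩
    · rw [Option.map_some, Option.toList_some, encode_state, encode_list_cons, encode_list_cons]
      rfl
    · rintro ⟨ρ', hρ', t', ht'⟩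
      have h := (hmem _).2 ⟨ρ', hρ', _, _, ht', rfl⟩
      have hne : l.filter (fun x => x.1 = target a.2.length) ≠ [] :=
        List.ne_nil_of_mem (List.mem_filter.2 ⟨h, by simp⟩)
      rw [chosen, List.head?_append_of_ne_nil _ hne] at hc
      simpa using (List.mem_filter.1 (List.mem_of_mem_head? hc)).2

/-- Starting from an empty history, the length of the history equals the number of steps made. An
outermost redex that persists is therefore contracted as soon as its position has priority. -/
theorem codesOutermostFair {P : FractranProgram} {c : Nat.Partrec.Code}
    (hc : ∀ m, c.eval m = Part.some (strategyCode (toks P.specRhs) m)) :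
    P.spec.CodesOutermostFair c := by
  have key : ∀ a b, P.spec.codedRel c a b → ∃ ρ ∈ P.spec.rules, ∃ p, StepAt ρ p a.1 b.1 ∧
      b.2 = a.2 ++ [(ρ, p)] ∧
      ((∃ ρ ∈ P.spec.rules, IsRedexAt ρ (target a.2.length) a.1) → p = target a.2.length) := by
    rintro a b ⟨ha, l, hl, hb⟩
    rw [hc, Part.mem_some_iff] at hl
    rcases strategyCode_spec ha with ⟨h, -⟩ | ⟨ρ, hρ, p, t, hst, h, hp⟩
    · rw [h, encode_inj] at hl
      rw [hl] at hb
      cases hb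
    · rw [h, encode_inj] at hl
      rw [hl, List.mem_singleton] at hb
      rw [hb]
      exact ⟨ρ, hρ, p, hst, rfl, hp⟩
  refine ⟨fun a ha => ?_, ⟨fun a b h => ?_, fun a h => ?_⟩, fun a _ h0 ha n ρ hρ p hf => ?_⟩
  · rcases strategyCode_spec ha with ⟨h, -⟩ | ⟨ρ, hρ, p, t, -, h, -⟩
    · exact ⟨_, by rw [hc, h]; exact Part.mem_some _⟩
    · exact ⟨_, by rw [hc, h]; exact Part.mem_some _⟩
  · obtain ⟨ρ, hρ, p, hst, hb, -⟩ := key a b h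
    exact ⟨h.1, ρ, hρ, p, hst, hb⟩
  · have ha : P.spec.IsState a := h.choose_spec.1
    rcases strategyCode_spec ha with ⟨-, h'⟩ | ⟨ρ, hρ, p, t, -, h', -⟩
    · exact (h' h).elim
    · exact ⟨_, ha, _, by rw [hc, h']; exact Part.mem_some _, List.mem_singleton.2 rfl⟩
  · have hlen : ∀ m, (a m).2.length = m := by
      intro m
      induction m with
      | zero => rw [h0]; rfl
      | succ m ih =>
        obtain ⟨_, _, _, _, hb, -⟩ := key _ _ (ha m)
        rw [hb, List.length_append, ih]
        rfl
    -- The number `Nat.pair (encode p) n` is at least `n`, and at this step `p` has priority.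
    obtain ⟨⟨hr, -⟩, hne⟩ := hf (Nat.pair (encode p) n) (Nat.right_le_pair _ _)
    obtain ⟨ρ', hρ', p', hst, hb, hp⟩ := key _ _ (ha (Nat.pair (encode p) n))
    have ht : target (a (Nat.pair (encode p) n)).2.length = p := by
      rw [hlen, target, Nat.unpair_pair, Denumerable.ofNat_encode]
    rw [ht] at hp
    obtain rfl := hp ⟨ρ, hρ, hr⟩
    obtain ⟨t, ht⟩ := hr
    -- Only one rule applies at `p`, so contracting there means contracting the given redex.
    obtain rfl := (stepAt_unique hρ hρ' ht hst).1
    exact hne hb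

end FractranProgram

/-! ### Computability of the strategy -/

namespace LSF

open Encodable Primrec

theorem primrec_seven : Primrec fun n : ℕ => (List.range n).map fun _ => 7 :=
  list_map list_range (Primrec.const 7).to₂

theorem primrec_double : Primrec₂ fun (_ : ℕ) (n : ℕ) => 2 * n :=
  (nat_mul.comp (.const 2) snd).to₂

theorem primrec_ruleCode : Primrec₂ ruleCode :=
  Primrec₂.natPair.comp (Primrec.encode.comp fst) (Primrec.encode.comp snd)

theorem primrec_modCode : Primrec modCode := by
  have hk : Primrec fun m : ℕ => (m - 11) / 4 :=
    nat_div.comp (nat_sub.comp .id (.const 11)) (.const 4)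
  have h4 : Primrec fun m : ℕ => [9, 5, 0, m] :=
    list_cons.comp (.const 9) <| list_cons.comp (.const 5) <| list_cons.comp (.const 0) <|
      list_cons.comp .id (.const [])
  exact primrec_ruleCode.comp (list_cons.comp .id (.const [0]))
    (list_append.comp (list_append.comp h4 (primrec_seven.comp hk)) (.const [0]))

theorem primrec_zipCode : Primrec zipCode := by
  have hk : Primrec fun m : ℕ => (m - 13) / 4 :=
    nat_div.comp (nat_sub.comp .id (.const 13)) (.const 4)
  have h4 : Primrec fun m : ℕ => [9, 5, 0, m] :=
    list_cons.comp (.const 9) <| list_cons.comp (.const 5) <| list_cons.comp (.const 0) <|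
      list_cons.comp .id (.const [])
  have hr : Primrec fun m : ℕ => List.range ((m - 13) / 4) := list_range.comp hk
  exact primrec_ruleCode.comp (list_cons.comp .id (list_map hr primrec_double))
    (list_append.comp (list_append.comp h4 (list_map (list_tail.comp hr) primrec_double))
      (.const [7, 0]))

theorem primrec_arity : Primrec arity := by
  have hmod : ∀ k, Primrec fun m : ℕ => m % k := fun k => nat_mod.comp .id (.const k)
  exact Primrec.ite (Primrec.eq.comp (hmod 2) (.const 0)) (.const 0) <|
    Primrec.ite (nat_lt.comp .id (.const 4)) (.const 0) <|
    Primrec.ite (nat_lt.comp .id (.const 8)) (.const 1) <|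
    Primrec.ite (Primrec.eq.comp .id (.const 9)) (.const 2) <|
    Primrec.ite (Primrec.eq.comp (hmod 4) (.const 3)) (.const 1) <|
    nat_div.comp (nat_sub.comp .id (.const 13)) (.const 4)

theorem primrec_rootRedexes :
    Primrec fun x : List ℕ × ℕ × List Info => rootRedexes x.1 x.2.1 x.2.2 := by
  have hm : Primrec fun x : List ℕ × ℕ × List Info => x.2.1 := fst.comp snd
  have hks : Primrec fun x : List ℕ × ℕ × List Info => x.2.2 := snd.comp snd
  have hhd : Primrec fun x : List ℕ × ℕ × List Info => x.2.2.headI := list_headI.comp hks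
  have hown : Primrec fun x : List ℕ × ℕ × List Info => x.2.2.headI.1.1 :=
    fst.comp (fst.comp hhd)
  have hargs : Primrec fun x : List ℕ × ℕ × List Info => x.2.2.headI.1.2 :=
    snd.comp (fst.comp hhd)
  have hsing : ∀ {c : List ℕ × ℕ × List Info → ℕ} {r : List ℕ × ℕ × List Info → List ℕ},
      Primrec c → Primrec r → Primrec fun x => [(([] : List ℕ), c x, r x)] := fun hc hr =>
    list_cons.comp ((Primrec.const []).pair (hc.pair hr)) (.const [])
  have hcons : PrimrecPred fun x : List ℕ × ℕ × List Info => x.2.2.headI.1.1.headI = 9 :=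
    Primrec.eq.comp (list_headI.comp hown) (.const 9)
  have h2 : ∀ k, Primrec fun x : List ℕ × ℕ × List Info => (x.2.1 - k) / 4 := fun k =>
    nat_div.comp (nat_sub.comp hm (.const k)) (.const 4)
  have hmsing : Primrec fun x : List ℕ × ℕ × List Info => [x.2.1] :=
    list_cons.comp hm (.const [])
  have hpre : Primrec fun x : List ℕ × ℕ × List Info => [9, 5] ++ x.2.2.headI.1.1 ++ [x.2.1] :=
    list_append.comp (list_append.comp (.const [9, 5]) hown) hmsing
  have hown' : Primrec₂ fun (_ : List ℕ × ℕ × List Info) (k : Info) => k.1.1 :=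
    (fst.comp (fst.comp snd)).to₂
  exact Primrec.ite (Primrec.eq.comp hm (.const 3))
      (hsing (primrec_ruleCode.comp (.const [3]) fst) fst) <|
    Primrec.ite (Primrec.eq.comp hm (.const 5))
      (Primrec.ite hcons (hsing (.const _) ((list_getD []).comp hargs (.const 0))) (.const [])) <|
    Primrec.ite (Primrec.eq.comp hm (.const 7))
      (Primrec.ite hcons (hsing (.const _) ((list_getD []).comp hargs (.const 1))) (.const [])) <|
    Primrec.ite (Primrec.eq.comp (nat_mod.comp hm (.const 4)) (.const 3))
      (hsing (primrec_modCode.comp hm)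
        (list_append.comp (list_append.comp hpre (primrec_seven.comp (h2 11))) hown)) <|
    Primrec.ite ((Primrec.eq.comp (nat_mod.comp hm (.const 4)) (.const 1)).and
        (nat_le.comp (.const 13) hm))
      (hsing (primrec_zipCode.comp hm)
        (list_append.comp (list_append.comp (list_append.comp hpre
          (list_flatten.comp (list_map (list_tail.comp hks) hown'))) (.const [7])) hown)) <|
    .const []

theorem primrec_innerRedexes : Primrec₂ innerRedexes := by
  have hown : Primrec fun ks : List Info => ks.map (·.1.1) :=
    list_map .id (fst.comp (fst.comp snd)).to₂
  have h : Primrec₂ fun (y : (ℕ × List Info) × ℕ) (x : List ℕ × ℕ × List ℕ) =>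
      (y.2 :: x.1, x.2.1, y.1.1 :: ((y.1.2.map (·.1.1)).set y.2 x.2.2).flatten) :=
    ((list_cons.comp (snd.comp fst) (fst.comp snd)).pair <|
      (fst.comp (snd.comp snd)).pair <| list_cons.comp (fst.comp (fst.comp fst)) <|
      list_flatten.comp <| list_set.comp (hown.comp (snd.comp (fst.comp fst)))
        ((snd.comp fst).pair (snd.comp (snd.comp snd)))).to₂
  have h' : Primrec fun y : (ℕ × List Info) × ℕ => (y.1.2.getI y.2).2 :=
    snd.comp (list_getI.comp (snd.comp fst) snd)
  exact list_flatMap (list_range.comp (list_length.comp snd)) (list_map h' h).to₂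

theorem primrec_infoStep :
    Primrec fun x : List ℕ × ℕ × List Info => infoStep x.1 x.2.1 x.2.2 := by
  have hown : Primrec fun x : List ℕ × ℕ × List Info => x.2.2.map (·.1.1) :=
    list_map (snd.comp snd) (fst.comp (fst.comp snd)).to₂
  exact ((list_cons.comp (fst.comp snd) (list_flatten.comp hown)).pair hown).pair
    (list_append.comp primrec_rootRedexes
      (primrec_innerRedexes.comp (fst.comp snd) (snd.comp snd)))

theorem primrec_stackFold :
    Primrec₂ fun (rhs ts : List ℕ) => stackFold (infoStep rhs) ts := by
  have h : Primrec₂ fun (x : List ℕ × List ℕ) (y : ℕ × List Info) =>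
      infoStep x.1 y.1 (y.2.take (arity y.1)) :: y.2.drop (arity y.1) := by
    have hm : Primrec fun z : (List ℕ × List ℕ) × ℕ × List Info => z.2.1 := fst.comp snd
    have hst : Primrec fun z : (List ℕ × List ℕ) × ℕ × List Info => z.2.2 := snd.comp snd
    exact (list_cons.comp
      (primrec_infoStep.comp ((fst.comp fst).pair
        (hm.pair (list_take.comp (primrec_arity.comp hm) hst))))
      (list_drop.comp (primrec_arity.comp hm) hst)).to₂
  exact list_foldr snd (.const []) h

theorem primrec_chosen : Primrec₂ chosen := by
  have ht : Primrec target := (Primrec.ofNat (List ℕ)).comp (fst.comp Primrec.unpair)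
  have hr : PrimrecRel fun (x : List ℕ × ℕ × List ℕ) (n : ℕ) => x.1 = target n :=
    Primrec.eq.comp (fst.comp fst) (ht.comp snd)
  exact list_head?.comp (list_append.comp (hr.listFilter.comp snd fst) snd)

theorem primrec_strategy :
    Primrec fun x : List ℕ × List ℕ × List ℕ => strategy x.1 x.2.1 x.2.2 := by
  have hc : Primrec fun x : List ℕ × List ℕ × List ℕ =>
      chosen x.2.2.length (stackFold (infoStep x.1) x.2.1).headI.2 :=
    primrec_chosen.comp (list_length.comp (snd.comp snd))
      (snd.comp (list_headI.comp (primrec_stackFold.comp fst (fst.comp snd))))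
  have he : Primrec fun z : (List ℕ × List ℕ × List ℕ) × (List ℕ × ℕ × List ℕ) =>
      [Nat.pair z.2.2.1 (encode z.2.1)] :=
    list_cons.comp (Primrec₂.natPair.comp (fst.comp (snd.comp snd))
      (Primrec.encode.comp (fst.comp snd))) (.const [])
  have hh : Primrec fun z : (List ℕ × List ℕ × List ℕ) × (List ℕ × ℕ × List ℕ) =>
      z.1.2.2 ++ [Nat.pair z.2.2.1 (encode z.2.1)] :=
    list_append.comp (snd.comp (snd.comp fst)) he
  have hr : Primrec fun z : (List ℕ × List ℕ × List ℕ) × (List ℕ × ℕ × List ℕ) => z.2.2.2 :=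
    snd.comp (snd.comp snd)
  have hs : Primrec₂ fun (x : List ℕ × List ℕ × List ℕ) (y : List ℕ × ℕ × List ℕ) =>
      Nat.pair (encode y.2.2) (encode (x.2.2 ++ [Nat.pair y.2.1 (encode y.1)])) :=
    (Primrec₂.natPair.comp (Primrec.encode.comp hr) (Primrec.encode.comp hh)).to₂
  exact Primrec.encode.comp (optionToList.comp (option_map hc hs))

/-- A code that computes the strategy for all right-hand sides of the stream constant. -/
theorem exists_strategyCode : ∃ c : Nat.Partrec.Code, ∀ rhs m,
    (c.curry (encode rhs)).eval m = Part.some (strategyCode rhs m) := by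
  have hl : Primrec fun n : ℕ => Denumerable.ofNat (List ℕ) n := Primrec.ofNat (List ℕ)
  have h1 : Primrec fun n : ℕ => n.unpair.1 := fst.comp Primrec.unpair
  have h2 : Primrec fun n : ℕ => n.unpair.2 := snd.comp Primrec.unpair
  have h : Primrec fun n : ℕ => strategyCode (Denumerable.ofNat (List ℕ) n.unpair.1)
      n.unpair.2 :=
    primrec_strategy.comp (g := fun n : ℕ => (Denumerable.ofNat (List ℕ) n.unpair.1,
        Denumerable.ofNat (List ℕ) n.unpair.2.unpair.1,
        Denumerable.ofNat (List ℕ) n.unpair.2.unpair.2))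
      ((hl.comp h1).pair ((hl.comp (h1.comp h2)).pair (hl.comp (h2.comp h2))))
  obtain ⟨c, hc⟩ := Nat.Partrec.Code.exists_code.1
    (Nat.Partrec.of_primrec (Primrec.nat_iff.1 h))
  refine ⟨c, fun rhs m => ?_⟩
  -- Supplying the right-hand side by `curry` makes the code of the strategy a computable function
  -- of the program, which the reduction uses.
  rw [Nat.Partrec.Code.eval_curry, hc]
  simp

end LSF

/-! ### Computability of the induced specification -/

/-- Lists of pairs of natural numbers as codes of Fractran programs. -/
def toProgram (L : List (ℕ × ℕ)) : FractranProgram :=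
  L.map fun x => (x.1.succPNat, x.2.succPNat)

theorem toProgram_surjective : Function.Surjective toProgram := fun P => by
  refine ⟨P.map fun x => (x.1.natPred, x.2.natPred), ?_⟩
  rw [toProgram, List.map_map]
  conv_rhs => rw [← List.map_id P]
  refine List.map_congr_left fun x _ => ?_
  simp

namespace ProgramCode

open Encodable Primrec LSF

/-- The first applicable fraction, with both components decreased by one. -/
def firstFraction (L : List (ℕ × ℕ)) (n : ℕ) : Option (ℕ × ℕ) :=
  (L.filter fun x => n * (x.1 + 1) % (x.2 + 1) = 0).head?

theorem firstFraction_toProgram (L : List (ℕ × ℕ)) (n : ℕ) :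
    (toProgram L).firstFraction n =
      (firstFraction L n).map fun x => (x.1.succPNat, x.2.succPNat) := by
  rw [FractranProgram.firstFraction, toProgram, List.find?_map, firstFraction, List.head?_filter]
  congr 2
  funext x
  exact decide_eq_decide.2 Nat.dvd_iff_mod_eq_zero

/-- One step of the program. -/
def step (L : List (ℕ × ℕ)) (n : ℕ) : Option ℕ :=
  (firstFraction L n).map fun x => n * (x.1 + 1) / (x.2 + 1)

theorem step_toProgram (L : List (ℕ × ℕ)) (n : ℕ) : (toProgram L).step n = step L n := by
  rw [FractranProgram.step, firstFraction_toProgram, Option.map_map]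
  rfl

/-- The greatest common divisor, by search. -/
theorem gcd_eq_findGreatest (a b : ℕ) :
    Nat.gcd a b = Nat.findGreatest (fun k => a % k = 0 ∧ b % k = 0) (a + b) := by
  simp only [← Nat.dvd_iff_mod_eq_zero]
  -- The bound `a + b` also covers the case of one zero argument; if both vanish, every number is a
  -- common divisor and the bound makes the search return `0`.
  rcases Nat.eq_zero_or_pos (a + b) with h | h
  · obtain ⟨rfl, rfl⟩ : a = 0 ∧ b = 0 := by omega
    rfl
  · have hg : 0 < Nat.gcd a b := Nat.pos_of_ne_zero fun h0 => by
      rw [Nat.gcd_eq_zero_iff] at h0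
      omega
    have hle : Nat.gcd a b ≤ a + b :=
      Nat.le_of_dvd h (dvd_add (Nat.gcd_dvd_left a b) (Nat.gcd_dvd_right a b))
    have hspec := Nat.findGreatest_spec (P := fun k => k ∣ a ∧ k ∣ b) hle
      ⟨Nat.gcd_dvd_left a b, Nat.gcd_dvd_right a b⟩
    exact le_antisymm
      (Nat.le_findGreatest hle ⟨Nat.gcd_dvd_left a b, Nat.gcd_dvd_right a b⟩)
      (Nat.le_of_dvd hg (Nat.dvd_gcd hspec.1 hspec.2))

theorem primrec_gcd : Primrec₂ Nat.gcd := by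
  have hr : PrimrecRel fun (x : ℕ × ℕ) (k : ℕ) => x.1 % k = 0 ∧ x.2 % k = 0 :=
    (Primrec.eq.comp (nat_mod.comp (fst.comp fst) snd) (.const 0)).and
      (Primrec.eq.comp (nat_mod.comp (snd.comp fst) snd) (.const 0))
  exact (nat_findGreatest (nat_add.comp fst snd) hr).of_eq fun x =>
    (gcd_eq_findGreatest x.1 x.2).symm

theorem primrec_lcm : Primrec₂ Nat.lcm :=
  nat_div.comp (nat_mul.comp fst snd) primrec_gcd

/-- The least common multiple of the denominators. -/
def denomLcm (L : List (ℕ × ℕ)) : ℕ := L.foldr (fun x d => Nat.lcm (x.2 + 1) d) 1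

theorem denomLcm_toProgram (L : List (ℕ × ℕ)) : (toProgram L).denomLcm = denomLcm L := by
  induction L with
  | nil => rfl
  | cons x L ih => exact congrArg (Nat.lcm (x.2 + 1)) ih

/-- The modulus in the `n`-th argument. -/
def modulus (L : List (ℕ × ℕ)) (n : ℕ) : ℕ :=
  ((firstFraction L n).map fun x => (x.1 + 1) * (denomLcm L / (x.2 + 1))).getD (denomLcm L)

theorem modulus_toProgram (L : List (ℕ × ℕ)) (n : ℕ) :
    (toProgram L).modulus n = modulus L n := by
  rw [FractranProgram.modulus, firstFraction_toProgram, denomLcm_toProgram, modulus]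
  cases firstFraction L n <;> rfl

/-- The tokens of the `n`-th argument. -/
def translArg (L : List (ℕ × ℕ)) (n : ℕ) : List ℕ :=
  ((firstFraction L n).map fun x => [4 * modulus L n + 11] ++
      (List.range (n * (x.1 + 1) / (x.2 + 1) - 1)).map (fun _ => 7) ++ [3]).getD
    ([9, 1] ++ [4 * modulus L n + 11] ++ (List.range (n - 1)).map (fun _ => 7) ++ [3])

theorem toks_translArg (L : List (ℕ × ℕ)) (n : ℕ) :
    toks ((toProgram L).translArg n) = translArg L n := by
  rw [FractranProgram.translArg, firstFraction_toProgram, translArg, ← modulus_toProgram]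
  cases firstFraction L n with
  | none =>
    simp only [Option.map_none, Option.getD_none]
    rw [toks_cons, toks_mod, toks_tailN]
    rfl
  | some x =>
    simp only [Option.map_some, Option.getD_some]
    rw [toks_mod, toks_tailN]
    rfl

/-- The tokens of the right-hand side of the rule for the stream constant. -/
def specRhs (L : List (ℕ × ℕ)) : List ℕ :=
  (4 * denomLcm L + 13) :: (List.range (denomLcm L)).flatMap fun i => translArg L (i + 1)

theorem toks_specRhs (L : List (ℕ × ℕ)) : toks (toProgram L).specRhs = specRhs L := by
  rw [FractranProgram.specRhs, toks_zip, denomLcm_toProgram, specRhs, List.flatMap_def]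
  congr 2
  refine List.ext_getElem (by simp) fun i h1 h2 => ?_
  simp [toks_translArg]

/-- The moduli that occur in the right-hand side. -/
def moduli (L : List (ℕ × ℕ)) : List ℕ :=
  ((List.range (denomLcm L)).map fun i => modulus L (i + 1)).foldr
    (fun a l => if ∃ b ∈ l, b = a then l else a :: l) []

theorem moduli_toProgram (L : List (ℕ × ℕ)) : (toProgram L).moduli = moduli L := by
  have h : ∀ l : List ℕ, l.dedup = l.foldr (fun a l => if ∃ b ∈ l, b = a then l else a :: l) [] := by
    intro l
    induction l with
    | nil => rfl
    | cons a l ih =>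
      rw [List.foldr_cons, ← ih]
      simp only [exists_eq_right, List.mem_dedup]
      split_ifs with h
      · exact List.dedup_cons_of_mem h
      · exact List.dedup_cons_of_notMem h
  rw [FractranProgram.moduli, moduli, h, denomLcm_toProgram]
  simp only [modulus_toProgram]

/-- The code of the induced specification. -/
def spec (L : List (ℕ × ℕ)) : ℕ :=
  Nat.pair
    (encode ([0, 4, 2, 3] ++ [2 * denomLcm L + 6, 1] ++ (moduli L).map fun k => 2 * k + 5))
    (encode ([ruleCode [3] (specRhs L), ruleCode [5, 9, 0, 2] [0], ruleCode [7, 9, 0, 2] [2],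
      zipCode (4 * denomLcm L + 13)] ++ (moduli L).map fun k => modCode (4 * k + 11)))

/-- Signature and rules are coded entry by entry, using the symbol numbers for the signature and the
token lists for the rules. -/
theorem encode_spec (L : List (ℕ × ℕ)) : encode (toProgram L).spec = spec L := by
  have h : encode (toProgram L).spec =
      Nat.pair (encode (toProgram L).specSig) (encode (toProgram L).specRules) := rfl
  rw [h, spec, ← encode_map_encode, ← encode_map_encode (toProgram L).specRules]
  refine congrArg₂ Nat.pair (congrArg encode ?_) (congrArg encode ?_)
  · rw [FractranProgram.specSig, List.map_append, List.map_map, moduli_toProgram,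
      ← denomLcm_toProgram]
    rfl
  · rw [FractranProgram.specRules, List.map_append, List.map_map, moduli_toProgram]
    refine congrArg₂ (· ++ ·) ?_ (List.map_congr_left fun k _ => encode_modRule k)
    · simp only [List.map_cons, List.map_nil]
      rw [encode_zipRule (toProgram L).denomLcm_pos, encode_rule, encode_rule, encode_rule,
        toks_specRhs, toks_headRule.1, toks_headRule.2, toks_tailRule.1, toks_tailRule.2,
        denomLcm_toProgram]
      rfl

theorem primrec_firstFraction : Primrec₂ firstFraction := by
  have hr : PrimrecRel fun (x : ℕ × ℕ) (n : ℕ) => n * (x.1 + 1) % (x.2 + 1) = 0 :=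
    Primrec.eq.comp (nat_mod.comp (nat_mul.comp snd (succ.comp (fst.comp fst)))
      (succ.comp (snd.comp fst))) (.const 0)
  exact list_head?.comp hr.listFilter

theorem primrec_step : Primrec₂ step := by
  have h : Primrec₂ fun (y : List (ℕ × ℕ) × ℕ) (x : ℕ × ℕ) => y.2 * (x.1 + 1) / (x.2 + 1) :=
    nat_div.comp (nat_mul.comp (snd.comp fst) (succ.comp (fst.comp snd)))
      (succ.comp (snd.comp snd))
  exact option_map primrec_firstFraction h

theorem primrec_denomLcm : Primrec denomLcm := by
  have h : Primrec₂ fun (_ : List (ℕ × ℕ)) (y : (ℕ × ℕ) × ℕ) => Nat.lcm (y.1.2 + 1) y.2 :=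
    primrec_lcm.comp (succ.comp (snd.comp (fst.comp snd))) (snd.comp snd)
  exact list_foldr .id (.const 1) h

theorem primrec_modulus : Primrec₂ modulus := by
  have hd : Primrec fun y : (List (ℕ × ℕ) × ℕ) × (ℕ × ℕ) => denomLcm y.1.1 :=
    primrec_denomLcm.comp (fst.comp fst)
  have h : Primrec₂ fun (y : List (ℕ × ℕ) × ℕ) (x : ℕ × ℕ) =>
      (x.1 + 1) * (denomLcm y.1 / (x.2 + 1)) :=
    nat_mul.comp (succ.comp (fst.comp snd)) (nat_div.comp hd (succ.comp (snd.comp snd)))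
  exact option_getD.comp (option_map primrec_firstFraction h) (primrec_denomLcm.comp fst)

theorem primrec_translArg : Primrec₂ translArg := by
  have hm : Primrec fun y : List (ℕ × ℕ) × ℕ => [4 * modulus y.1 y.2 + 11] :=
    list_cons.comp (nat_add.comp (nat_mul.comp (.const 4) primrec_modulus) (.const 11)) (.const [])
  have h7 : Primrec fun y : (List (ℕ × ℕ) × ℕ) × (ℕ × ℕ) =>
      (List.range (y.1.2 * (y.2.1 + 1) / (y.2.2 + 1) - 1)).map fun _ => 7 :=
    primrec_seven.comp (nat_sub.comp (nat_div.comp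
      (nat_mul.comp (snd.comp fst) (succ.comp (fst.comp snd)))
      (succ.comp (snd.comp snd))) (.const 1))
  have h : Primrec₂ fun (y : List (ℕ × ℕ) × ℕ) (x : ℕ × ℕ) => [4 * modulus y.1 y.2 + 11] ++
      (List.range (y.2 * (x.1 + 1) / (x.2 + 1) - 1)).map (fun _ => 7) ++ [3] :=
    list_append.comp (list_append.comp (hm.comp fst) h7) (.const [3])
  have h' : Primrec fun y : List (ℕ × ℕ) × ℕ => [9, 1] ++ [4 * modulus y.1 y.2 + 11] ++
      (List.range (y.2 - 1)).map (fun _ => 7) ++ [3] :=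
    list_append.comp (list_append.comp (list_append.comp (.const [9, 1]) hm)
      (primrec_seven.comp (nat_sub.comp snd (.const 1)))) (.const [3])
  exact option_getD.comp (option_map primrec_firstFraction h) h'

theorem primrec_specRhs : Primrec specRhs := by
  have h : Primrec₂ fun (L : List (ℕ × ℕ)) (i : ℕ) => translArg L (i + 1) :=
    primrec_translArg.comp fst (succ.comp snd)
  exact list_cons.comp (nat_add.comp (nat_mul.comp (.const 4) primrec_denomLcm) (.const 13))
    (list_flatMap (list_range.comp primrec_denomLcm) h)

theorem primrec_moduli : Primrec moduli := by
  have h : Primrec₂ fun (L : List (ℕ × ℕ)) (i : ℕ) => modulus L (i + 1) :=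
    primrec_modulus.comp fst (succ.comp snd)
  have hmem : PrimrecRel fun (l : List ℕ) (a : ℕ) => ∃ b ∈ l, b = a :=
    PrimrecRel.exists_mem_list Primrec.eq
  have h' : Primrec₂ fun (_ : List (ℕ × ℕ)) (y : ℕ × List ℕ) =>
      if ∃ b ∈ y.2, b = y.1 then y.2 else y.1 :: y.2 :=
    Primrec.ite (hmem.comp (snd.comp snd) (fst.comp snd)) (snd.comp snd)
      (list_cons.comp (fst.comp snd) (snd.comp snd))
  exact list_foldr (list_map (list_range.comp primrec_denomLcm) h) (.const []) h'

theorem primrec_spec : Primrec spec := by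
  have h1 : Primrec fun L : List (ℕ × ℕ) => [2 * denomLcm L + 6, 1] :=
    list_cons.comp (nat_add.comp (nat_mul.comp (.const 2) primrec_denomLcm) (.const 6)) (.const [1])
  have h2 : Primrec₂ fun (_ : List (ℕ × ℕ)) (k : ℕ) => 2 * k + 5 :=
    nat_add.comp (nat_mul.comp (.const 2) snd) (.const 5)
  have h3 : Primrec₂ fun (_ : List (ℕ × ℕ)) (k : ℕ) => modCode (4 * k + 11) :=
    primrec_modCode.comp (nat_add.comp (nat_mul.comp (.const 4) snd) (.const 11))
  have h4 : Primrec fun L : List (ℕ × ℕ) => [zipCode (4 * denomLcm L + 13)] :=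
    list_cons.comp (primrec_zipCode.comp (nat_add.comp
      (nat_mul.comp (.const 4) primrec_denomLcm) (.const 13))) (.const [])
  have h5 : Primrec fun L : List (ℕ × ℕ) => [ruleCode [3] (specRhs L),
      ruleCode [5, 9, 0, 2] [0], ruleCode [7, 9, 0, 2] [2], zipCode (4 * denomLcm L + 13)] :=
    list_cons.comp (primrec_ruleCode.comp (.const [3]) primrec_specRhs)
      (list_cons.comp (.const (ruleCode [5, 9, 0, 2] [0]))
        (list_cons.comp (.const (ruleCode [7, 9, 0, 2] [2])) h4))
  have hs : Primrec fun L : List (ℕ × ℕ) => [0, 4, 2, 3] ++ [2 * denomLcm L + 6, 1] ++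
      (moduli L).map fun k => 2 * k + 5 :=
    list_append.comp (list_append.comp (.const [0, 4, 2, 3]) h1) (list_map primrec_moduli h2)
  exact Primrec₂.natPair.comp (Primrec.encode.comp hs)
    (Primrec.encode.comp (list_append.comp h5 (list_map primrec_moduli h3)))

end ProgramCode

/-! ### Counter machines and loop programs -/

namespace CounterMachine

/-- Instructions of counter machines: `add r k t` adds `k` to the register `r` and jumps to `t`;
`dec r t₁ t₂` decrements the register `r` and jumps to `t₁`, or jumps to `t₂` if the register
is zero. -/
inductive Instr
  | add (r k t : ℕ)
  | dec (r t₁ t₂ : ℕ)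

/-- The step function on pairs of a program counter and the contents of the registers. -/
def step (prog : List Instr) (c : ℕ × (ℕ → ℕ)) : Option (ℕ × (ℕ → ℕ)) :=
  match prog[c.1]? with
  | none => none
  | some (.add r k t) => some (t, Function.update c.2 r (c.2 r + k))
  | some (.dec r t₁ t₂) =>
    if c.2 r = 0 then some (t₂, c.2) else some (t₁, Function.update c.2 r (c.2 r - 1))

/-- Reachability in a number of steps. -/
abbrev Reaches (prog : List Instr) : ℕ × (ℕ → ℕ) → ℕ × (ℕ → ℕ) → Prop :=
  Relation.ReflTransGen fun a b => step prog a = some b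

/-- No instruction jumps to itself, where `b` is the address of the first instruction. -/
def NoSelfJump : ℕ → List Instr → Prop
  | _, [] => True
  | b, .add _ _ t :: l => t ≠ b ∧ NoSelfJump (b + 1) l
  | b, .dec _ t₁ t₂ :: l => (t₁ ≠ b ∧ t₂ ≠ b) ∧ NoSelfJump (b + 1) l

theorem noSelfJump_append (b : ℕ) (l l' : List Instr) :
    NoSelfJump b (l ++ l') ↔ NoSelfJump b l ∧ NoSelfJump (b + l.length) l' := by
  induction l generalizing b with
  | nil => simp [NoSelfJump]
  | cons i l ih =>
    cases i <;>
      simp only [List.cons_append, NoSelfJump, ih, List.length_cons, and_assoc,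
        Nat.add_comm 1, Nat.add_assoc]

/-- Loop programs. The command `loop r c` repeats the decrement of `r` followed by `c` until `r`
is zero. -/
inductive Cmd
  | skip
  | add (r k : ℕ)
  | seq (c₁ c₂ : Cmd)
  | loop (r : ℕ) (c : Cmd)

/-- The iteration of a loop body. -/
def loopEval (r : ℕ) (f : (ℕ → ℕ) → ℕ → ℕ) : ℕ → (ℕ → ℕ) → ℕ → ℕ
  | 0, v => v
  | n + 1, v => loopEval r f n (f (Function.update v r n))

namespace Cmd

/-- The number of instructions of the compiled command. -/
def size : Cmd → ℕ
  | skip => 0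
  | add _ _ => 1
  | seq c₁ c₂ => c₁.size + c₂.size
  | loop _ c => c.size + 2

/-- The instructions of a command at the address `b`. -/
def compile : Cmd → ℕ → List Instr
  | skip, _ => []
  | add r k, b => [.add r k (b + 1)]
  | seq c₁ c₂, b => c₁.compile b ++ c₂.compile (b + c₁.size)
  | loop r c, b => .dec r (b + 1) (b + c.size + 2) :: (c.compile (b + 1) ++ [.add 0 0 b])

/-- The effect of a command on the registers. -/
def eval : Cmd → (ℕ → ℕ) → ℕ → ℕ
  | skip, v => v
  | add r k, v => Function.update v r (v r + k)
  | seq c₁ c₂, v => c₂.eval (c₁.eval v)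
  | loop r c, v => loopEval r c.eval (v r) v

/-- The registers that are modified by the command. -/
def Writes : Cmd → ℕ → Prop
  | skip, _ => False
  | add r _, x => x = r
  | seq c₁ c₂, x => c₁.Writes x ∨ c₂.Writes x
  | loop r c, x => x = r ∨ c.Writes x

/-- The bodies of loops do not modify the loop register. -/
def WF : Cmd → Prop
  | skip => True
  | add _ _ => True
  | seq c₁ c₂ => c₁.WF ∧ c₂.WF
  | loop r c => ¬ c.Writes r ∧ c.WF

theorem length_compile (c : Cmd) (b : ℕ) : (c.compile b).length = c.size := by
  induction c generalizing b with
  | skip => rfl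
  | add r k => rfl
  | seq c₁ c₂ ih₁ ih₂ => rw [compile, List.length_append, ih₁, ih₂, size]
  | loop r c ih => rw [compile, List.length_cons, List.length_append, ih]; rfl

/-- A self-jump would have to be avoided in the Fractran simulation: the state prime would cancel
from its fraction, which could then apply to integers without that state. -/
theorem noSelfJump_compile (c : Cmd) (b : ℕ) : NoSelfJump b (c.compile b) := by
  induction c generalizing b with
  | skip => trivial
  | add r k => exact ⟨Nat.succ_ne_self b, trivial⟩
  | seq c₁ c₂ ih₁ ih₂ =>
    rw [compile, noSelfJump_append, length_compile]
    exact ⟨ih₁ _, ih₂ _⟩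
  | loop r c ih =>
    refine ⟨⟨Nat.succ_ne_self b, by omega⟩, ?_⟩
    rw [noSelfJump_append, length_compile]
    exact ⟨ih _, by omega, trivial⟩

theorem loopEval_eq {r x : ℕ} {f : (ℕ → ℕ) → ℕ → ℕ} (hf : ∀ v, f v x = v x) (hx : x ≠ r)
    (n : ℕ) (v : ℕ → ℕ) : loopEval r f n v x = v x := by
  induction n generalizing v with
  | zero => rfl
  | succ n ih => rw [loopEval, ih, hf, Function.update_of_ne hx]

theorem eval_of_not_writes {c : Cmd} {x : ℕ} (hx : ¬ c.Writes x) (v : ℕ → ℕ) :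
    c.eval v x = v x := by
  induction c generalizing v with
  | skip => rfl
  | add r k => exact Function.update_of_ne hx _ _
  | seq c₁ c₂ ih₁ ih₂ =>
    rw [Writes, not_or] at hx
    rw [eval, ih₂ hx.2, ih₁ hx.1]
  | loop r c ih =>
    rw [Writes, not_or] at hx
    exact loopEval_eq (ih hx.2) hx.1 _ _

theorem step_at {prog pre post : List Instr} {i : Instr} (hp : prog = pre ++ i :: post)
    (v : ℕ → ℕ) : step prog (pre.length, v) =
      match i with
      | .add r k t => some (t, Function.update v r (v r + k))
      | .dec r t₁ t₂ => if v r = 0 then some (t₂, v) else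
          some (t₁, Function.update v r (v r - 1)) := by
  have h : prog[pre.length]? = some i := by
    rw [hp, List.getElem?_append_right le_rfl, Nat.sub_self]
    rfl
  rw [step]
  simp only [h]
  cases i <;> rfl

/-- A compiled command computes its effect. -/
theorem run {prog : List Instr} (c : Cmd) (hc : c.WF) (pre post : List Instr)
    (hp : prog = pre ++ (c.compile pre.length ++ post)) (v : ℕ → ℕ) :
    Reaches prog (pre.length, v) (pre.length + c.size, c.eval v) := by
  induction c generalizing pre post v with
  | skip => exact .refl
  | add r k => exact .single (step_at hp v)
  | seq c₁ c₂ ih₁ ih₂ =>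
    rw [compile, List.append_assoc] at hp
    have h₁ := ih₁ hc.1 pre _ hp v
    have h₂ := ih₂ hc.2 (pre ++ c₁.compile pre.length) post
      (by rw [hp, List.append_assoc, List.length_append, length_compile]) (c₁.eval v)
    rw [List.length_append, length_compile] at h₂
    rw [size, ← Nat.add_assoc]
    exact h₁.trans h₂
  | loop r c ih =>
    have hp' : prog = (pre ++ [.dec r (pre.length + 1) (pre.length + c.size + 2)]) ++
        (c.compile (pre.length + 1) ++ ([.add 0 0 pre.length] ++ post)) := by
      rw [hp, compile]
      simp
    -- Adding zero to a register serves as an unconditional jump back to the head of the loop.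
    have hgoto : ∀ v, step prog (pre.length + 1 + c.size, v) = some (pre.length, v) := by
      intro v
      have h := step_at (prog := prog)
        (pre := pre ++ [.dec r (pre.length + 1) (pre.length + c.size + 2)] ++
          c.compile (pre.length + 1)) (i := .add 0 0 pre.length) (post := post)
        (by rw [hp']; simp) v
      simp only [List.length_append, length_compile, List.length_singleton] at h
      rw [h, Nat.add_zero, Function.update_eq_self]
    have hdec : ∀ v, step prog (pre.length, v) = if v r = 0 then
        some (pre.length + c.size + 2, v) else
          some (pre.length + 1, Function.update v r (v r - 1)) := fun v => step_at hp v
    -- The body does not modify `r`, so the register really counts the remaining rounds.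
    have key : ∀ (n : ℕ) (v : ℕ → ℕ), v r = n → Reaches prog (pre.length, v)
        (pre.length + c.size + 2, loopEval r c.eval n v) := by
      intro n
      induction n with
      | zero =>
        intro v hv
        exact .single (by rw [hdec, if_pos hv]; rfl)
      | succ n ihn =>
        intro v hv
        have h₁ : step prog (pre.length, v) =
            some (pre.length + 1, Function.update v r n) := by
          rw [hdec, if_neg (by omega), hv]
          rfl
        have h₂ := ih hc.2 _ _ (by rw [hp', List.length_append]; rfl) (Function.update v r n)
        rw [List.length_append] at h₂
        refine .head h₁ (h₂.trans (.head (hgoto _) (ihn _ ?_)))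
        rw [eval_of_not_writes hc.1, Function.update_self]
    exact key _ v rfl

/-- From every point of a compiled command, its end is reached. -/
theorem exit {prog : List Instr} (c : Cmd) (hc : c.WF) (pre post : List Instr)
    (hp : prog = pre ++ (c.compile pre.length ++ post)) (j : ℕ) (hj : j ≤ c.size) (v : ℕ → ℕ) :
    ∃ v', Reaches prog (pre.length + j, v) (pre.length + c.size, v') ∧
      ∀ x, ¬ c.Writes x → v' x = v x := by
  induction c generalizing pre post j v with
  | skip =>
    obtain rfl : j = 0 := by simpa [size] using hj
    exact ⟨v, .refl, fun _ _ => rfl⟩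
  | add r k =>
    rcases Nat.eq_zero_or_pos j with rfl | hj0
    · exact ⟨_, run (.add r k) hc pre post hp v, fun x hx => eval_of_not_writes hx v⟩
    · obtain rfl : j = 1 := by rw [size] at hj; omega
      exact ⟨v, .refl, fun _ _ => rfl⟩
  | seq c₁ c₂ ih₁ ih₂ =>
    rw [compile, List.append_assoc] at hp
    have hp₂ : prog = (pre ++ c₁.compile pre.length) ++
        (c₂.compile (pre ++ c₁.compile pre.length).length ++ post) := by
      rw [hp, List.append_assoc, List.length_append, length_compile]
    have hlen : (pre ++ c₁.compile pre.length).length = pre.length + c₁.size := by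
      rw [List.length_append, length_compile]
    rw [size] at hj ⊢
    rcases Nat.le_total j c₁.size with hj₁ | hj₁
    · obtain ⟨v', hv', hx⟩ := ih₁ hc.1 pre _ hp j hj₁ v
      have h₂ := run c₂ hc.2 _ _ hp₂ v'
      rw [hlen, Nat.add_assoc] at h₂
      refine ⟨_, hv'.trans h₂, fun x hw => ?_⟩
      rw [Writes, not_or] at hw
      rw [eval_of_not_writes hw.2, hx x hw.1]
    · obtain ⟨v', hv', hx⟩ := ih₂ hc.2 _ _ hp₂ (j - c₁.size) (by omega) v
      rw [hlen, Nat.add_assoc, Nat.add_assoc, Nat.add_sub_cancel' hj₁] at hv'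
      exact ⟨v', hv', fun x hw => hx x fun h => hw (.inr h)⟩
  | loop r c ih =>
    have hrun := run (.loop r c) hc pre post hp
    have hp' : prog = (pre ++ [.dec r (pre.length + 1) (pre.length + c.size + 2)]) ++
        (c.compile (pre.length + 1) ++ ([.add 0 0 pre.length] ++ post)) := by
      rw [hp, compile]
      simp
    have hgoto : ∀ v, step prog (pre.length + 1 + c.size, v) = some (pre.length, v) := by
      intro v
      have h := step_at (prog := prog)
        (pre := pre ++ [.dec r (pre.length + 1) (pre.length + c.size + 2)] ++
          c.compile (pre.length + 1)) (i := .add 0 0 pre.length) (post := post)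
        (by rw [hp']; simp) v
      simp only [List.length_append, length_compile, List.length_singleton] at h
      rw [h, Nat.add_zero, Function.update_eq_self]
    rw [size] at hj
    rcases Nat.eq_zero_or_pos j with rfl | hj0
    · exact ⟨_, hrun v, fun x hx => eval_of_not_writes hx v⟩
    · rcases Nat.lt_or_ge j (c.size + 2) with hlt | hge
      -- From inside the body its end is reached by induction; the jump then leads to the head of
      -- the loop, from where the complete loop is run with whatever registers have resulted.
      · obtain ⟨v', hv', hx⟩ := ih hc.2 _ _ (by rw [hp', List.length_append]; rfl) (j - 1)
          (by omega) v
        rw [List.length_append, List.length_singleton] at hv'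
        rw [show pre.length + 1 + (j - 1) = pre.length + j by omega] at hv'
        refine ⟨_, hv'.trans (.head (hgoto v') (hrun v')), fun x hw => ?_⟩
        rw [eval_of_not_writes hw, hx x fun h => hw (.inr h)]
      · obtain rfl : j = c.size + 2 := by omega
        exact ⟨v, .refl, fun _ _ => rfl⟩

/-! ### Primitive recursive functions by loop programs -/

/-- Set a register to zero. -/
def clear (r : ℕ) : Cmd := loop r skip

/-- Copy the register `x` to `y` by means of the auxiliary register `t`. -/
def copy (x y t : ℕ) : Cmd :=
  seq (clear y) <| seq (clear t) <| seq (loop x (seq (add y 1) (add t 1))) (loop t (add x 1))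

theorem eval_clear (r : ℕ) (v : ℕ → ℕ) : (clear r).eval v = Function.update v r 0 := by
  have key : ∀ (n : ℕ) (v : ℕ → ℕ), v r = n →
      loopEval r (fun v => v) n v = Function.update v r 0 := by
    intro n
    induction n with
    | zero =>
      intro v hv
      exact (congrArg (Function.update v r) hv.symm |>.trans (Function.update_eq_self ..)).symm
    | succ n ih => intro v _; rw [loopEval, ih _ (Function.update_self ..), Function.update_idem]
  exact key _ v rfl

/-- The register `x` is emptied into `y` and `t` simultaneously and then restored from `t`. Thus
inputs are written to, although their values survive. -/
theorem eval_copy {x y t : ℕ} (hxy : x ≠ y) (hxt : x ≠ t) (hyt : y ≠ t) (v : ℕ → ℕ) :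
    (copy x y t).eval v = Function.update (Function.update v y (v x)) t 0 := by
  have h₁ : ∀ (n : ℕ) (v : ℕ → ℕ), v x = n →
      loopEval x (seq (add y 1) (add t 1)).eval n v =
        Function.update (Function.update (Function.update v x 0) y (v y + n)) t (v t + n) := by
    intro n
    induction n with
    | zero =>
      intro v hv
      funext z
      simp only [loopEval, Function.update_apply]
      split_ifs <;> simp_all
    | succ n ih =>
      intro v hv
      rw [loopEval, ih _ (by simp [eval, Function.update_apply, hxy, hxt])]
      funext z
      simp only [eval, Function.update_apply]
      split_ifs <;> simp_all <;> omega
  have h₂ : ∀ (n : ℕ) (v : ℕ → ℕ), v t = n →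
      loopEval t (add x 1).eval n v =
        Function.update (Function.update v t 0) x (v x + n) := by
    intro n
    induction n with
    | zero =>
      intro v hv
      funext z
      simp only [loopEval, Function.update_apply]
      split_ifs <;> simp_all
    | succ n ih =>
      intro v hv
      rw [loopEval, ih _ (by simp [eval, Function.update_apply, hxt.symm])]
      funext z
      simp only [eval, Function.update_apply]
      split_ifs <;> simp_all
      omega
  change loopEval t (add x 1).eval (loopEval x (seq (add y 1) (add t 1)).eval
    ((clear t).eval ((clear y).eval v) x) ((clear t).eval ((clear y).eval v)) t)
    (loopEval x (seq (add y 1) (add t 1)).eval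
    ((clear t).eval ((clear y).eval v) x) ((clear t).eval ((clear y).eval v))) = _
  rw [eval_clear, eval_clear, h₁ _ _ rfl, h₂ _ _ rfl]
  funext z
  simp only [Function.update_apply]
  split_ifs <;> simp_all

theorem wf_copy {x y t : ℕ} (hxy : x ≠ y) (hxt : x ≠ t) : (copy x y t).WF :=
  ⟨⟨id, trivial⟩, ⟨id, trivial⟩, ⟨by simp [Writes, hxy, hxt], trivial, trivial⟩,
    by simp [Writes, hxt.symm], trivial⟩

theorem writes_copy {x y t z : ℕ} (h : (copy x y t).Writes z) : z = x ∨ z = y ∨ z = t := by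
  simp only [copy, clear, Writes] at h
  tauto

end Cmd

open Cmd

/-- The function `f` can be computed by a loop program, for all choices of the input registers,
the output register and the first auxiliary register. -/
def Computes {n : ℕ} (f : List.Vector ℕ n → ℕ) : Prop :=
  ∀ (ins : Fin n → ℕ) (out b : ℕ), (∀ i, ins i < b) → out < b → (∀ i, ins i ≠ out) →
    ∃ c : Cmd, c.WF ∧ (∀ r, c.Writes r → r = out ∨ b ≤ r ∨ ∃ i, r = ins i) ∧
      ∀ v, c.eval v out = f (List.Vector.ofFn fun i => v (ins i)) ∧
        ∀ r < b, r ≠ out → c.eval v r = v r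

/-- The intermediate value of `g i` is kept in the register `b + i`, and all auxiliary registers lie
from `b + n` on, so no value is overwritten. -/
theorem computes_comp {m n : ℕ} {f : List.Vector ℕ n → ℕ} (g : Fin n → List.Vector ℕ m → ℕ)
    (hf : Computes f) (hg : ∀ i, Computes (g i)) :
    Computes fun a => f (List.Vector.ofFn fun i => g i a) := by
  intro ins out b hins hout hne
  have key : ∀ k ≤ n, ∃ c : Cmd, c.WF ∧
      (∀ r, c.Writes r → b ≤ r ∨ ∃ i, r = ins i) ∧
      ∀ v, (∀ i : Fin n, (i : ℕ) < k →
        c.eval v (b + i) = g i (List.Vector.ofFn fun i => v (ins i))) ∧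
        ∀ r < b, c.eval v r = v r := by
    intro k
    induction k with
    | zero =>
      exact fun _ => ⟨.skip, trivial, fun r h => h.elim, fun v =>
        ⟨fun i hi => absurd hi (Nat.not_lt_zero _), fun r _ => rfl⟩⟩
    | succ k ih =>
      intro hk
      obtain ⟨c, hc, hw, hv⟩ := ih (by omega)
      obtain ⟨c', hc', hw', hv'⟩ := hg ⟨k, hk⟩ ins (b + k) (b + n)
        (fun i => (hins i).trans_le (Nat.le_add_right _ _)) (by omega)
        (fun i => by have := hins i; omega)
      refine ⟨.seq c c', ⟨hc, hc'⟩, fun r hr => ?_, fun v => ⟨fun i hi => ?_, fun r hr => ?_⟩⟩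
      · rcases hr with hr | hr
        · exact hw r hr
        · rcases hw' r hr with h | h | h
          · exact .inl (by omega)
          · exact .inl (by omega)
          · exact .inr h
      · rcases Nat.lt_succ_iff_lt_or_eq.1 hi with hi | hi
        · rw [eval, (hv' _).2 _ (by omega) (by omega)]
          exact (hv v).1 i hi
        · obtain rfl : i = ⟨k, hk⟩ := Fin.ext hi
          rw [eval, (hv' _).1]
          congr 2
          funext i
          exact (hv v).2 _ (hins i)
      · rw [eval, (hv' _).2 _ (by omega) (by omega)]
        exact (hv v).2 r hr
  obtain ⟨c, hc, hw, hv⟩ := key n le_rfl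
  obtain ⟨c', hc', hw', hv'⟩ := hf (fun i => b + i) out (b + n) (fun i => by omega) (by omega)
    (fun i => by omega)
  refine ⟨.seq c c', ⟨hc, hc'⟩, fun r hr => ?_, fun v => ⟨?_, fun r hr hro => ?_⟩⟩
  · rcases hr with hr | hr
    · exact .inr (hw r hr)
    · rcases hw' r hr with h | h | ⟨i, h⟩
      · exact .inl h
      · exact .inr (.inl (by omega))
      · exact .inr (.inl (by omega))
  · rw [eval, (hv' _).1]
    congr 2
    funext i
    exact (hv v).1 i i.2
  · rw [eval, (hv' _).2 r (by omega) hro]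
    exact (hv v).2 r hr

/-- The registers `b` to `b + 4` hold the remaining rounds, the current argument of the recursion,
the value reached, the newly computed value and the auxiliary cell for copying. The programs for `f`
and `g` work from `b + 5` on. The recursion argument is copied because the loop destroys its
counter. -/
theorem computes_prec {n : ℕ} {f : List.Vector ℕ n → ℕ} {g : List.Vector ℕ (n + 2) → ℕ}
    (hf : Computes f) (hg : Computes g) :
    Computes fun v : List.Vector ℕ (n + 1) =>
      v.head.rec (f v.tail) fun y IH => g (y ::ᵥ IH ::ᵥ v.tail) := by
  intro ins out b hins hout hne
  have hins' : ∀ i : Fin n, ins i.succ < b := fun i => hins _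
  have h0 := hins 0
  obtain ⟨cf, hcf, hwf, hvf⟩ := hf (fun i => ins i.succ) (b + 2) (b + 5)
    (fun i => (hins' i).trans_le (by omega)) (by omega) (fun i => by have := hins' i; omega)
  let gin : Fin (n + 2) → ℕ := Fin.cons (b + 1) (Fin.cons (b + 2) fun i => ins i.succ)
  have hgin : ∀ P : ℕ → Prop, P (b + 1) → P (b + 2) → (∀ i : Fin n, P (ins i.succ)) →
      ∀ i, P (gin i) := fun P h1 h2 h3 i => Fin.cases h1 (fun i => Fin.cases h2 h3 i) i
  obtain ⟨cg, hcg, hwg, hvg⟩ := hg gin (b + 3) (b + 5)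
    (hgin (· < b + 5) (by omega) (by omega) fun i => by have := hins' i; omega) (by omega)
    (hgin (· ≠ b + 3) (by omega) (by omega) fun i => by have := hins' i; omega)
  have hwg' : ∀ r, cg.Writes r → r = b + 1 ∨ r = b + 2 ∨ r = b + 3 ∨ b + 5 ≤ r ∨
      ∃ i : Fin n, r = ins i.succ := by
    intro r hr
    rcases hwg r hr with h | h | ⟨i, h⟩
    · exact .inr (.inr (.inl h))
    · exact .inr (.inr (.inr (.inl h)))
    · rw [h]
      exact hgin (fun r => r = b + 1 ∨ r = b + 2 ∨ r = b + 3 ∨ b + 5 ≤ r ∨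
        ∃ i : Fin n, r = ins i.succ) (.inl rfl) (.inr (.inl rfl))
        (fun i => .inr (.inr (.inr (.inr ⟨i, rfl⟩)))) i
  let body : Cmd := .seq cg (.seq (copy (b + 3) (b + 2) (b + 4)) (.add (b + 1) 1))
  let c : Cmd := .seq (copy (ins 0) b (b + 4)) <| .seq (clear (b + 1)) <| .seq cf <|
    .seq (.loop b body) (copy (b + 2) out (b + 4))
  have hbody : ¬ body.Writes b := by
    rintro (h | h | h)
    · rcases hwg' b h with h | h | h | h | ⟨i, h⟩
      · omega
      · omega
      · omega
      · omega
      · have := hins' i; omega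
    · have := writes_copy h
      omega
    · change b = b + 1 at h
      omega
  have hvb : ∀ v, body.eval v (b + 1) = v (b + 1) + 1 ∧
      body.eval v (b + 2) =
        g (v (b + 1) ::ᵥ v (b + 2) ::ᵥ List.Vector.ofFn fun i : Fin n => v (ins i.succ)) ∧
      ∀ r < b + 1, body.eval v r = v r := by
    intro v
    have e : body.eval v = (Cmd.add (b + 1) 1).eval
        ((copy (b + 3) (b + 2) (b + 4)).eval (cg.eval v)) := rfl
    rw [e, eval_copy (by omega) (by omega) (by omega), (hvg v).1]
    refine ⟨?_, ?_, fun r hr => ?_⟩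
    · simp [eval, (hvg v).2 (b + 1) (by omega) (by omega)]
    · simp only [eval, Function.update_apply]
      rw [if_neg (by omega), if_neg (by omega), if_pos trivial, List.Vector.ofFn,
        List.Vector.ofFn]
      rfl
    · simp only [eval, Function.update_apply]
      rw [if_neg (by omega), if_neg (by omega), if_neg (by omega)]
      exact (hvg v).2 r (by omega) (by omega)
  -- Loop invariant: with `m` in `b + 1`, the register `b + 2` holds the value of the recursion at
  -- `m`, and all registers below `b` agree with the original contents `a`.
  have hloop : ∀ (a : ℕ → ℕ) (k : ℕ) (v : ℕ → ℕ) (m : ℕ), v (b + 1) = m →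
      v (b + 2) = Nat.rec (f (List.Vector.ofFn fun i : Fin n => a (ins i.succ)))
        (fun y IH => g (y ::ᵥ IH ::ᵥ List.Vector.ofFn fun i : Fin n => a (ins i.succ))) m →
      (∀ r < b, v r = a r) →
      loopEval b body.eval k v (b + 2) =
        Nat.rec (f (List.Vector.ofFn fun i : Fin n => a (ins i.succ)))
        (fun y IH => g (y ::ᵥ IH ::ᵥ List.Vector.ofFn fun i : Fin n => a (ins i.succ))) (m + k) ∧
      ∀ r < b, loopEval b body.eval k v r = a r := by
    intro a k
    induction k with
    | zero => intro v m _ h2 h3; exact ⟨h2, h3⟩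
    | succ k ih =>
      intro v m h1 h2 h3
      have hu : ∀ r, r ≠ b → Function.update v b k r = v r := fun r hr =>
        Function.update_of_ne hr _ _
      obtain ⟨hb1, hb2, hb3⟩ := hvb (Function.update v b k)
      rw [hu _ (by omega)] at hb1 hb2
      rw [hu _ (by omega), h1, h2] at hb2
      have hvec : (fun i : Fin n => Function.update v b k (ins i.succ)) =
          fun i : Fin n => a (ins i.succ) := by
        funext i
        have := hins' i
        rw [hu _ (by omega), h3 _ this]
      rw [hvec] at hb2
      have := ih (body.eval (Function.update v b k)) (m + 1) (by rw [hb1, h1]) hb2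
        (fun r hr => by rw [hb3 r (by omega), hu _ (by omega), h3 r hr])
      rwa [Nat.add_assoc, Nat.add_comm 1 k] at this
  refine ⟨c, ⟨wf_copy (by omega) (by omega), ⟨id, trivial⟩, hcf,
    ⟨hbody, hcg, wf_copy (by omega) (by omega), trivial⟩, wf_copy (by omega) (by omega)⟩, ?_, ?_⟩
  · rintro r (h | (h | h) | h | (h | h | h | h) | h)
    · rcases writes_copy h with h | h | h
      · exact .inr (.inr ⟨0, h⟩)
      · exact .inr (.inl (by omega))
      · exact .inr (.inl (by omega))
    · exact .inr (.inl (by omega))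
    · exact h.elim
    · rcases hwf r h with h | h | ⟨i, h⟩
      · exact .inr (.inl (by omega))
      · exact .inr (.inl (by omega))
      · exact .inr (.inr ⟨_, h⟩)
    · exact .inr (.inl (by omega))
    · rcases hwg' r h with h | h | h | h | ⟨i, h⟩
      · exact .inr (.inl (by omega))
      · exact .inr (.inl (by omega))
      · exact .inr (.inl (by omega))
      · exact .inr (.inl (by omega))
      · exact .inr (.inr ⟨_, h⟩)
    · have := writes_copy h
      exact .inr (.inl (by omega))
    · change r = b + 1 at h
      exact .inr (.inl (by omega))
    · rcases writes_copy h with h | h | h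
      · exact .inr (.inl (by omega))
      · exact .inl h
      · exact .inr (.inl (by omega))
  · intro v
    let v1 := (clear (b + 1)).eval ((copy (ins 0) b (b + 4)).eval v)
    have e : c.eval v = (copy (b + 2) out (b + 4)).eval
        (loopEval b body.eval ((cf.eval v1) b) (cf.eval v1)) := rfl
    have hv1 : v1 = Function.update (Function.update (Function.update v b (v (ins 0)))
        (b + 4) 0) (b + 1) 0 := by
      change (clear (b + 1)).eval ((copy (ins 0) b (b + 4)).eval v) = _
      rw [eval_copy (by omega) (by omega) (by omega), eval_clear]
    have hlt : ∀ r < b, v1 r = v r := by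
      intro r hr
      rw [hv1, Function.update_of_ne (by omega), Function.update_of_ne (by omega),
        Function.update_of_ne (by omega)]
    have hv1b : v1 b = v (ins 0) := by
      rw [hv1, Function.update_of_ne (by omega), Function.update_of_ne (by omega),
        Function.update_self]
    have hv1y : v1 (b + 1) = 0 := by rw [hv1, Function.update_self]
    obtain ⟨hf1, hf2⟩ := hvf v1
    have hvec : (fun i : Fin n => v1 (ins i.succ)) = fun i : Fin n => v (ins i.succ) :=
      funext fun i => hlt _ (hins' i)
    rw [hvec] at hf1
    have hl := hloop v (v (ins 0)) (cf.eval v1) 0 (by rw [hf2 _ (by omega) (by omega), hv1y]) hf1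
      (fun r hr => by rw [hf2 _ (by omega) (by omega), hlt r hr])
    rw [Nat.zero_add] at hl
    rw [e, hf2 b (by omega) (by omega), hv1b, eval_copy (by omega) (by omega) (by omega)]
    refine ⟨?_, fun r hr hro => ?_⟩
    · rw [Function.update_of_ne (by omega), Function.update_self, hl.1]
      rfl
    · rw [Function.update_of_ne (by omega), Function.update_of_ne hro, hl.2 r hr]

/-- All primitive recursive functions can be computed by loop programs. -/
theorem computes_of_primrec {n : ℕ} {f : List.Vector ℕ n → ℕ} (hf : Nat.Primrec' f) :
    Computes f := by
  induction hf with
  | zero =>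
    intro ins out b _ _ _
    refine ⟨clear out, ⟨id, trivial⟩, fun r hr => .inl (hr.elim id False.elim), fun v => ?_⟩
    rw [eval_clear]
    exact ⟨Function.update_self .., fun r _ hr => Function.update_of_ne hr _ _⟩
  | succ =>
    intro ins out b hins hout hne
    have h0 := hins 0
    refine ⟨.seq (copy (ins 0) out b) (.add out 1), ⟨wf_copy (hne 0) (by omega), trivial⟩, ?_,
      fun v => ?_⟩
    · rintro r (h | h)
      · rcases writes_copy h with h | h | h
        · exact .inr (.inr ⟨0, h⟩)
        · exact .inl h
        · exact .inr (.inl h.ge)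
      · exact .inl h
    · rw [eval, eval_copy (hne 0) (by omega) (by omega)]
      refine ⟨?_, fun r hr hro => ?_⟩
      · rw [eval, Function.update_self, Function.update_of_ne (by omega), Function.update_self]
        rfl
      · rw [eval, Function.update_of_ne hro, Function.update_of_ne (by omega),
          Function.update_of_ne hro]
  | get i =>
    intro ins out b hins hout hne
    have h0 := hins i
    refine ⟨copy (ins i) out b, wf_copy (hne i) (by omega), ?_, fun v => ?_⟩
    · intro r h
      rcases writes_copy h with h | h | h
      · exact .inr (.inr ⟨i, h⟩)
      · exact .inl h
      · exact .inr (.inl h.ge)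
    · rw [eval_copy (hne i) (by omega) (by omega)]
      refine ⟨?_, fun r hr hro => ?_⟩
      · rw [Function.update_of_ne (by omega), Function.update_self]
        exact (List.Vector.get_ofFn (fun i => v (ins i)) i).symm
      · rw [Function.update_of_ne (by omega), Function.update_of_ne hro]
  | comp g _ _ ihf ihg => exact computes_comp g ihf ihg
  | prec _ _ ihf ihg => exact computes_prec ihf ihg

end CounterMachine

/-! ### Simulation of counter machines by Fractran programs -/

namespace CounterMachine

/-- The prime whose exponent is the contents of the register `r`. -/
noncomputable def reg (r : ℕ) : ℕ := Nat.nth Nat.Prime (2 * r)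

/-- The prime that represents the program counter `i`. -/
noncomputable def st (i : ℕ) : ℕ := Nat.nth Nat.Prime (2 * i + 1)

theorem prime_reg (r : ℕ) : (reg r).Prime := Nat.prime_nth_prime _

theorem prime_st (i : ℕ) : (st i).Prime := Nat.prime_nth_prime _

theorem reg_injective : Function.Injective reg := fun r s h => by
  have := Nat.nth_injective Nat.infinite_setOfPred_prime h
  omega

theorem st_injective : Function.Injective st := fun r s h => by
  have := Nat.nth_injective Nat.infinite_setOfPred_prime h
  omega

theorem st_ne_reg (i r : ℕ) : st i ≠ reg r := fun h => by
  have := Nat.nth_injective Nat.infinite_setOfPred_prime h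
  omega

theorem st_dvd_st {i j : ℕ} : st i ∣ st j ↔ i = j :=
  (Nat.prime_dvd_prime_iff_eq (prime_st i) (prime_st j)).trans st_injective.eq_iff

theorem not_st_dvd_reg_pow (i r k : ℕ) : ¬ st i ∣ reg r ^ k := fun h =>
  st_ne_reg i r ((Nat.prime_dvd_prime_iff_eq (prime_st i) (prime_reg r)).1
    ((prime_st i).dvd_of_dvd_pow h))

theorem not_reg_dvd_st (i r : ℕ) : ¬ reg r ∣ st i := fun h =>
  st_ne_reg i r ((Nat.prime_dvd_prime_iff_eq (prime_reg r) (prime_st i)).1 h).symm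

/-- The Fractran program with the given numerators and denominators. -/
def ofPairs (F : List (ℕ × ℕ)) : FractranProgram := F.map fun x => (x.1.toPNat', x.2.toPNat')

/-- The step function of a list of fractions. -/
def fracStep : List (ℕ × ℕ) → ℕ → Option ℕ
  | [], _ => none
  | x :: F, n => if x.2 ∣ n * x.1 then some (n * x.1 / x.2) else fracStep F n

theorem step_ofPairs {F : List (ℕ × ℕ)} (hF : ∀ x ∈ F, 0 < x.1 ∧ 0 < x.2) (n : ℕ) :
    (ofPairs F).step n = fracStep F n := by
  induction F with
  | nil => rfl
  | cons x F ih =>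
    have hx := hF x List.mem_cons_self
    have ih' := ih fun y hy => hF y (List.mem_cons_of_mem _ hy)
    have h1 : ((x.1.toPNat' : ℕ+) : ℕ) = x.1 := by simp [hx.1]
    have h2 : ((x.2.toPNat' : ℕ+) : ℕ) = x.2 := by simp [hx.2]
    rw [fracStep, ← ih']
    simp only [FractranProgram.step, FractranProgram.firstFraction, ofPairs, List.map_cons,
      List.find?_cons, h1, h2]
    by_cases h : x.2 ∣ n * x.1
    · simp [h, h1, h2]
    · simp [h]

theorem fracStep_append {F : List (ℕ × ℕ)} {n : ℕ} (h : ∀ x ∈ F, ¬ x.2 ∣ n * x.1)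
    (G : List (ℕ × ℕ)) : fracStep (F ++ G) n = fracStep G n := by
  induction F with
  | nil => rfl
  | cons x F ih =>
    rw [List.cons_append, fracStep, if_neg (h x List.mem_cons_self),
      ih fun y hy => h y (List.mem_cons_of_mem _ hy)]

theorem fracStep_eq_none {F : List (ℕ × ℕ)} {n : ℕ} (h : ∀ x ∈ F, ¬ x.2 ∣ n * x.1) :
    fracStep F n = none := by
  rw [← List.append_nil F, fracStep_append h]
  rfl

/-- The fractions that remove two program counters. -/
noncomputable def kills (n : ℕ) : List (ℕ × ℕ) :=
  (List.range n).flatMap fun i => (List.range n).map fun j => (1, st i * st j)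

theorem mem_kills {n : ℕ} {x : ℕ × ℕ} :
    x ∈ kills n ↔ ∃ i < n, ∃ j < n, x = (1, st i * st j) := by
  simp only [kills, List.mem_flatMap, List.mem_map, List.mem_range, eq_comm]

/-- The fractions of a list of instructions at the address `b`. -/
noncomputable def instrFractions : ℕ → List Instr → List (ℕ × ℕ)
  | _, [] => []
  | b, .add r k t :: l => (st t * reg r ^ k, st b) :: instrFractions (b + 1) l
  | b, .dec r t₁ t₂ :: l =>
    (st t₁, st b * reg r) :: (st t₂, st b) :: instrFractions (b + 1) l

/-- The fractions that simulate a counter machine. -/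
noncomputable def fractions (prog : List Instr) : List (ℕ × ℕ) :=
  kills prog.length ++ instrFractions 0 prog

theorem mem_instrFractions {b : ℕ} {l : List Instr} (hl : NoSelfJump b l) {x : ℕ × ℕ}
    (hx : x ∈ instrFractions b l) :
    0 < x.1 ∧ 0 < x.2 ∧ ∃ j, b ≤ j ∧ j < b + l.length ∧ st j ∣ x.2 ∧ ¬ st j ∣ x.1 := by
  induction l generalizing b with
  | nil => cases hx
  | cons i l ih =>
    rw [List.length_cons]
    cases i with
    | add r k t =>
      rcases List.mem_cons.1 hx with rfl | hx
      · refine ⟨Nat.mul_pos (prime_st t).pos (pow_pos (prime_reg r).pos k), (prime_st b).pos, b,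
          le_rfl, by omega, dvd_rfl, fun h => ?_⟩
        rcases (prime_st b).dvd_mul.1 h with h | h
        · exact hl.1 (st_dvd_st.1 h).symm
        · exact not_st_dvd_reg_pow _ _ _ h
      · obtain ⟨h1, h2, j, h3, h4, h5⟩ := ih hl.2 hx
        exact ⟨h1, h2, j, by omega, by omega, h5⟩
    | dec r t₁ t₂ =>
      rcases List.mem_cons.1 hx with rfl | hx
      · exact ⟨(prime_st t₁).pos, Nat.mul_pos (prime_st b).pos (prime_reg r).pos, b,
          le_rfl, by omega, dvd_mul_right _ _, fun h => hl.1.1 (st_dvd_st.1 h).symm⟩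
      rcases List.mem_cons.1 hx with rfl | hx
      · exact ⟨(prime_st t₂).pos, (prime_st b).pos, b,
          le_rfl, by omega, dvd_rfl, fun h => hl.1.2 (st_dvd_st.1 h).symm⟩
      · obtain ⟨h1, h2, j, h3, h4, h5⟩ := ih hl.2 hx
        exact ⟨h1, h2, j, by omega, by omega, h5⟩

theorem fractions_pos {prog : List Instr} (hp : NoSelfJump 0 prog) :
    ∀ x ∈ fractions prog, 0 < x.1 ∧ 0 < x.2 := by
  intro x hx
  rcases List.mem_append.1 hx with hx | hx
  · obtain ⟨i, _, j, _, rfl⟩ := mem_kills.1 hx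
    exact ⟨Nat.one_pos, Nat.mul_pos (prime_st i).pos (prime_st j).pos⟩
  · exact ⟨(mem_instrFractions hp hx).1, (mem_instrFractions hp hx).2.1⟩

/-- No program counter below `n` divides `w`. -/
def NoState (n w : ℕ) : Prop := ∀ i < n, ¬ st i ∣ w

theorem fracStep_fractions_of_noState {prog : List Instr} (hp : NoSelfJump 0 prog) {m : ℕ}
    (hm : NoState prog.length m) : fracStep (fractions prog) m = none := by
  refine fracStep_eq_none fun x hx h => ?_
  rcases List.mem_append.1 hx with hx | hx
  · obtain ⟨i, hi, j, _, rfl⟩ := mem_kills.1 hx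
    rw [mul_one] at h
    exact hm i hi ((dvd_mul_right _ _).trans h)
  · obtain ⟨_, _, j, _, hj, h2, h1⟩ := mem_instrFractions hp hx
    rcases (prime_st j).dvd_mul.1 (h2.trans h) with h | h
    · exact hm j (by omega) h
    · exact h1 h

/-- These fractions have numerator `1` and a denominator above `1`, so they make the integer
smaller. The case `i = j` covers a repeated state prime. -/
theorem fracStep_kills {n m : ℕ} (hm : 0 < m) (h : ∃ i < n, ∃ j < n, st i * st j ∣ m)
    (G : List (ℕ × ℕ)) : ∃ m', fracStep (kills n ++ G) m = some m' ∧ 0 < m' ∧ m' < m := by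
  have key : ∀ F : List (ℕ × ℕ), (∀ x ∈ F, x.1 = 1 ∧ 1 < x.2) → (∃ x ∈ F, x.2 ∣ m) →
      ∃ m', fracStep (F ++ G) m = some m' ∧ 0 < m' ∧ m' < m := by
    intro F hF hx
    induction F with
    | nil => obtain ⟨x, hx, _⟩ := hx; cases hx
    | cons y F ih =>
      obtain ⟨hy1, hy2⟩ := hF y List.mem_cons_self
      rw [List.cons_append, fracStep, hy1, mul_one]
      by_cases hy : y.2 ∣ m
      · rw [if_pos hy]
        exact ⟨_, rfl, Nat.div_pos (Nat.le_of_dvd hm hy) (by omega), Nat.div_lt_self hm hy2⟩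
      · rw [if_neg hy]
        refine ih (fun x hx => hF x (List.mem_cons_of_mem _ hx)) ?_
        obtain ⟨x, hx, hxm⟩ := hx
        rcases List.mem_cons.1 hx with rfl | hx
        · exact absurd hxm hy
        · exact ⟨x, hx, hxm⟩
  refine key _ (fun x hx => ?_) ?_
  · obtain ⟨i, _, j, _, rfl⟩ := mem_kills.1 hx
    exact ⟨rfl, Nat.one_lt_mul_iff.2 ⟨(prime_st i).pos, (prime_st j).pos, .inl (prime_st i).one_lt⟩⟩
  · obtain ⟨i, hi, j, hj, hd⟩ := h
    exact ⟨_, mem_kills.2 ⟨i, hi, j, hj, rfl⟩, hd⟩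

/-- Fractions of addresses before `i` require a state prime that neither the integer nor the
numerator provides. For a decrement at `i` itself, the first fraction applies exactly if the
register is not empty; otherwise the second one takes over. -/
theorem fracStep_instrFractions {b : ℕ} {l : List Instr} (hl : NoSelfJump b l) {i w : ℕ}
    (hi : b ≤ i) (hw : ∀ j, b ≤ j → j < b + l.length → ¬ st j ∣ w) :
    fracStep (instrFractions b l) (st i * w) =
      match l[i - b]? with
      | none => none
      | some (.add r k t) => some (st t * (w * reg r ^ k))
      | some (.dec r t₁ t₂) =>
        if reg r ∣ w then some (st t₁ * (w / reg r)) else some (st t₂ * w) := by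
  induction l generalizing b with
  | nil => rfl
  | cons a l ih =>
    rw [List.length_cons] at hw
    rcases Nat.eq_or_lt_of_le hi with rfl | hlt
    · rw [Nat.sub_self, List.getElem?_cons_zero]
      cases a with
      | add r k t =>
        simp only [instrFractions, fracStep]
        rw [Nat.mul_assoc, if_pos (dvd_mul_right _ _), Nat.mul_div_cancel_left _ (prime_st b).pos,
          Nat.mul_left_comm]
      | dec r t₁ t₂ =>
        simp only [instrFractions, fracStep]
        have h1 : st b * w * st t₁ = st b * (st t₁ * w) := by ring
        have h2 : st b * w * st t₂ = st b * (st t₂ * w) := by ring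
        rw [h1, h2, Nat.mul_div_mul_left _ _ (prime_st b).pos, if_pos (dvd_mul_right _ _),
          Nat.mul_div_cancel_left _ (prime_st b).pos]
        by_cases h : reg r ∣ w
        · rw [if_pos (Nat.mul_dvd_mul_left _ (h.mul_left _)), if_pos h, Nat.mul_div_assoc _ h]
        · rw [if_neg h, if_neg fun h' => ((prime_reg r).dvd_mul.1
            (Nat.dvd_of_mul_dvd_mul_left (prime_st b).pos h')).elim (not_reg_dvd_st _ _) h]
    · have hskip : ∀ p, ¬ st b ∣ p → ¬ st b ∣ st i * w * p := by
        intro p hp h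
        rcases (prime_st b).dvd_mul.1 h with h | h
        · rcases (prime_st b).dvd_mul.1 h with h | h
          · exact hlt.ne (st_dvd_st.1 h)
          · exact hw b le_rfl (by omega) h
        · exact hp h
      rw [show i - b = i - (b + 1) + 1 by omega, List.getElem?_cons_succ,
        ← ih (b := b + 1) (by cases a <;> exact hl.2) hlt fun j h1 h2 => hw j (by omega) (by omega)]
      cases a with
      | add r k t =>
        rw [instrFractions, fracStep, if_neg]
        refine hskip _ fun h => ?_
        rcases (prime_st b).dvd_mul.1 h with h | h
        · exact hl.1 (st_dvd_st.1 h).symm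
        · exact not_st_dvd_reg_pow _ _ _ h
      | dec r t₁ t₂ =>
        rw [instrFractions, fracStep, if_neg, fracStep, if_neg]
        · exact hskip _ fun h => hl.1.2 (st_dvd_st.1 h).symm
        · exact fun h => hskip _ (fun h => hl.1.1 (st_dvd_st.1 h).symm) ((dvd_mul_right _ _).trans h)

/-- The register contents that are represented by `w`. -/
noncomputable def contents (w r : ℕ) : ℕ := w.factorization (reg r)

theorem contents_mul_pow {w : ℕ} (hw : 0 < w) (r k : ℕ) :
    contents (w * reg r ^ k) = Function.update (contents w) r (contents w r + k) := by
  funext s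
  have h := Nat.factorization_mul hw.ne' (pow_pos (prime_reg r).pos k).ne'
  rw [contents, h, (prime_reg r).factorization_pow, Finsupp.add_apply, Finsupp.single_apply,
    Function.update_apply]
  rcases eq_or_ne s r with rfl | hs
  · simp [contents]
  · rw [if_neg fun h => hs (reg_injective h).symm, if_neg hs, Nat.add_zero]
    rfl

theorem reg_dvd_iff {w : ℕ} (hw : 0 < w) (r : ℕ) : reg r ∣ w ↔ contents w r ≠ 0 := by
  rw [contents, ← Nat.pos_iff_ne_zero]
  exact (prime_reg r).dvd_iff_one_le_factorization hw.ne'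

theorem contents_div {w r : ℕ} (hw : 0 < w) (h : reg r ∣ w) :
    contents (w / reg r) = Function.update (contents w) r (contents w r - 1) := by
  obtain ⟨u, rfl⟩ := h
  have hu : 0 < u := Nat.pos_of_mul_pos_left hw
  have e := contents_mul_pow hu r 1
  rw [pow_one, Nat.mul_comm] at e
  rw [Nat.mul_div_cancel_left _ (prime_reg r).pos, e, Function.update_self,
    Function.update_idem, Nat.add_sub_cancel, Function.update_eq_self]

/-- A step of the fractions corresponds to a step of the machine. -/
theorem fracStep_fractions {prog : List Instr} (hp : NoSelfJump 0 prog) (i : ℕ) {w : ℕ}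
    (hw0 : 0 < w) (hw : NoState prog.length w) :
    (step prog (i, contents w) = none ∧ fracStep (fractions prog) (st i * w) = none) ∨
    ∃ j u, step prog (i, contents w) = some (j, contents u) ∧ 0 < u ∧ NoState prog.length u ∧
      fracStep (fractions prog) (st i * w) = some (st j * u) := by
  -- Two program counters cannot divide `st i * w`, because `w` contributes none.
  have hk : ∀ x ∈ kills prog.length, ¬ x.2 ∣ st i * w * x.1 := by
    intro x hx h
    obtain ⟨a, ha, b, hb, rfl⟩ := mem_kills.1 hx
    rw [mul_one] at h
    rcases eq_or_ne a i with rfl | hai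
    · exact hw b hb (Nat.dvd_of_mul_dvd_mul_left (prime_st a).pos h)
    · rcases (prime_st a).dvd_mul.1 ((dvd_mul_right _ _).trans h) with h | h
      · exact hai (st_dvd_st.1 h)
      · exact hw a ha h
  rw [fractions, fracStep_append hk,
    fracStep_instrFractions hp (Nat.zero_le i) fun j _ hj => hw j (by omega), Nat.sub_zero, step]
  dsimp only
  cases h : prog[i]? with
  | none => exact .inl ⟨rfl, rfl⟩
  | some a =>
    right
    cases a with
    | add r k t =>
      refine ⟨t, w * reg r ^ k, ?_, Nat.mul_pos hw0 (pow_pos (prime_reg r).pos k), ?_, rfl⟩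
      · simp only [contents_mul_pow hw0]
      · intro j hj h
        rcases (prime_st j).dvd_mul.1 h with h | h
        · exact hw j hj h
        · exact not_st_dvd_reg_pow _ _ _ h
    | dec r t₁ t₂ =>
      by_cases hr : reg r ∣ w
      · refine ⟨t₁, w / reg r, ?_, Nat.div_pos (Nat.le_of_dvd hw0 hr) (prime_reg r).pos, ?_, ?_⟩
        · simp only [if_neg ((reg_dvd_iff hw0 r).1 hr), contents_div hw0 hr]
        · exact fun j hj h => hw j hj (h.trans (Nat.div_dvd_of_dvd hr))
        · simp only [if_pos hr]
      · refine ⟨t₂, w, ?_, hw0, hw, ?_⟩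
        · simp only [if_pos (not_not.1 (mt (reg_dvd_iff hw0 r).2 hr))]
        · simp only [if_neg hr]

/-- The machine halts from the given configuration. -/
def HaltsFrom (prog : List Instr) (c : ℕ × (ℕ → ℕ)) : Prop :=
  ∃ c', Reaches prog c c' ∧ step prog c' = none

/-- The Fractran program that simulates a counter machine. -/
noncomputable def toFractran (prog : List Instr) : FractranProgram := ofPairs (fractions prog)

/-- The cofactor `w` may contain state primes beyond the end of the program. They occur in no
denominator and do not affect the simulation, so only `contents w` has to match. -/
theorem halts_state_of_haltsFrom {prog : List Instr} (hp : NoSelfJump 0 prog) {c : ℕ × (ℕ → ℕ)}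
    (hc : HaltsFrom prog c) {w : ℕ} (hw0 : 0 < w) (hw : NoState prog.length w)
    (he : contents w = c.2) : (toFractran prog).Halts (st c.1 * w) := by
  obtain ⟨c', hr, hn⟩ := hc
  induction hr using Relation.ReflTransGen.head_induction_on generalizing w with
  | refl =>
    rcases fracStep_fractions hp c'.1 hw0 hw with ⟨_, h⟩ | ⟨j, u, h, _⟩
    · exact FractranProgram.halts_of_step (by rw [toFractran, step_ofPairs (fractions_pos hp), h])
    · rw [he, hn] at h
      cases h
  | head hab _ ih =>
    rename_i a b _
    rcases fracStep_fractions hp a.1 hw0 hw with ⟨h, _⟩ | ⟨j, u, h, hu0, hu, hs⟩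
    · rw [he, hab] at h
      cases h
    · rw [he, hab] at h
      obtain rfl := Option.some.inj h
      rw [FractranProgram.halts_iff_of_step
        (show (toFractran prog).step (st a.1 * w) = some (st j * u) by
          rw [toFractran, step_ofPairs (fractions_pos hp), hs])]
      exact ih hu0 hu rfl

/-- If the machine halts from all configurations, then the Fractran program halts on all positive
integers. -/
theorem halts_of_haltsFrom {prog : List Instr} (hp : NoSelfJump 0 prog)
    (h : ∀ c, HaltsFrom prog c) (m : ℕ) (hm : 0 < m) : (toFractran prog).Halts m := by
  induction m using Nat.strong_induction_on with
  | _ m ih =>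
    -- An integer with two program counters is reduced to a smaller one, an integer with exactly one
    -- is a configuration of the machine, and without any the program stops at once.
    by_cases hk : ∃ i < prog.length, ∃ j < prog.length, st i * st j ∣ m
    · obtain ⟨m', hs, h0, hlt⟩ := fracStep_kills hm hk (instrFractions 0 prog)
      rw [FractranProgram.halts_iff_of_step
        (show (toFractran prog).step m = some m' by
          rw [toFractran, step_ofPairs (fractions_pos hp)]; exact hs)]
      exact ih m' hlt h0
    · by_cases h1 : ∃ i < prog.length, st i ∣ m
      · obtain ⟨i, hi, w, rfl⟩ := h1
        exact halts_state_of_haltsFrom hp (h (i, contents w)) (Nat.pos_of_mul_pos_left hm)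
          (fun j hj hd => hk ⟨i, hi, j, hj, Nat.mul_dvd_mul_left _ hd⟩) rfl
      · refine FractranProgram.halts_of_step ?_
        rw [toFractran, step_ofPairs (fractions_pos hp)]
        exact fracStep_fractions_of_noState hp fun i hi hd => h1 ⟨i, hi, hd⟩

theorem haltsFrom_of_halts_state {prog : List Instr} (hp : NoSelfJump 0 prog) {i w : ℕ}
    (hw0 : 0 < w) (hw : NoState prog.length w) (h : (toFractran prog).Halts (st i * w)) :
    HaltsFrom prog (i, contents w) := by
  obtain ⟨k, hk⟩ := h
  induction k generalizing i w with
  | zero => cases hk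
  | succ k ih =>
    rw [Function.iterate_succ_apply, Option.bind_some, toFractran,
      step_ofPairs (fractions_pos hp)] at hk
    rcases fracStep_fractions hp i hw0 hw with ⟨h, _⟩ | ⟨j, u, h, hu0, hu, hs⟩
    · exact ⟨_, .refl, h⟩
    · rw [hs] at hk
      obtain ⟨c', hr, hn⟩ := ih hu0 hu hk
      exact ⟨c', .head h hr, hn⟩

/-- If the Fractran program halts on all positive integers, then the machine halts on all inputs
in the register `r`. -/
theorem haltsFrom_of_halts {prog : List Instr} (hp : NoSelfJump 0 prog)
    (h : ∀ m, 0 < m → (toFractran prog).Halts m) (r x : ℕ) :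
    HaltsFrom prog (0, Function.update (fun _ => 0) r x) := by
  have h0 : 0 < reg r ^ x := pow_pos (prime_reg r).pos x
  have e := contents_mul_pow Nat.one_pos r x
  have e1 : contents 1 = fun _ => 0 := by funext s; simp [contents]
  rw [e1, Nat.one_mul, Nat.zero_add] at e
  rw [← e]
  exact haltsFrom_of_halts_state hp h0 (fun i _ => not_st_dvd_reg_pow i r x)
    (h _ (Nat.mul_pos (prime_st 0).pos h0))

end CounterMachine

/-! ### Fractran programs for `Π⁰₂` sets -/

namespace CounterMachine

open Cmd

/-- The machine is deterministic, so a single halting computation makes its starting configuration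
accessible. -/
theorem acc_of_haltsFrom {prog : List Instr} {c : ℕ × (ℕ → ℕ)} (h : HaltsFrom prog c) :
    Acc (fun b a => step prog a = some b) c := by
  obtain ⟨c', hr, hn⟩ := h
  induction hr using Relation.ReflTransGen.head_induction_on with
  | refl => exact ⟨_, fun b hb => by rw [hn] at hb; cases hb⟩
  | head hab _ ih =>
    refine ⟨_, fun b hb => ?_⟩
    rw [hab] at hb
    obtain rfl := Option.some.inj hb
    exact ih

/-- The body of the search: the register `2` is increased until the register `3`, the value
computed by `c` from the registers `0`, `1` and `2`, is not zero. -/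
def searchBody (c : Cmd) (n : ℕ) : Cmd :=
  -- The parameter `n` is restored in every round, so the search also works when it is entered with
  -- arbitrary registers.
  seq (clear 0) (seq (add 0 n) (seq (add 2 1) c))

/-- The machine that performs the search. -/
def search (c : Cmd) (n : ℕ) : List Instr :=
  (searchBody c n).compile 0 ++ [.dec 3 (c.size + 5) 0]

theorem size_searchBody (c : Cmd) (n : ℕ) : (searchBody c n).size = c.size + 4 := by
  simp only [searchBody, clear, size]
  omega

theorem length_search (c : Cmd) (n : ℕ) : (search c n).length = c.size + 5 := by
  rw [search, List.length_append, length_compile, size_searchBody]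
  rfl

theorem noSelfJump_search (c : Cmd) (n : ℕ) : NoSelfJump 0 (search c n) := by
  rw [search, noSelfJump_append, length_compile, size_searchBody]
  exact ⟨noSelfJump_compile _ _, ⟨by omega, by omega⟩, trivial⟩

theorem step_search_end (c : Cmd) (n : ℕ) (v : ℕ → ℕ) :
    step (search c n) (c.size + 4, v) =
      if v 3 = 0 then some (0, v) else some (c.size + 5, Function.update v 3 (v 3 - 1)) := by
  have h := step_at (prog := search c n) (pre := (searchBody c n).compile 0) (post := []) rfl v
  rwa [length_compile, size_searchBody] at h

theorem step_search_none (c : Cmd) (n i : ℕ) (hi : c.size + 5 ≤ i) (v : ℕ → ℕ) :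
    step (search c n) (i, v) = none := by
  rw [step, List.getElem?_eq_none (by rwa [length_search])]

/-- This is one round of the search. The candidate is increased before the test, and `c` preserves
the registers `0`, `1` and `2`. -/
theorem reaches_search {c : Cmd} (hc : c.WF) {p : ℕ → ℕ → ℕ → ℕ}
    (hv : ∀ v, c.eval v 3 = p (v 0) (v 1) (v 2) ∧ ∀ r < 3, c.eval v r = v r)
    (n : ℕ) (v : ℕ → ℕ) :
    ∃ v', Reaches (search c n) (0, v) (c.size + 4, v') ∧ v' 1 = v 1 ∧ v' 2 = v 2 + 1 ∧
      v' 3 = p n (v 1) (v 2 + 1) := by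
  have h := run (prog := search c n) (searchBody c n) ⟨⟨id, trivial⟩, trivial, trivial, hc⟩ []
    [.dec 3 (c.size + 5) 0] rfl v
  rw [size_searchBody, List.length_nil, Nat.zero_add] at h
  have e : (searchBody c n).eval v =
      c.eval ((add 2 1).eval ((add 0 n).eval ((clear 0).eval v))) := rfl
  rw [eval_clear] at e
  refine ⟨_, h, ?_⟩
  rw [e, (hv _).1, (hv _).2 1 (by omega), (hv _).2 2 (by omega)]
  simp [eval]

/-- From any address of the body the final test is reached by `exit`. If it fails, the search
restarts with some value `x` and some candidate in the registers. Both are arbitrary, but every `x`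
has a witness, and by monotonicity every larger candidate is one as well. -/
theorem haltsFrom_search {c : Cmd} (hc : c.WF) {p : ℕ → ℕ → ℕ → ℕ}
    (hv : ∀ v, c.eval v 3 = p (v 0) (v 1) (v 2) ∧ ∀ r < 3, c.eval v r = v r)
    {n : ℕ} (hmono : ∀ x k k', k ≤ k' → p n x k ≠ 0 → p n x k' ≠ 0)
    (h : ∀ x, ∃ k, p n x k ≠ 0) (a : ℕ × (ℕ → ℕ)) : HaltsFrom (search c n) a := by
  have hend : ∀ v, v 3 ≠ 0 → HaltsFrom (search c n) (c.size + 4, v) := fun v hv3 =>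
    ⟨_, .single (by rw [step_search_end, if_neg hv3]), step_search_none c n _ le_rfl _⟩
  have hstart : ∀ v, HaltsFrom (search c n) (0, v) := by
    intro v
    obtain ⟨k, hk⟩ := h (v 1)
    -- The number `d` bounds the rounds left until the candidate in the register `2` reaches the
    -- witness `k`.
    have key : ∀ d (u : ℕ → ℕ), u 1 = v 1 → k ≤ u 2 + d → HaltsFrom (search c n) (0, u) := by
      intro d
      induction d with
      | zero =>
        intro u h1 h2
        obtain ⟨u', hu, _, _, hu3⟩ := reaches_search hc hv n u
        obtain ⟨b, hb, hn⟩ := hend u' (by rw [hu3, h1]; exact hmono _ _ _ (by omega) hk)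
        exact ⟨b, hu.trans hb, hn⟩
      | succ d ih =>
        intro u h1 h2
        obtain ⟨u', hu, hu1, hu2, _⟩ := reaches_search hc hv n u
        by_cases hu3 : u' 3 = 0
        · obtain ⟨b, hb, hn⟩ := ih u' (by rw [hu1, h1]) (by omega)
          exact ⟨b, hu.trans (.head (by rw [step_search_end, if_pos hu3]) hb), hn⟩
        · obtain ⟨b, hb, hn⟩ := hend u' hu3
          exact ⟨b, hu.trans hb, hn⟩
    exact key k v rfl (Nat.le_add_left _ _)
  obtain ⟨i, v⟩ := a
  rcases Nat.lt_or_ge i (c.size + 5) with hi | hi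
  · obtain ⟨v', hr, _⟩ := exit (prog := search c n) (searchBody c n)
      ⟨⟨id, trivial⟩, trivial, trivial, hc⟩ [] [.dec 3 (c.size + 5) 0] rfl i
      (by rw [size_searchBody]; omega) v
    rw [size_searchBody, List.length_nil, Nat.zero_add, Nat.zero_add] at hr
    by_cases h3 : v' 3 = 0
    · obtain ⟨b, hb, hn⟩ := hstart v'
      exact ⟨b, hr.trans (.head (by rw [step_search_end, if_pos h3]) hb), hn⟩
    · obtain ⟨b, hb, hn⟩ := hend v' h3
      exact ⟨b, hr.trans hb, hn⟩
  · exact ⟨_, .refl, step_search_none c n i hi v⟩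

/-- Without a witness every round leads back to address `0` with the same `x`. As a round consists
of several steps, the contradiction uses accessibility for the transitive closure. -/
theorem exists_of_haltsFrom_search {c : Cmd} (hc : c.WF) {p : ℕ → ℕ → ℕ → ℕ}
    (hv : ∀ v, c.eval v 3 = p (v 0) (v 1) (v 2) ∧ ∀ r < 3, c.eval v r = v r)
    {n x : ℕ} {v : ℕ → ℕ} (hx : v 1 = x)
    (h : HaltsFrom (search c n) (0, v)) : ∃ k, p n x k ≠ 0 := by
  by_contra! hne
  have key : ∀ a, Acc (Relation.TransGen fun b a => step (search c n) a = some b) a →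
      a.1 = 0 → a.2 1 = x → False := by
    intro a ha
    induction ha with
    | intro a _ ih =>
      obtain ⟨i, u⟩ := a
      rintro rfl (h1 : u 1 = x)
      obtain ⟨u', hu, hu1, _, hu3⟩ := reaches_search hc hv n u
      have hs : step (search c n) (c.size + 4, u') = some (0, u') := by
        rw [step_search_end, if_pos (by rw [hu3, h1, hne])]
      exact ih (0, u') (Relation.transGen_swap.2 (Relation.TransGen.tail' hu hs)) rfl (hu1.trans h1)
  exact key _ (acc_of_haltsFrom h).transGen rfl hx

/-- The parameter enters through one instruction, at address `2`, and therefore through one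
exponent. All else is constant, so the reduction is primitive recursive in `n` without computing
primes. -/
theorem fractions_search (c : Cmd) :
    ∃ (A B : List (ℕ × ℕ)) (q : ℕ), ∀ n, fractions (search c n) =
      A ++ (st 3 * reg 0 ^ n, q) :: B := by
  refine ⟨kills (c.size + 5) ++ [(st 1, st 0 * reg 0), (st 2, st 0), (st 0 * reg 0 ^ 0, st 1)],
    instrFractions 3 ((search c 0).drop 3), st 2, fun n => ?_⟩
  rw [fractions, length_search, List.append_assoc]
  rfl

end CounterMachine

/-- Every `Π⁰₂` set is given by a primitive recursive function. -/
theorem IsPi02.exists_primrec {B : Set ℕ} (hB : IsPi02 B) : ∃ p : ℕ → ℕ → ℕ → ℕ,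
    Nat.Primrec' (fun v : List.Vector ℕ 3 => p (v.get 0) (v.get 1) (v.get 2)) ∧
    (∀ n x k k', k ≤ k' → p n x k ≠ 0 → p n x k' ≠ 0) ∧
    ∀ n, n ∈ B ↔ ∀ x, ∃ k, p n x k ≠ 0 := by
  obtain ⟨r, hr, hB⟩ := hB
  obtain ⟨f, hf, hrf⟩ := ComputablePred.computable_iff.1 hr
  have hrf' : ∀ n x y, r n x y ↔ f (n, x, y) = true := fun n x y => by
    exact iff_of_eq (congrFun hrf (n, x, y))
  let g : ℕ →. ℕ := fun a => Nat.rfind fun y => Part.some (f (a.unpair.1, a.unpair.2, y))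
  have hg : Partrec g := by
    refine Partrec.rfind (p := fun (a : ℕ) (y : ℕ) =>
      Part.some (f (a.unpair.1, a.unpair.2, y))) ?_
    exact (hf.comp (((Computable.fst.comp Computable.unpair).comp Computable.fst).pair
      (((Computable.snd.comp Computable.unpair).comp Computable.fst).pair Computable.snd))).partrec
  obtain ⟨c, hc⟩ := Nat.Partrec.Code.exists_code.1 (Partrec.nat_iff.1 hg)
  -- The decidable matrix is replaced by the test whether the search for `y` is completed by `evaln`
  -- with bound `k`, which is primitive recursive and monotone in `k`.
  have hp : Primrec fun v : ℕ × ℕ × ℕ =>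
      ((Nat.Partrec.Code.evaln v.2.2 c (Nat.pair v.1 v.2.1)).map fun _ => 1).getD 0 := by
    refine Primrec.option_getD.comp (Primrec.option_map (Nat.Partrec.Code.primrec_evaln.comp
      ((Primrec.pair (Primrec.snd.comp Primrec.snd) (.const c)).pair
        (Primrec₂.natPair.comp Primrec.fst (Primrec.fst.comp Primrec.snd))))
        (Primrec₂.const 1)) (.const 0)
  have hne : ∀ k m, ((Nat.Partrec.Code.evaln k c m).map fun _ => 1).getD 0 ≠ 0 ↔
      ∃ y, y ∈ Nat.Partrec.Code.evaln k c m := fun k m => by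
    cases Nat.Partrec.Code.evaln k c m <;> simp
  refine ⟨fun n x k => ((Nat.Partrec.Code.evaln k c (Nat.pair n x)).map fun _ => 1).getD 0,
    ?_, fun n x k k' hk h => ?_, fun n => ?_⟩
  · refine Nat.Primrec'.of_prim ?_
    have hget : ∀ i : Fin 3, Primrec fun v : List.Vector ℕ 3 => v.get i := fun i =>
      Primrec.vector_get.comp Primrec.id (.const i)
    exact hp.comp ((hget 0).pair ((hget 1).pair (hget 2)))
  · obtain ⟨y, hy⟩ := (hne _ _).1 h
    exact (hne _ _).2 ⟨y, Nat.Partrec.Code.evaln_mono hk hy⟩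
  · rw [hB]
    refine forall_congr' fun x => ?_
    have h1 : (∃ y, r n x y) ↔ (c.eval (Nat.pair n x)).Dom := by
      rw [hc]
      refine Iff.trans ?_ Nat.rfind_dom.symm
      refine exists_congr fun y => (hrf' n x y).trans ⟨fun h => ⟨?_, fun _ => trivial⟩, fun h => ?_⟩
      · rw [Nat.unpair_pair, h]
        exact Part.mem_some _
      · have := Part.mem_some_iff.1 h.1
        rw [Nat.unpair_pair] at this
        exact this.symm
    rw [h1, Part.dom_iff_mem]
    constructor
    · rintro ⟨y, hy⟩
      obtain ⟨k, hk⟩ := Nat.Partrec.Code.evaln_complete.1 hy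
      exact ⟨k, (hne _ _).2 ⟨y, hk⟩⟩
    · rintro ⟨k, hk⟩
      obtain ⟨y, hy⟩ := (hne _ _).1 hk
      exact ⟨y, Nat.Partrec.Code.evaln_sound hy⟩

/-- Every `Π⁰₂` set can be reduced to the totality problem for Fractran programs. -/
theorem IsPi02.exists_fractran {B : Set ℕ} (hB : IsPi02 B) :
    ∃ L : ℕ → List (ℕ × ℕ), Primrec L ∧
      ∀ n, n ∈ B ↔ ∀ m, 0 < m → (toProgram (L n)).Halts m := by
  obtain ⟨p, hp, hmono, hB⟩ := hB.exists_primrec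
  -- The inputs are the registers `0`, `1` and `2`, the output is the register `3`, and auxiliary
  -- registers start at `4`, as the search machine expects.
  obtain ⟨c, hc, -, hv⟩ := CounterMachine.computes_of_primrec hp (fun i => i) 3 4
    (fun i => by omega) (by omega) (fun i => by omega)
  have hv' : ∀ v, c.eval v 3 = p (v 0) (v 1) (v 2) ∧ ∀ r < 3, c.eval v r = v r := fun v => by
    refine ⟨?_, fun r hr => (hv v).2 r (by omega) (by omega)⟩
    rw [(hv v).1]
    simp only [List.Vector.get_ofFn]
    rfl
  obtain ⟨A, F, q, hF⟩ := CounterMachine.fractions_search c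
  -- Numerators and denominators are stored decreased by one, since `toProgram` adds one.
  refine ⟨fun n => (CounterMachine.fractions (CounterMachine.search c n)).map fun x =>
    (x.1.pred, x.2.pred), ?_, fun n => ?_⟩
  · simp only [hF]
    refine Primrec.list_map (Primrec.list_append.comp (.const A) (Primrec.list_cons.comp
      (Primrec.pair (Primrec.nat_mul.comp (.const _) ?_) (.const q)) (.const F)))
      (Primrec.pair (Primrec.pred.comp (Primrec.fst.comp Primrec.snd))
        (Primrec.pred.comp (Primrec.snd.comp Primrec.snd)))
    refine (Primrec.nat_rec₁ 1 (f := fun _ y => y * CounterMachine.reg 0)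
      (Primrec.nat_mul.comp Primrec.snd (.const _))).of_eq fun n => ?_
    induction n with
    | zero => rfl
    | succ n ih => rw [pow_succ, ← ih]
  · have e : toProgram ((CounterMachine.fractions (CounterMachine.search c n)).map fun x =>
        (x.1.pred, x.2.pred)) = CounterMachine.toFractran (CounterMachine.search c n) := by
      rw [toProgram, List.map_map]
      rfl
    rw [e, hB]
    constructor
    · intro h
      exact CounterMachine.halts_of_haltsFrom (CounterMachine.noSelfJump_search c n)
        (CounterMachine.haltsFrom_search hc hv' (hmono n) h)
    · intro h x
      exact CounterMachine.exists_of_haltsFrom_search hc hv' (Function.update_self ..)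
        (CounterMachine.haltsFrom_of_halts (CounterMachine.noSelfJump_search c n) h 1 x)

/-! ### The productivity problem -/

theorem FractranProgram.exists_codesOutermostFair (P : FractranProgram) :
    ∃ c : Nat.Partrec.Code, P.spec.CodesOutermostFair c :=
  let ⟨c, hc⟩ := LSF.exists_strategyCode
  ⟨c.curry (Encodable.encode (LSF.toks P.specRhs)), P.codesOutermostFair (hc _)⟩

theorem FractranProgram.productive_iff_halts (P : FractranProgram)
    {S : RState StreamLang → RState StreamLang → Prop} (hS : P.spec.IsStrategy S)
    (hf : P.spec.OutermostFair S) :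
    P.spec.Productive S LSF.const ↔ ∀ n : ℕ, 0 < n → P.Halts n :=
  ⟨fun h _ hn => P.halts_of_productive hS h hn, fun h => P.productive_of_halts hS hf h⟩

/-- All outermost-fair strategies agree on productivity, and at least one exists, so the quantifier
over strategies is not vacuous. -/
theorem FractranProgram.spec_mem_productiveFractranSpecs (P : FractranProgram) :
    P.spec ∈ productiveFractranSpecs ↔ ∀ n : ℕ, 0 < n → P.Halts n := by
  constructor
  · rintro ⟨-, h⟩
    obtain ⟨c, -, hS, hf⟩ := P.exists_codesOutermostFair
    exact (P.productive_iff_halts hS hf).1 (h _ hS hf)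
  · exact fun h => ⟨⟨P, rfl⟩, fun S hS hf => (P.productive_iff_halts hS hf).2 h⟩

/-! ### The upper bound and the completeness of the productivity problem -/

namespace ProgramCode

open Encodable

/-- The computation of a program after `k` steps. -/
def run (L : List (ℕ × ℕ)) (n k : ℕ) : Option ℕ :=
  (fun o : Option ℕ => o.bind (step L))^[k] (some n)

theorem halts_toProgram (L : List (ℕ × ℕ)) (n : ℕ) :
    (toProgram L).Halts n ↔ ∃ k, run L n k = none := by
  have h : (toProgram L).step = step L := funext (step_toProgram L)
  rw [FractranProgram.Halts, h]
  rfl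

theorem primrec_run : Primrec fun x : (List (ℕ × ℕ) × ℕ) × ℕ => run x.1.1 x.1.2 x.2 := by
  refine Primrec.nat_iterate Primrec.snd
    (Primrec.option_some.comp (Primrec.snd.comp Primrec.fst)) ?_
  exact Primrec.option_bind Primrec.snd (primrec_step.comp
    (Primrec.fst.comp (Primrec.fst.comp (Primrec.fst.comp Primrec.fst))) Primrec.snd)

/-- The pair of a program and a number that is coded by `x`. -/
def decodePair (x : ℕ) : List (ℕ × ℕ) × ℕ := (decode x).getD ([], 0)

theorem decodePair_encode (y : List (ℕ × ℕ) × ℕ) : decodePair (encode y) = y := by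
  rw [decodePair, encodek, Option.getD_some]

theorem primrec_decodePair : Primrec decodePair :=
  Primrec.option_getD.comp Primrec.decode (.const _)

end ProgramCode

theorem encode_mem_iff {R : TRS StreamLang} :
    Encodable.encode R ∈ Encodable.encode '' productiveFractranSpecs ↔
      R ∈ productiveFractranSpecs :=
  Encodable.encode_injective.mem_set_image

-- Different programs may induce the same specification. By `spec_mem_productiveFractranSpecs` they
-- either all halt everywhere or none of them does, so one may quantify over all programs with the
-- given specification.
open ProgramCode in
theorem isPi02_productiveFractranSpecs : IsPi02 (Encodable.encode '' productiveFractranSpecs) := by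
  -- The witness `y` contains a program showing that `e` codes an induced specification, and a
  -- running time. The challenge `x` contains a program and an input, and counts only if its program
  -- has the same specification. Inputs are shifted by one to be positive.
  refine ⟨fun e x y => spec (decodePair y).1 = e ∧ (spec (decodePair x).1 = e →
    run (decodePair x).1 ((decodePair x).2 + 1) (decodePair y).2 = none), ?_, fun e => ?_⟩
  · have h1 : Primrec fun v : ℕ × ℕ × ℕ => decodePair v.2.1 :=
      primrec_decodePair.comp (Primrec.fst.comp Primrec.snd)
    have h2 : Primrec fun v : ℕ × ℕ × ℕ => decodePair v.2.2 :=
      primrec_decodePair.comp (Primrec.snd.comp Primrec.snd)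
    have h3 : PrimrecPred fun v : ℕ × ℕ × ℕ => spec (decodePair v.2.2).1 = v.1 :=
      Primrec.eq.comp (primrec_spec.comp (Primrec.fst.comp h2)) Primrec.fst
    have h4 : PrimrecPred fun v : ℕ × ℕ × ℕ => spec (decodePair v.2.1).1 = v.1 :=
      Primrec.eq.comp (primrec_spec.comp (Primrec.fst.comp h1)) Primrec.fst
    have h5 : PrimrecPred fun v : ℕ × ℕ × ℕ =>
        run (decodePair v.2.1).1 ((decodePair v.2.1).2 + 1) (decodePair v.2.2).2 = none :=
      Primrec.eq.comp (primrec_run.comp (((Primrec.fst.comp h1).pair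
        (Primrec.succ.comp (Primrec.snd.comp h1))).pair (Primrec.snd.comp h2))) (.const none)
    obtain ⟨_, h⟩ := h3.and (h4.not.or h5)
    refine ComputablePred.computable_iff.2 ⟨_, h.to_comp, ?_⟩
    funext v
    simp only [decide_eq_true_eq, imp_iff_not_or]
  · constructor
    · rintro ⟨R, hR, rfl⟩ x
      obtain ⟨P, rfl⟩ := hR.1
      obtain ⟨L, rfl⟩ := toProgram_surjective P
      by_cases hx : spec (decodePair x).1 = Encodable.encode (toProgram L).spec
      · have e : (toProgram (decodePair x).1).spec = (toProgram L).spec :=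
          Encodable.encode_injective ((encode_spec _).trans hx)
        rw [← e, FractranProgram.spec_mem_productiveFractranSpecs] at hR
        obtain ⟨k, hk⟩ := (halts_toProgram _ _).1 (hR ((decodePair x).2 + 1) (Nat.succ_pos _))
        refine ⟨Encodable.encode (L, k), ?_⟩
        beta_reduce
        rw [decodePair_encode]
        exact ⟨(encode_spec L).symm, fun _ => hk⟩
      · refine ⟨Encodable.encode (L, 0), ?_⟩
        beta_reduce
        rw [decodePair_encode]
        exact ⟨(encode_spec L).symm, fun h => absurd h hx⟩
    · intro h
      -- Any challenge produces a program with the specification `e`; its inputs are then used as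
      -- challenges.
      obtain ⟨y, hy, -⟩ := h 0
      rw [← encode_spec] at hy
      rw [← hy, encode_mem_iff, FractranProgram.spec_mem_productiveFractranSpecs]
      intro n hn
      obtain ⟨z, -, hz⟩ := h (Encodable.encode ((decodePair y).1, n - 1))
      rw [decodePair_encode, ← encode_spec, Nat.sub_add_cancel hn] at hz
      exact (halts_toProgram _ _).2 ⟨_, hz hy⟩

theorem IsPi02.preimage {A : Set ℕ} (hA : IsPi02 A) {f : ℕ → ℕ} (hf : Computable f) :
    IsPi02 (f ⁻¹' A) := by
  obtain ⟨r, hr, h⟩ := hA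
  obtain ⟨g, hg, e⟩ := ComputablePred.computable_iff.1 hr
  refine ⟨fun n => r (f n), ComputablePred.computable_iff.2
    ⟨_, hg.comp ((hf.comp Computable.fst).pair Computable.snd), ?_⟩, fun n => h (f n)⟩
  funext v
  exact congrFun e (f v.1, v.2)

/-- The answer does not depend on the strategy in the instance and can be read off from the system
alone. -/
theorem mem_productivityYes_iff {x : TRS StreamLang × Nat.Partrec.Code × RTerm StreamLang}
    (hx : x ∈ fractranInstances) : x ∈ productivityYes ↔ x.1 ∈ productiveFractranSpecs := by
  obtain ⟨R, c, t⟩ := x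
  obtain ⟨⟨-, -, hS, hf⟩, P, rfl, rfl⟩ := hx
  exact (P.productive_iff_halts hS hf).trans P.spec_mem_productiveFractranSpecs.symm

theorem isPi02CompleteProblem_fractranInstances :
    IsPi02CompleteProblem fractranInstances productivityYes := by
  constructor
  · refine ⟨_, isPi02_productiveFractranSpecs.preimage (f := fun m => m.unpair.1)
      (Primrec.fst.comp Primrec.unpair).to_comp, fun x hx => ?_⟩
    have e : Encodable.encode x = Nat.pair (Encodable.encode x.1) (Encodable.encode x.2) := rfl
    rw [mem_productivityYes_iff hx, Set.mem_preimage, e, Nat.unpair_pair, encode_mem_iff]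
  · intro B hB
    obtain ⟨L, hL, hBL⟩ := hB.exists_fractran
    -- One code serves all programs; currying it with the right-hand side gives the strategy of the
    -- instance computably in `n`.
    obtain ⟨c, hc⟩ := LSF.exists_strategyCode
    have hinst : ∀ n, ((toProgram (L n)).spec,
        c.curry (Encodable.encode (ProgramCode.specRhs (L n))), LSF.const) ∈
          fractranInstances := fun n =>
      ⟨⟨⟨by simp [FractranProgram.spec, FractranProgram.specSig], fun i => i.elim0⟩,
        (toProgram (L n)).codesOutermostFair fun m => by
          rw [ProgramCode.toks_specRhs]
          exact hc _ m⟩, _, rfl, rfl⟩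
    refine ⟨fun n => ((toProgram (L n)).spec,
      c.curry (Encodable.encode (ProgramCode.specRhs (L n))), LSF.const), ?_, fun n =>
        ⟨hinst n, ?_⟩⟩
    · have h : Primrec fun n => Nat.pair (ProgramCode.spec (L n)) (Nat.pair
          (Encodable.encode (c.curry (Encodable.encode (ProgramCode.specRhs (L n)))))
          (Encodable.encode LSF.const)) :=
        Primrec₂.natPair.comp (ProgramCode.primrec_spec.comp hL) (Primrec₂.natPair.comp
          (Primrec.encode.comp (Nat.Partrec.Code.primrec₂_curry.comp (.const c)
            (Primrec.encode.comp (ProgramCode.primrec_specRhs.comp hL)))) (.const _))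
      refine h.to_comp.of_eq fun n => ?_
      rw [← ProgramCode.encode_spec]
      rfl
    · rw [mem_productivityYes_iff (hinst n), hBL,
        FractranProgram.spec_mem_productiveFractranSpecs]

theorem isPi02Complete_productiveFractranSpecs :
    IsPi02Complete (Encodable.encode '' productiveFractranSpecs) := by
  refine ⟨isPi02_productiveFractranSpecs, fun B hB => ?_⟩
  obtain ⟨L, hL, hBL⟩ := hB.exists_fractran
  refine ⟨fun n => ProgramCode.spec (L n), (ProgramCode.primrec_spec.comp hL).to_comp, fun n => ?_⟩
  beta_reduce
  rw [hBL, ← ProgramCode.encode_spec, encode_mem_iff,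
    FractranProgram.spec_mem_productiveFractranSpecs]

theorem mainTheorem2 :
    -- the induced specifications are in the lazy stream format, computable outermost-fair
    -- strategies for them exist, and productivity is equivalent to halting
    (∀ P : FractranProgram,
      LSF.InFormat P.spec ∧
      (∃ c : Nat.Partrec.Code, P.spec.CodesOutermostFair c) ∧
      ∀ S : RState StreamLang → RState StreamLang → Prop,
        P.spec.IsStrategy S → P.spec.OutermostFair S →
          (P.spec.Productive S LSF.const ↔ ∀ n : ℕ, 0 < n → P.Halts n)) ∧
    -- the productivity problem, restricted to these specifications, with the strategy as a
    -- part of the instance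
    IsPi02CompleteProblem fractranInstances productivityYes ∧
    -- the same with respect to all outermost-fair strategies
    IsPi02Complete (Encodable.encode '' productiveFractranSpecs) := by
  exact ⟨fun P => ⟨P.inFormat_spec, P.exists_codesOutermostFair,
    fun _ hS hf => P.productive_iff_halts hS hf⟩,
    isPi02CompleteProblem_fractranInstances, isPi02Complete_productiveFractranSpecs⟩
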